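/- **Setting.** Let $m$ learners minimize $F(\theta)=\frac1m\sum_{i=1}^m f_i(\theta)$ over $\theta\in\mathbb R^n$, where $f_i(\theta)=\mathbb E_{\xi\sim\mathcal P_i}[l(\theta,\xi)]$ is well defined and $l$ is differentiable in $\theta$. At each time $t=0,1,2,\dots$ learner $i$ receives a data point $\xi_{i,t}\sim\mathcal P_i$; the data are independent across $t$. With $z_{i,0}=e_i\in\mathbb R^m$, arbitrary $\theta_{i,0},s_{i,0}\in\mathbb R^n$, stepsize $\lambda_t=\lambda_0/(t+1)^v$ and $\nabla f_{i,t}(\theta)=\frac1{t+1}\sum_{k=0}^t\nabla l(\theta,\xi_{i,k})$, the algorithm is $$s_{i,t+1}=(1+C_{ii})s_{i,t}+\sum_{j:C_{ij}>0}C_{ij}(s_{j,t}+\zeta_{j,t})+\lambda_t\nabla f_{i,t}(\theta_{i,t}),$$ $$\theta_{i,t+1}=(1+R_{ii})\theta_{i,t}+\sum_{j:R_{ij}>0}R_{ij}(\theta_{j,t}+\vartheta_{j,t})-\frac{s_{i,t+1}-s_{i,t}}{m[z_{i,t}]_i},\qquad z_{i,t+1}=z_{i,t}+\sum_{j:R_{ij}>0}R_{ij}(z_{j,t}-z_{i,t}).$$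 **Assumptions.** 1. $R,C\in\mathbb R^{m\times m}$ have nonnegative off-diagonal entries, diagonal entries in $(-1,0)$, and $R\mathbf 1=0$, $\mathbf 1^TC=0^T$. With an arrow from $j$ to $i$ in the graph of $W$ when $W_{ij}>0$, the graph of $R$ is strongly connected and the graph of $C^T$ contains a directed spanning tree. 2. $F$ has a minimizer $\theta^*$; $\|\nabla f_i(\theta)\|_2\le D$ for all $i,\theta$; and for all $\theta_1,\theta_2\in\mathbb R^n$ there is $\mu\ge0$ with $F(\theta_2)\ge F(\theta_1)+\nabla F(\theta_1)^T(\theta_2-\theta_1)+\frac\mu2\|\theta_1-\theta_2\|_2^2$. The case "$\mu>0$" means that for all $\theta_1,\theta_2$ this holds with some $\mu>0$ (possibly depending on $\theta_1,\theta_2$). 3. For $\xi\sim\mathcal P_i$ and all $\theta$: $\mathbb E[\nabla l(\theta,\xi)]=\nabla f_i(\theta)$ and $\mathbb E\|\nabla l(\theta,\xi)-\nabla f_i(\theta)\|_2^2\le\kappa^2$; moreover $\nabla l(\cdot,\xi)$ is $L$-Lipschitz for every data point $\xi$. 4. $\lambda_0>0$, $v\in(\frac12,1)$. The coordinates of $\zeta_{i,t}$,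 $\vartheta_{i,t}$ have the Laplace distributions $\mathrm{Lap}(\nu_{i,t,\zeta})$, $\mathrm{Lap}(\nu_{i,t,\vartheta})$ with $2\nu_{i,t,\zeta}^2=\sigma_{i,t,\zeta}^2$, $2\nu_{i,t,\vartheta}^2=\sigma_{i,t,\vartheta}^2$, $\sigma_{i,t,\zeta}=\sigma_{i,0,\zeta}/(t+1)^{\varsigma_{i,\zeta}}$, $\sigma_{i,t,\vartheta}=\sigma_{i,0,\vartheta}/(t+1)^{\varsigma_{i,\vartheta}}$, $\sigma_{i,0,\zeta},\sigma_{i,0,\vartheta}>0$, $\varsigma_{i,\zeta},\varsigma_{i,\vartheta}\in(\frac12,1)$ and $\max_i\{\varsigma_{i,\zeta},\varsigma_{i,\vartheta}\}<v$. For each learner and time these $2n$ coordinates are independent; the noises are independent across time and independent of the data. 5. There is $c_l>0$ with $\|\nabla l(\theta,\xi)\|_1\le c_l$ for all $\theta$ and all data points $\xi$. **Privacy notions.** Two local data sequences are adjacent if they differ in exactly one entry. The implementation of learner $i$ up to time $T$ maps its local data and the messages it receives to the random sequence $(s_{i,t}+\zeta_{i,t},\theta_{i,t}+\vartheta_{i,t})_{0\le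 t\le T}$; it is $\epsilon$-LDP if for all adjacent data, all received messages and all measurable sets $\mathcal O$ of outputs, $\mathbb P[\text{output}\in\mathcal O]\le e^\epsilon\,\mathbb P[\text{output}'\in\mathcal O]$. The sensitivities $\Delta_{i,t,s}$, $\Delta_{i,t,\theta}$ are the suprema, over adjacent data and common received messages, of the $\ell^1$-distances of the two values of $s_{i,t}$, respectively $\theta_{i,t}$. Put $\epsilon_{i,s}(T)=\sum_{t=1}^T\Delta_{i,t,s}/\nu_{i,t,\zeta}$ and $\epsilon_{i,\theta}(T)=\sum_{t=1}^T\Delta_{i,t,\theta}/\nu_{i,t,\vartheta}$. **Theorem.** Under Assumptions 1–5, for every learner $i$: in the case $\mu>0$, $\mathbb E\|\theta_{i,t}-\theta^*\|_2^2\to0$ as $t\to\infty$; and in the general convex case, $\mathbb E[F(\theta_{i,t})-F(\theta^*)]\to0$. Moreover, $I+R$ has a unique positive left eigenvector $u^T$ for the eigenvalue $1$ with $u^T\mathbf 1=m$, there are $c_z>0$, $\gamma_z\in(0,1)$ with $\big|\frac1{m[z_{j,t}]_j}-\frac1{u_j}\big|\le c_z\gamma_z^t$ for all $j,t$, and, for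 all such constants: 1. For every finite $T$, the implementation of learner $i$ up to time $T$ is $\epsilon_i$-LDP with $\epsilon_i=\epsilon_{i,s}(T)+\epsilon_{i,\theta}(T)$, where $$\epsilon_{i,s}(T)\le\sum_{t=1}^T\frac{\sqrt2\,\varrho_{t,s}(t+1)^{\varsigma_{i,\zeta}}}{\sigma_{i,0,\zeta}},\qquad \epsilon_{i,\theta}(T)\le\sum_{t=1}^T\frac{\sqrt2\,\varrho_{t,\theta}(t+1)^{\varsigma_{i,\vartheta}}}{\sigma_{i,0,\vartheta}},$$ $\varrho_{0,s}=0$, $\varrho_{t,s}=2c_l\sum_{p=1}^t(1-\min_j|C_{jj}|)^{t-p}\lambda_{p-1}$ and $\varrho_{t,\theta}=\sum_{q=1}^t(1-\min_j|R_{jj}|)^{t-q}\big(c_z\gamma_z^{q-1}+\frac1{|u_i|}\big)(\varrho_{q,s}+\varrho_{q-1,s})$. 2. The cumulative budget stays finite: $\sup_T\big(\epsilon_{i,s}(T)+\epsilon_{i,\theta}(T)\big)<\infty$, and for every $T$ the implementation of learner $i$ up to time $T$ is LDP with this supremum as budget. -/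

import Mathlib

open MeasureTheory ProbabilityTheory Filter Topology
open scoped ENNReal

noncomputable section

namespace OnlineLDP

/-- The parameter space `ℝⁿ` with its Euclidean norm. -/
abbrev Vec (n : ℕ) : Type := EuclideanSpace ℝ (Fin n)

/-- The `ℓ¹` norm of a vector. -/
def l1norm {n : ℕ} (x : Vec n) : ℝ := ∑ k, |x k|

/-! ### Communication graphs -/

/-- In-neighbours of `i` in the graph induced by `W`: the learners `j` with `W i j > 0`, i.e. those
whose messages `i` receives. -/
def inNbrs {m : ℕ} (W : Matrix (Fin m) (Fin m) ℝ) (i : Fin m) : Finset (Fin m) :=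
  open Classical in Finset.univ.filter (fun j => 0 < W i j)

/-- There is an arrow from `j` to `i` in the graph induced by `W`: `i` receives messages
from `j`. -/
def Arrow {m : ℕ} (W : Matrix (Fin m) (Fin m) ℝ) (j i : Fin m) : Prop := 0 < W i j

/-- Between any two distinct nodes there is a directed path. -/
def StronglyConnected {m : ℕ} (W : Matrix (Fin m) (Fin m) ℝ) : Prop :=
  ∀ i j : Fin m, i ≠ j → Relation.TransGen (Arrow W) i j

/-- The graph contains a directed spanning tree: there are a root `r` and a parent map along arrows
of the graph such that every node is led to `r` by iterating the parent map. -/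
def HasSpanningTree {m : ℕ} (W : Matrix (Fin m) (Fin m) ℝ) : Prop :=
  ∃ (r : Fin m) (parent : Fin m → Fin m),
    (∀ i, i ≠ r → Arrow W (parent i) i) ∧ ∀ i, ∃ k : ℕ, parent^[k] i = r

/-- The standing assumption on the coupling matrices `R` and `C`. The entries of `I + R` and `I + C`
on the diagonal are positive. -/
structure CouplingAssumption {m : ℕ} (R C : Matrix (Fin m) (Fin m) ℝ) : Prop where
  R_offdiag : ∀ i j, i ≠ j → 0 ≤ R i j
  C_offdiag : ∀ i j, i ≠ j → 0 ≤ C i j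
  R_diag : ∀ i, R i i = -∑ j ∈ inNbrs R i, R i j
  C_diag : ∀ i, C i i = -∑ j ∈ inNbrs C.transpose i, C j i
  R_diag_neg : ∀ i, R i i < 0
  C_diag_neg : ∀ i, C i i < 0
  R_diag_gt : ∀ i, -1 < R i i
  C_diag_gt : ∀ i, -1 < C i i
  R_conn : StronglyConnected R
  C_tree : HasSpanningTree C.transpose

/-- `u` is a positive left eigenvector of `I + R` for the eigenvalue `1`, with entries summing
to `m`. -/
def IsLeftPerron {m : ℕ} (R : Matrix (Fin m) (Fin m) ℝ) (u : Fin m → ℝ) : Prop :=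
  (∀ i, 0 < u i) ∧ Matrix.vecMul u (1 + R) = u ∧ ∑ i, u i = m

/-- The local estimates `z i t ∈ ℝᵐ` of the left eigenvector. -/
def zEst {m : ℕ} (R : Matrix (Fin m) (Fin m) ℝ) : ℕ → Fin m → (Fin m → ℝ)
  | 0 => fun i => Pi.single i 1
  | t + 1 => fun i =>
      zEst R t i + ∑ j ∈ inNbrs R i, R i j • (zEst R t j - zEst R t i)

/-- `cz > 0` and `γz ∈ (0,1)` are constants of a geometric rate for the eigenvector estimates:
`|1 / (m [z i t]_i) - 1 / u i| ≤ cz γz ^ t` for all learners and times. -/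
def IsEigenRate {m : ℕ} (R : Matrix (Fin m) (Fin m) ℝ) (u : Fin m → ℝ) (cz γz : ℝ) : Prop :=
  0 < cz ∧ 0 < γz ∧ γz < 1 ∧
    ∀ (i : Fin m) (t : ℕ), |1 / ((m : ℝ) * zEst R t i i) - 1 / u i| ≤ cz * γz ^ t

/-! ### The algorithm -/

/-- Parameters of the algorithm: coupling matrices, loss function (for a data space `Ξ`),
stepsize parameters, and initial values of `θ` and `s`. -/
structure Algo (m n : ℕ) (Ξ : Type*) where
  R : Matrix (Fin m) (Fin m) ℝ
  C : Matrix (Fin m) (Fin m) ℝ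
  loss : Vec n → Ξ → ℝ
  lam0 : ℝ
  v : ℝ
  s0 : Fin m → Vec n
  θ0 : Fin m → Vec n

namespace Algo

variable {m n : ℕ} {Ξ : Type*}

/-- The stepsize `λ_t = λ_0 / (t + 1) ^ v`. -/
def lam (A : Algo m n Ξ) (t : ℕ) : ℝ := A.lam0 / ((t : ℝ) + 1) ^ A.v

/-- The gradient `∇l(θ, ξ)` of the loss in `θ`. -/
def gradLoss (A : Algo m n Ξ) (θ : Vec n) (ξ : Ξ) : Vec n := gradient (fun x => A.loss x ξ) θ

/-- The empirical gradient at `θ` built from the data points `D 0, …, D t`. -/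
def empGrad (A : Algo m n Ξ) (D : ℕ → Ξ) (t : ℕ) (θ : Vec n) : Vec n :=
  (1 / ((t : ℝ) + 1)) • ∑ k ∈ Finset.range (t + 1), A.gradLoss θ (D k)

/-- One iteration, at time `t`, of learner `i` with data stream `D`, when the messages it receives
are `a j` (noisy tracking variables) and `b j` (noisy model parameters);
`x = (s_{i,t}, θ_{i,t})`. -/
def step (A : Algo m n Ξ) (i : Fin m) (D : ℕ → Ξ) (t : ℕ) (a b : Fin m → Vec n)
    (x : Vec n × Vec n) : Vec n × Vec n :=
  let s' : Vec n := (1 + A.C i i) • x.1 + ∑ j ∈ inNbrs A.C i, A.C i j • a j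
    + A.lam t • A.empGrad D t x.2
  let θ' : Vec n := (1 + A.R i i) • x.2 + ∑ j ∈ inNbrs A.R i, A.R i j • b j
    - (1 / ((m : ℝ) * zEst A.R t i i)) • (s' - x.1)
  (s', θ')

/-- The joint evolution `(s_{i,t}, θ_{i,t})` of all learners, for data streams `D i` and noises
`ζ i t`, `ϑ i t`. -/
def network (A : Algo m n Ξ) (D : Fin m → ℕ → Ξ) (ζ ϑ : Fin m → ℕ → Vec n) :
    ℕ → Fin m → Vec n × Vec n
  | 0 => fun i => (A.s0 i, A.θ0 i)
  | t + 1 => fun i =>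
      A.step i (D i) t (fun j => (network A D ζ ϑ t j).1 + ζ j t)
        (fun j => (network A D ζ ϑ t j).2 + ϑ j t) (network A D ζ ϑ t i)

/-- The internal variables `(s_{i,t}, θ_{i,t})` of learner `i` as a function of its data stream `D`
and of all messages it receives: `msg.1 t j` and `msg.2 t j` are the noisy tracking variable and
the noisy model parameter received from `j` at time `t`. -/
def learner (A : Algo m n Ξ) (i : Fin m) (D : ℕ → Ξ)
    (msg : (ℕ → Fin m → Vec n) × (ℕ → Fin m → Vec n)) : ℕ → Vec n × Vec n
  | 0 => (A.s0 i, A.θ0 i)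
  | t + 1 => A.step i D t (msg.1 t) (msg.2 t) (learner A i D msg t)

/-- The implementation of learner `i` up to time `T`: everything it sends at times `0, …, T`, that is
`(s_{i,t} + ζ_{i,t}, θ_{i,t} + ϑ_{i,t})`, as a function of its data, of the messages it receives
and of the outcome `ω` on which its noises `ζ`, `ϑ` depend. -/
def implementation {Ω : Type*} (A : Algo m n Ξ) (i : Fin m) (ζ ϑ : ℕ → Ω → Vec n) (T : ℕ)
    (D : ℕ → Ξ) (msg : (ℕ → Fin m → Vec n) × (ℕ → Fin m → Vec n)) (ω : Ω) :
    Fin (T + 1) → Vec n × Vec n :=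
  fun t => ((A.learner i D msg t).1 + ζ t ω, (A.learner i D msg t).2 + ϑ t ω)

/-- The local objective `f_i(θ) = E_{ξ ∼ Q i} l(θ, ξ)`. -/
def localObj [MeasurableSpace Ξ] (A : Algo m n Ξ) (Q : Fin m → Measure Ξ) (i : Fin m)
    (θ : Vec n) : ℝ := ∫ ξ, A.loss θ ξ ∂(Q i)

/-- The global objective `F = (1/m) ∑ f_i`. -/
def obj [MeasurableSpace Ξ] (A : Algo m n Ξ) (Q : Fin m → Measure Ξ) (θ : Vec n) : ℝ :=
  (1 / (m : ℝ)) * ∑ i, A.localObj Q i θ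

end Algo

/-! ### Adjacency, local differential privacy and sensitivity -/

/-- Two data streams are adjacent if they differ in exactly one entry. (What is sent up to a time
`T` depends only on finitely many entries of the stream, so nothing changes if the streams are cut
off at `T`.) -/
def Adjacent {Ξ : Type*} (D D' : ℕ → Ξ) : Prop :=
  ∃ k, D k ≠ D' k ∧ ∀ t, t ≠ k → D t = D' t

/-- `ε`-local differential privacy of a randomized implementation `impl`, a function of the local
data, of the received messages and of the outcome. -/
def IsLDP {Ω Ξ M Out : Type*} [MeasurableSpace Ω] [MeasurableSpace Out] (P : Measure Ω)
    (impl : (ℕ → Ξ) → M → Ω → Out) (ε : ℝ) : Prop :=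
  ∀ D D' : ℕ → Ξ, Adjacent D D' → ∀ msg : M, ∀ O : Set Out, MeasurableSet O →
    P {ω | impl D msg ω ∈ O} ≤ ENNReal.ofReal (Real.exp ε) * P {ω | impl D' msg ω ∈ O}

namespace Algo

variable {m n : ℕ} {Ξ : Type*}

/-- Sensitivity `Δ_{i,t,s}` of the shared variable `s_{i,t}`: the supremum over adjacent data streams,
with the same received messages, of the `ℓ¹` distance (with value `∞` if unbounded). -/
def sensS (A : Algo m n Ξ) (i : Fin m) (t : ℕ) : ℝ≥0∞ :=
  ⨆ (D : ℕ → Ξ) (D' : ℕ → Ξ) (_ : Adjacent D D')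
    (msg : (ℕ → Fin m → Vec n) × (ℕ → Fin m → Vec n)),
    ENNReal.ofReal (l1norm ((A.learner i D msg t).1 - (A.learner i D' msg t).1))

/-- Sensitivity `Δ_{i,t,θ}` of the shared variable `θ_{i,t}`. -/
def sensθ (A : Algo m n Ξ) (i : Fin m) (t : ℕ) : ℝ≥0∞ :=
  ⨆ (D : ℕ → Ξ) (D' : ℕ → Ξ) (_ : Adjacent D D')
    (msg : (ℕ → Fin m → Vec n) × (ℕ → Fin m → Vec n)),
    ENNReal.ofReal (l1norm ((A.learner i D msg t).2 - (A.learner i D' msg t).2))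

/-- `ϱ_{t,s}`, the explicit bound on the sensitivity of `s_{i,t}`. -/
def rhoS (A : Algo m n Ξ) (cl : ℝ) (t : ℕ) : ℝ :=
  2 * cl * ∑ p ∈ Finset.Icc 1 t, (1 - ⨅ j, |A.C j j|) ^ (t - p) * A.lam (p - 1)

/-- `ϱ_{t,θ}`, the explicit bound on the sensitivity of `θ_{i,t}`; `ui` is `u_i`. -/
def rhoθ (A : Algo m n Ξ) (cl cz γz ui : ℝ) (t : ℕ) : ℝ :=
  ∑ q ∈ Finset.Icc 1 t, (1 - ⨅ j, |A.R j j|) ^ (t - q) * (cz * γz ^ (q - 1) + 1 / |ui|)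
    * (A.rhoS cl q + A.rhoS cl (q - 1))

end Algo

/-! ### Laplace noise -/

/-- The Laplace distribution `Lap(ν)` on `ℝ`. -/
def laplace (ν : ℝ) : Measure ℝ :=
  volume.withDensity (fun x => ENNReal.ofReal (1 / (2 * ν) * Real.exp (-|x| / ν)))

/-- The standard deviation `σ_t = σ_0 / (t + 1) ^ ς`. -/
def noiseStd (σ0 ς : ℝ) (t : ℕ) : ℝ := σ0 / ((t : ℝ) + 1) ^ ς

/-- The Laplace parameter `ν_t > 0` with `σ_t² = 2 ν_t²`. -/
def noiseScale (σ0 ς : ℝ) (t : ℕ) : ℝ := noiseStd σ0 ς t / √2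

/-- Cumulative budget `∑_{t=1}^T Δ_t / ν_t` of a shared variable with sensitivities `Δ_t` and
Laplace parameters `ν_t`. -/
def budget (Δ : ℕ → ℝ≥0∞) (ν : ℕ → ℝ) (T : ℕ) : ℝ≥0∞ :=
  ∑ t ∈ Finset.Icc 1 T, Δ t / ENNReal.ofReal (ν t)

/-- Parameters of the noises: initial standard deviations and decay rates. -/
structure NoiseParams (m : ℕ) where
  σζ : Fin m → ℝ
  σϑ : Fin m → ℝ
  ςζ : Fin m → ℝ
  ςϑ : Fin m → ℝ

/-! ### Standing assumptions -/

/-- Stepsize `λ_0 > 0`, `v ∈ (1/2, 1)`; noise parameters `σ_0 > 0`, `ς ∈ (1/2, 1)` with `ς < v`. -/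
structure RateAssumption {m : ℕ} (lam0 v : ℝ) (N : NoiseParams m) : Prop where
  lam0_pos : 0 < lam0
  v_gt : 1 / 2 < v
  v_lt : v < 1
  σζ_pos : ∀ i, 0 < N.σζ i
  σϑ_pos : ∀ i, 0 < N.σϑ i
  ςζ_mem : ∀ i, N.ςζ i ∈ Set.Ioo (1 / 2 : ℝ) 1
  ςϑ_mem : ∀ i, N.ςϑ i ∈ Set.Ioo (1 / 2 : ℝ) 1
  ςζ_lt : ∀ i, N.ςζ i < v
  ςϑ_lt : ∀ i, N.ςϑ i < v

/-- Well-posedness of the loss, and the assumptions on the stochastic gradients: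
unbiasedness, variance at most `κ²`, and `L`-Lipschitz continuity. -/
structure GradientAssumption {m n : ℕ} {Ξ : Type*} [MeasurableSpace Ξ] (A : Algo m n Ξ)
    (Q : Fin m → Measure Ξ) (κ L : ℝ) : Prop where
  meas : ∀ θ, Measurable (A.loss θ)
  integrable : ∀ i θ, Integrable (A.loss θ) (Q i)
  diff : ∀ ξ, Differentiable ℝ (fun θ => A.loss θ ξ)
  unbiased : ∀ i θ, Integrable (A.gradLoss θ) (Q i) ∧
    ∫ ξ, A.gradLoss θ ξ ∂(Q i) = gradient (A.localObj Q i) θ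
  variance : ∀ i θ,
    ∫⁻ ξ, ENNReal.ofReal (‖A.gradLoss θ ξ - gradient (A.localObj Q i) θ‖ ^ 2) ∂(Q i)
      ≤ ENNReal.ofReal (κ ^ 2)
  lipschitz : ∀ ξ θ₁ θ₂, ‖A.gradLoss θ₁ ξ - A.gradLoss θ₂ ξ‖ ≤ L * ‖θ₁ - θ₂‖

/-- The lower bound of `F` by its linearization at `θ₁` plus `(μ/2) ‖θ₁ - θ₂‖²`. -/
def ConvexityBound {n : ℕ} (F : Vec n → ℝ) (μ : ℝ) (θ₁ θ₂ : Vec n) : Prop :=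
  F θ₁ + inner ℝ (gradient F θ₁) (θ₂ - θ₁) + μ / 2 * ‖θ₁ - θ₂‖ ^ 2 ≤ F θ₂

/-- The data points `ξ i t` have law `Q i` and are independent across iterations. -/
structure DataAssumption {m : ℕ} {Ω Ξ : Type*} [MeasurableSpace Ω] [MeasurableSpace Ξ]
    (P : Measure Ω) (Q : Fin m → Measure Ξ) (ξ : Fin m → ℕ → Ω → Ξ) : Prop where
  meas : ∀ i t, Measurable (ξ i t)
  law : ∀ i t, P.map (ξ i t) = Q i
  indep : iIndepFun (fun (t : ℕ) (ω : Ω) (i : Fin m) => ξ i t ω) P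

/-- The coordinates of the noises `ζ i t` and `ϑ i t` have Laplace distributions with parameters
`ν_{i,t,ζ}` and `ν_{i,t,ϑ}`; the `2n` coordinates of the noises of one learner at one time are
independent; the noises are independent across iterations and independent of the data. -/
structure NoiseAssumption {m n : ℕ} {Ω Ξ : Type*} [MeasurableSpace Ω] [MeasurableSpace Ξ]
    (P : Measure Ω) (N : NoiseParams m) (ξ : Fin m → ℕ → Ω → Ξ) (ζ ϑ : Fin m → ℕ → Ω → Vec n) :
    Prop where
  measζ : ∀ i t, Measurable (ζ i t)
  measϑ : ∀ i t, Measurable (ϑ i t)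
  lawζ : ∀ i t (k : Fin n), P.map (fun ω => ζ i t ω k) = laplace (noiseScale (N.σζ i) (N.ςζ i) t)
  lawϑ : ∀ i t (k : Fin n), P.map (fun ω => ϑ i t ω k) = laplace (noiseScale (N.σϑ i) (N.ςϑ i) t)
  indep_coord : ∀ i t, iIndepFun
    (fun (c : Fin n ⊕ Fin n) (ω : Ω) => Sum.elim (fun k => ζ i t ω k) (fun k => ϑ i t ω k) c) P
  indep_time : iIndepFun (fun (t : ℕ) (ω : Ω) (i : Fin m) => (ζ i t ω, ϑ i t ω)) P
  indep_data : IndepFun (fun (ω : Ω) (i : Fin m) (t : ℕ) => (ζ i t ω, ϑ i t ω))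
    (fun (ω : Ω) (i : Fin m) (t : ℕ) => ξ i t ω) P

end OnlineLDP

end

/-! Convergence. The tracking variables matter only through their increments. The powers of I + C
converge geometrically, so `norm_increment_le` bounds s_{t+1} - s_t by a geometric filter of the
noises and stepsizes, which are square summable in mean because their exponents exceed 1/2; no bound
on s itself is needed. Summation over the learners removes C, and weighting by the stationary vector
p = u/m removes R. Hence x_t = ∑ p_i θ_{i,t} performs a gradient step perturbed by noise independent
of the present state and by a remainder of size γ_z^t times the increment (`avgθ_succ`), while the
disagreements θ_{i,t} - x_t have summable second moments (`sqSummable_consensus`).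

The delicate term is the gradient error: x_t depends on the very samples that are averaged, so
unbiasedness at fixed points is not enough. Hoeffding's inequality on a polynomially large grid, a
union bound and the Lipschitz property give a mean square error of order (log t)/t at an arbitrary
random point whose norm exceeds t + 1 with probability O(1/t) (`integral_gradDev_sq_le`);
square-summable increments ensure this tail (`exists_tail_bound`). Since v > 1/2, the error is
summable after multiplication by λ_t and Young's inequality.

All this is packaged in `MeanDescent`, a descent inequality for a whole class of test functions with
one common error sequence. The squared distance to θ* yields, by a Robbins–Siegmund argument,
bounded second moments and ∑ λ_t E[F(x_t) - F(θ*)] < ∞. The objective gap itself is almost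
decreasing in mean, and ∑ λ_t = ∞ then forces it to 0. When μ > 0, μ may still depend on the points;
compactness of spheres and convexity along rays give only ‖y - θ*‖ ≤ δ + c (F(y) - F(θ*)) for each δ
> 0, hence convergence in L¹. The functions `truncSq` are almost decreasing in mean uniformly in the
truncation level, which supplies the uniform integrability needed for mean square convergence.

Privacy. For fixed messages the state of a learner is a deterministic function of its data, so its
output is a deterministic sequence plus Laplace noise, independent over coordinates and times.
Density ratios multiply and budgets add (`isLDP_implementation`). The explicit bounds ϱ come from
estimating the difference of two empirical gradients by 2 c_l. Since ϱ_{t,s} ≥ 2 c_l λ_{t-1}, they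
cannot give a finite total budget: t^(ς-v) is not summable. For that, adjacent streams are compared
more carefully: only one of t + 1 samples differs, so the gradients differ by O(1/(t+1)) plus a
multiple of the difference of the parameters. The resulting coupled recursion `sensRec` becomes
contractive once λ_t is small, with weighted forcing of order t^(ς-v-1), summable because ς < v
(`summable_coupled`). -/

/-! ### Geometric ergodicity of finite stochastic matrices -/

namespace OnlineLDP

section Markov

variable {ι : Type*} [Fintype ι] [DecidableEq ι]

/-- Nonnegative matrices with unit row sums. -/
structure RowStoch (P : Matrix ι ι ℝ) : Prop where
  nonneg : ∀ i j, 0 ≤ P i j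
  row_sum : ∀ i, ∑ j, P i j = 1

theorem RowStoch.pow {P : Matrix ι ι ℝ} (hP : RowStoch P) (t : ℕ) : RowStoch (P ^ t) := by
  induction t with
  | zero =>
    refine ⟨fun i j => ?_, fun i => ?_⟩
    · rw [pow_zero, Matrix.one_apply]; split_ifs <;> norm_num
    · simp [Matrix.one_apply]
  | succ t ih =>
    refine ⟨fun i j => ?_, fun i => ?_⟩
    · rw [pow_succ, Matrix.mul_apply]
      exact Finset.sum_nonneg fun k _ => mul_nonneg (ih.nonneg i k) (hP.nonneg k j)
    · simp_rw [pow_succ, Matrix.mul_apply]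
      rw [Finset.sum_comm]
      simp_rw [← Finset.mul_sum, hP.row_sum, mul_one, ih.row_sum]

omit [DecidableEq ι] in
theorem RowStoch.le_one {P : Matrix ι ι ℝ} (hP : RowStoch P) (i j : ι) : P i j ≤ 1 := by
  rw [← hP.row_sum i]
  exact Finset.single_le_sum (fun k _ => hP.nonneg i k) (Finset.mem_univ j)

/-- A row-stochastic matrix with a column bounded below contracts oscillations. -/
theorem RowStoch.osc_contract {Q : Matrix ι ι ℝ} (hQ : RowStoch Q) {r : ι} {δ : ℝ} (hδ : 0 ≤ δ)
    (hr : ∀ i, δ ≤ Q i r) {x : ι → ℝ} {B : ℝ} (hx : ∀ k l, |x k - x l| ≤ B) (k l : ι) :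
    |∑ a, Q k a * x a - ∑ b, Q l b * x b| ≤ (1 - δ ^ 2) * B := by
  have hB : 0 ≤ B := (abs_nonneg _).trans (hx r r)
  -- Independent coupling of rows k and l: the pair (r, r) has mass at least δ ^ 2 and contributes
  -- nothing.
  have e1 : ∑ a, Q k a * x a - ∑ b, Q l b * x b
      = ∑ a, ∑ b, Q k a * Q l b * (x a - x b) := by
    have h1 : ∑ a, Q k a * x a = ∑ a, ∑ b, Q k a * Q l b * x a := by
      refine Finset.sum_congr rfl fun a _ => ?_
      rw [← Finset.sum_mul, ← Finset.mul_sum, hQ.row_sum, mul_one]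
    have h2 : ∑ b, Q l b * x b = ∑ a, ∑ b, Q k a * Q l b * x b := by
      rw [Finset.sum_comm]
      refine Finset.sum_congr rfl fun b _ => ?_
      rw [← Finset.sum_mul, ← Finset.sum_mul, hQ.row_sum, one_mul]
    rw [h1, h2, ← Finset.sum_sub_distrib]
    refine Finset.sum_congr rfl fun a _ => ?_
    rw [← Finset.sum_sub_distrib]
    exact Finset.sum_congr rfl fun b _ => by ring
  have e2 : ∑ a, ∑ b, Q k a * Q l b = 1 := by
    simp_rw [← Finset.mul_sum, hQ.row_sum, mul_one, hQ.row_sum]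
  rw [e1]
  have e3 : ∀ a b, |Q k a * Q l b * (x a - x b)|
      ≤ Q k a * Q l b * B - (if a = r then if b = r then δ ^ 2 * B else 0 else 0) := by
    intro a b
    have hn := mul_nonneg (hQ.nonneg k a) (hQ.nonneg l b)
    rw [abs_mul, abs_of_nonneg hn]
    split_ifs with h1 h2
    · subst h1; subst h2
      rw [sub_self, abs_zero, mul_zero, ← sub_mul, sq]
      refine mul_nonneg (sub_nonneg.2 ?_) hB
      exact mul_le_mul (hr k) (hr l) hδ (hQ.nonneg _ _)
    · rw [sub_zero]; exact mul_le_mul_of_nonneg_left (hx a b) hn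
    · rw [sub_zero]; exact mul_le_mul_of_nonneg_left (hx a b) hn
  calc |∑ a, ∑ b, Q k a * Q l b * (x a - x b)|
      ≤ ∑ a, ∑ b, |Q k a * Q l b * (x a - x b)| :=
        (Finset.abs_sum_le_sum_abs _ _).trans
          (Finset.sum_le_sum fun a _ => Finset.abs_sum_le_sum_abs _ _)
    _ ≤ ∑ a, ∑ b, (Q k a * Q l b * B
          - (if a = r then if b = r then δ ^ 2 * B else 0 else 0)) :=
        Finset.sum_le_sum fun a _ => Finset.sum_le_sum fun b _ => e3 a b
    _ = (1 - δ ^ 2) * B := by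
        simp_rw [Finset.sum_sub_distrib, ← Finset.sum_mul]
        rw [e2]
        simp [Finset.sum_ite_eq']
        ring

/-- The floor loses at most one, t / N ≤ ⌊t / N⌋ + 1; the rate is ρ ^ (1 / N) and the constant ρ⁻¹
pays for the loss. -/
theorem exists_geometric_of_div {ρ : ℝ} (h0 : 0 < ρ) (h1 : ρ < 1) {N : ℕ} (hN : 0 < N) :
    ∃ c γ : ℝ, 0 < c ∧ 0 < γ ∧ γ < 1 ∧ ∀ t : ℕ, ρ ^ (t / N) ≤ c * γ ^ t := by
  have hN' : (0 : ℝ) < N := by exact_mod_cast hN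
  refine ⟨ρ⁻¹, ρ ^ (1 / (N : ℝ)), by positivity, by positivity,
    Real.rpow_lt_one h0.le h1 (by positivity), fun t => ?_⟩
  rw [← Real.rpow_natCast (ρ ^ (1 / (N : ℝ))) t, ← Real.rpow_mul h0.le, ← Real.rpow_natCast,
    ← Real.rpow_neg_one ρ, ← Real.rpow_add h0]
  refine Real.rpow_le_rpow_of_exponent_ge h0 h1.le ?_
  have h : (t : ℝ) < N * ((t / N : ℕ) + 1) := by
    exact_mod_cast Nat.lt_mul_div_succ t hN
  have : (1 / (N : ℝ)) * t ≤ ((t / N : ℕ) : ℝ) + 1 := by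
    rw [one_div, inv_mul_le_iff₀ hN']; exact h.le
  linarith

/-- If one column of some power is positive, the powers converge geometrically to a matrix with
equal rows. -/
theorem RowStoch.exists_limit {P : Matrix ι ι ℝ} (hP : RowStoch P) {r : ι} {N : ℕ} (hN : 0 < N)
    {δ : ℝ} (hδ : 0 < δ) (hr : ∀ i, δ ≤ (P ^ N) i r) :
    ∃ p : ι → ℝ, (∀ j, 0 ≤ p j) ∧ ∑ j, p j = 1 ∧ Matrix.vecMul p P = p ∧
      ∃ c γ : ℝ, 0 < c ∧ 0 < γ ∧ γ < 1 ∧ ∀ t i j, |(P ^ t) i j - p j| ≤ c * γ ^ t := by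
  have hδ1 : δ ≤ 1 := (hr r).trans ((hP.pow N).le_one r r)
  -- Halving δ ^ 2 keeps ρ positive even if δ = 1.
  set ρ : ℝ := 1 - δ ^ 2 / 2 with hρ
  have hρ0 : 0 < ρ := by nlinarith
  have hρ1 : ρ < 1 := by nlinarith
  have hmul : ∀ s t i j, (P ^ (s + t)) i j = ∑ k, (P ^ s) i k * (P ^ t) k j := by
    intro s t i j; rw [pow_add, Matrix.mul_apply]
  have hosc1 : ∀ q t j k l, |(P ^ (N * q + t)) k j - (P ^ (N * q + t)) l j| ≤ ρ ^ q := by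
    intro q
    induction q with
    | zero =>
      intro t j k l
      have a := (hP.pow (N * 0 + t)).nonneg
      have b := (hP.pow (N * 0 + t)).le_one
      rw [pow_zero, abs_le]
      constructor <;> linarith [a k j, a l j, b k j, b l j]
    | succ q ih =>
      intro t j k l
      have e : N * (q + 1) + t = N + (N * q + t) := by ring
      rw [e, hmul, hmul]
      refine ((hP.pow N).osc_contract hδ.le hr (fun k l => ih t j k l) k l).trans ?_
      rw [pow_succ' ρ]
      have h2 : 1 - δ ^ 2 ≤ ρ := by nlinarith
      exact mul_le_mul_of_nonneg_right h2 (by positivity)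
  obtain ⟨c, γ, hc, hγ, hγ1, hcγ⟩ := exists_geometric_of_div hρ0 hρ1 hN
  have hosc : ∀ t j k l, |(P ^ t) k j - (P ^ t) l j| ≤ c * γ ^ t := by
    intro t j k l
    have := hosc1 (t / N) (t % N) j k l
    rw [Nat.div_add_mod] at this
    exact this.trans (hcγ t)
  -- A row of P ^ (s + t) is a convex combination of rows of P ^ t. The case s = 1 makes row r a
  -- Cauchy sequence; letting s → ∞ gives the rate for every row.
  have hstep : ∀ s t i j k, |(P ^ (s + t)) i j - (P ^ t) k j| ≤ c * γ ^ t := by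
    intro s t i j k
    have e : (P ^ (s + t)) i j - (P ^ t) k j
        = ∑ l, (P ^ s) i l * ((P ^ t) l j - (P ^ t) k j) := by
      simp_rw [mul_sub, Finset.sum_sub_distrib, ← Finset.sum_mul, (hP.pow s).row_sum, one_mul, hmul]
    rw [e]
    calc _ ≤ ∑ l, |(P ^ s) i l * ((P ^ t) l j - (P ^ t) k j)| := Finset.abs_sum_le_sum_abs _ _
      _ ≤ ∑ l, (P ^ s) i l * (c * γ ^ t) := by
          refine Finset.sum_le_sum fun l _ => ?_
          rw [abs_mul, abs_of_nonneg ((hP.pow s).nonneg i l)]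
          exact mul_le_mul_of_nonneg_left (hosc t j l k) ((hP.pow s).nonneg i l)
      _ = c * γ ^ t := by rw [← Finset.sum_mul, (hP.pow s).row_sum, one_mul]
  have hlim : ∀ j, ∃ p : ℝ, Tendsto (fun t => (P ^ t) r j) atTop (𝓝 p) := by
    intro j
    have hc := cauchySeq_of_le_geometric γ c hγ1 (f := fun t => (P ^ t) r j) (fun t => by
      rw [dist_comm, Real.dist_eq, add_comm]; exact hstep 1 t r j r)
    exact cauchySeq_tendsto_of_complete hc
  choose p hp using hlim
  have hdist : ∀ t i j, |(P ^ t) i j - p j| ≤ c * γ ^ t := by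
    intro t i j
    have h1 : Tendsto (fun s => |(P ^ (s + t)) r j - (P ^ t) i j|) atTop
        (𝓝 |p j - (P ^ t) i j|) :=
      (((tendsto_add_atTop_iff_nat t).2 (hp j)).sub_const _).abs
    rw [abs_sub_comm]
    exact le_of_tendsto h1 (Eventually.of_forall fun s => hstep s t r j i)
  refine ⟨p, fun j => ge_of_tendsto (hp j) (Eventually.of_forall fun t => (hP.pow t).nonneg r j),
    ?_, ?_, c, γ, hc, hγ, hγ1, hdist⟩
  · have h1 : Tendsto (fun t => ∑ j, (P ^ t) r j) atTop (𝓝 (∑ j, p j)) :=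
      tendsto_finsetSum _ fun j _ => hp j
    refine tendsto_nhds_unique h1 ?_
    simp_rw [fun t => (hP.pow t).row_sum r]
    exact tendsto_const_nhds
  · funext j
    have h1 : Tendsto (fun t => ∑ k, (P ^ t) r k * P k j) atTop (𝓝 (∑ k, p k * P k j)) :=
      tendsto_finsetSum _ fun k _ => (hp k).mul_const _
    have h2 : Tendsto (fun t => (P ^ (t + 1)) r j) atTop (𝓝 (p j)) :=
      (tendsto_add_atTop_iff_nat 1).2 (hp j)
    have h3 : (fun t => (P ^ (t + 1)) r j) = fun t => ∑ k, (P ^ t) r k * P k j := by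
      funext t; rw [hmul, pow_one]
    rw [h3] at h2
    exact tendsto_nhds_unique h1 h2

theorem vecMul_pow_eq {P : Matrix ι ι ℝ} {q : ι → ℝ} (hq : Matrix.vecMul q P = q) (t : ℕ) :
    Matrix.vecMul q (P ^ t) = q := by
  induction t with
  | zero => simp
  | succ t ih => rw [pow_succ, ← Matrix.vecMul_vecMul, ih, hq]

/-- Uniqueness of the stationary vector: pass to the limit in q = q P ^ t. -/
theorem eq_of_vecMul_eq {P : Matrix ι ι ℝ} {p q : ι → ℝ} {c γ : ℝ} (hγ : 0 < γ) (hγ1 : γ < 1)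
    (hp : ∀ t i j, |(P ^ t) i j - p j| ≤ c * γ ^ t) (hq : Matrix.vecMul q P = q) :
    q = fun j => (∑ i, q i) * p j := by
  funext j
  have hg : Tendsto (fun t : ℕ => c * γ ^ t) atTop (𝓝 0) := by
    simpa using (tendsto_pow_atTop_nhds_zero_of_lt_one hγ.le hγ1).const_mul c
  have hpt : ∀ i, Tendsto (fun t => (P ^ t) i j) atTop (𝓝 (p j)) := fun i =>
    tendsto_iff_dist_tendsto_zero.2 (squeeze_zero (fun _ => dist_nonneg)
      (fun t => by rw [Real.dist_eq]; exact hp t i j) hg)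
  have h1 : Tendsto (fun t => ∑ i, q i * (P ^ t) i j) atTop (𝓝 (∑ i, q i * p j)) :=
    tendsto_finsetSum _ fun i _ => (hpt i).const_mul _
  rw [← Finset.sum_mul] at h1
  refine tendsto_nhds_unique ?_ h1
  have h2 : ∀ t, ∑ i, q i * (P ^ t) i j = q j := fun t => congrFun (vecMul_pow_eq hq t) j
  simp_rw [h2]
  exact tendsto_const_nhds

/-- The loop at r allows waiting there, so one exponent beyond all hitting times serves every
starting node; δ is a minimum over finitely many nodes. -/
theorem RowStoch.exists_pow_pos {P : Matrix ι ι ℝ} (hP : RowStoch P) {r : ι} (hd : 0 < P r r)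
    (h : ∀ i, ∃ k, 0 < (P ^ k) i r) :
    ∃ N, 0 < N ∧ ∃ δ : ℝ, 0 < δ ∧ ∀ i, δ ≤ (P ^ N) i r := by
  have hdiag : ∀ s, 0 < (P ^ s) r r := by
    intro s
    induction s with
    | zero => simp
    | succ s ih =>
      rw [pow_succ, Matrix.mul_apply]
      refine (mul_pos ih hd).trans_le ?_
      exact Finset.single_le_sum (f := fun k => (P ^ s) r k * P k r)
        (fun k _ => mul_nonneg ((hP.pow s).nonneg r k) (hP.nonneg k r)) (Finset.mem_univ r)
  choose k hk using h
  set N := ∑ i, k i + 1 with hN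
  have hpos : ∀ i, 0 < (P ^ N) i r := by
    intro i
    have hle : k i ≤ ∑ i, k i := Finset.single_le_sum (fun _ _ => Nat.zero_le _)
      (Finset.mem_univ i)
    have e : N = k i + (N - k i) := by omega
    rw [e, pow_add, Matrix.mul_apply]
    refine (mul_pos (hk i) (hdiag (N - k i))).trans_le ?_
    exact Finset.single_le_sum (f := fun l => (P ^ k i) i l * (P ^ (N - k i)) l r)
      (fun l _ => mul_nonneg ((hP.pow _).nonneg i l) ((hP.pow _).nonneg l r)) (Finset.mem_univ r)
  refine ⟨N, by omega, ?_⟩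
  have : Nonempty ι := ⟨r⟩
  obtain ⟨i0, hi0⟩ := Finite.exists_min fun i => (P ^ N) i r
  exact ⟨_, hpos i0, hi0⟩

end Markov

end OnlineLDP

/-! ### The coupling matrices -/

namespace OnlineLDP

variable {m : ℕ}

theorem mem_inNbrs {W : Matrix (Fin m) (Fin m) ℝ} {i j : Fin m} : j ∈ inNbrs W i ↔ 0 < W i j := by
  simp [inNbrs]

/-- The neighbourhood omits only the negative diagonal entry and zero entries. This turns the sums
of the algorithm into matrix products. -/
theorem sum_inNbrs {W : Matrix (Fin m) (Fin m) ℝ} (hoff : ∀ i j, i ≠ j → 0 ≤ W i j)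
    (hdiag : ∀ i, W i i < 0) {E : Type*} [AddCommGroup E] [Module ℝ E] (i : Fin m)
    (f : Fin m → E) :
    ∑ j ∈ inNbrs W i, W i j • f j = ∑ j, W i j • f j - W i i • f i := by
  rw [eq_sub_iff_add_eq, ← Finset.sum_erase_add _ _ (Finset.mem_univ i)]
  congr 1
  refine Finset.sum_subset (fun j hj => ?_) fun j hj hj' => ?_
  · rw [mem_inNbrs] at hj
    refine Finset.mem_erase.2 ⟨?_, Finset.mem_univ j⟩
    rintro rfl
    exact absurd hj (hdiag _).not_gt
  · have hne : i ≠ j := (Finset.ne_of_mem_erase hj).symm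
    rw [mem_inNbrs, not_lt] at hj'
    rw [le_antisymm hj' (hoff i j hne), zero_smul]

theorem rowStoch_one_add {W : Matrix (Fin m) (Fin m) ℝ} (hoff : ∀ i j, i ≠ j → 0 ≤ W i j)
    (hdiag : ∀ i, W i i < 0) (hgt : ∀ i, -1 < W i i)
    (hsum : ∀ i, W i i = -∑ j ∈ inNbrs W i, W i j) : RowStoch (1 + W) := by
  refine ⟨fun i j => ?_, fun i => ?_⟩
  · rw [Matrix.add_apply, Matrix.one_apply]
    split_ifs with h
    · subst h; linarith [hgt i]
    · linarith [hoff i j h]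
  · have h1 := sum_inNbrs hoff hdiag i fun _ => (1 : ℝ)
    simp only [smul_eq_mul, mul_one] at h1
    have h2 := hsum i
    simp only [Matrix.add_apply, Finset.sum_add_distrib, Matrix.one_apply, Finset.sum_ite_eq,
      Finset.mem_univ, if_true]
    linarith

namespace CouplingAssumption

variable {R C : Matrix (Fin m) (Fin m) ℝ}

theorem rowStoch_R (h : CouplingAssumption R C) : RowStoch (1 + R) :=
  rowStoch_one_add h.R_offdiag h.R_diag_neg h.R_diag_gt h.R_diag

theorem rowStoch_C (h : CouplingAssumption R C) : RowStoch (1 + C.transpose) :=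
  rowStoch_one_add (fun i j hij => h.C_offdiag j i hij.symm) h.C_diag_neg h.C_diag_gt h.C_diag

theorem m_pos (h : CouplingAssumption R C) : 0 < m := by
  obtain ⟨r, -⟩ := h.C_tree
  exact r.pos

end CouplingAssumption

/-- Each arrow contributes a positive factor along the walk, and the other walks contribute
nonnegative terms. -/
theorem pow_pos_of_transGen {W : Matrix (Fin m) (Fin m) ℝ} (hW : RowStoch (1 + W))
    (hoff : ∀ i j, 0 < W i j → i ≠ j) {i j : Fin m} (h : Relation.TransGen (Arrow W) i j) :
    ∃ k : ℕ, 0 < ((1 + W) ^ k) j i := by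
  have harr : ∀ {a b}, Arrow W a b → 0 < (1 + W) b a := by
    intro a b hab
    rw [Matrix.add_apply, Matrix.one_apply, if_neg (hoff b a hab), zero_add]
    exact hab
  induction h with
  | single hab => exact ⟨1, by rw [pow_one]; exact harr hab⟩
  | tail _ hbc ih =>
    rename_i b c _
    obtain ⟨k, hk⟩ := ih
    refine ⟨k + 1, ?_⟩
    rw [pow_succ', Matrix.mul_apply]
    refine (mul_pos (harr hbc) hk).trans_le ?_
    exact Finset.single_le_sum (f := fun l => (1 + W) c l * ((1 + W) ^ k) l i)
      (fun l _ => mul_nonneg (hW.nonneg _ _) ((hW.pow k).nonneg _ _)) (Finset.mem_univ b)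

/-- Strong connectivity makes each column positive in some power. One column suffices for the limit;
applying p = p P ^ N to column j then gives p j ≥ δ > 0. -/
theorem CouplingAssumption.exists_limit_R {R C : Matrix (Fin m) (Fin m) ℝ}
    (h : CouplingAssumption R C) :
    ∃ p : Fin m → ℝ, (∀ j, 0 < p j) ∧ ∑ j, p j = 1 ∧ Matrix.vecMul p (1 + R) = p ∧
      ∃ c γ : ℝ, 0 < c ∧ 0 < γ ∧ γ < 1 ∧ ∀ t i j, |((1 + R) ^ t) i j - p j| ≤ c * γ ^ t := by
  have hP := h.rowStoch_R
  have hoff : ∀ i j, 0 < R i j → i ≠ j := by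
    rintro i j hij rfl; exact absurd hij (h.R_diag_neg _).not_gt
  have key : ∀ r, ∃ N, 0 < N ∧ ∃ δ : ℝ, 0 < δ ∧ ∀ i, δ ≤ ((1 + R) ^ N) i r := by
    intro r
    refine hP.exists_pow_pos ?_ fun i => ?_
    · simp only [Matrix.add_apply, Matrix.one_apply_eq]; linarith [h.R_diag_gt r]
    · rcases eq_or_ne r i with rfl | hne
      · exact ⟨0, by simp⟩
      · exact pow_pos_of_transGen hP hoff (h.R_conn r i hne)
  obtain ⟨N, hN, δ, hδ, hr⟩ := key ⟨0, h.m_pos⟩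
  obtain ⟨p, hp0, hp1, hpP, hex⟩ := hP.exists_limit hN hδ hr
  refine ⟨p, fun j => ?_, hp1, hpP, hex⟩
  obtain ⟨N, hN, δ, hδ, hr⟩ := key j
  have e := congrFun (vecMul_pow_eq hpP N) j
  refine hδ.trans_le ?_
  calc δ = ∑ i, p i * δ := by rw [← Finset.sum_mul, hp1, one_mul]
    _ ≤ ∑ i, p i * ((1 + R) ^ N) i j :=
        Finset.sum_le_sum fun i _ => mul_le_mul_of_nonneg_left (hr i) (hp0 i)
    _ = p j := e

/-- A spanning tree only makes the column of its root positive, so no positivity of p is claimed.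
Transposition turns equal rows into equal columns, hence a limit depending on i alone; this is
enough to control increments. -/
theorem CouplingAssumption.exists_limit_C {R C : Matrix (Fin m) (Fin m) ℝ}
    (h : CouplingAssumption R C) :
    ∃ p : Fin m → ℝ, ∃ c γ : ℝ, 0 < c ∧ 0 < γ ∧ γ < 1 ∧
      ∀ t i j, |((1 + C) ^ t) i j - p i| ≤ c * γ ^ t := by
  have hP := h.rowStoch_C
  obtain ⟨r, parent, hpar, hroot⟩ := h.C_tree
  have hreach : ∀ k i, parent^[k] i = r → ∃ k' : ℕ, 0 < ((1 + C.transpose) ^ k') i r := by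
    intro k
    induction k with
    | zero => rintro i rfl; exact ⟨0, by simp⟩
    | succ k ih =>
      intro i hi
      rcases eq_or_ne i r with rfl | hne
      · exact ⟨0, by simp⟩
      · obtain ⟨k', hk'⟩ := ih (parent i) (by rwa [Function.iterate_succ_apply] at hi)
        refine ⟨k' + 1, ?_⟩
        have harr : 0 < C.transpose i (parent i) := hpar i hne
        have hne' : i ≠ parent i := by
          intro e
          rw [← e] at harr
          exact absurd harr (h.C_diag_neg i).not_gt
        have hpos : 0 < (1 + C.transpose) i (parent i) := by
          rwa [Matrix.add_apply, Matrix.one_apply, if_neg hne', zero_add]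
        rw [pow_succ', Matrix.mul_apply]
        refine (mul_pos hpos hk').trans_le ?_
        exact Finset.single_le_sum
          (f := fun l => (1 + C.transpose) i l * ((1 + C.transpose) ^ k') l r)
          (fun l _ => mul_nonneg (hP.nonneg _ _) ((hP.pow k').nonneg _ _)) (Finset.mem_univ _)
  obtain ⟨N, hN, δ, hδ, hr⟩ := hP.exists_pow_pos (r := r)
    (by simp only [Matrix.add_apply, Matrix.one_apply_eq, Matrix.transpose_apply]
        linarith [h.C_diag_gt r])
    fun i => (hroot i).elim fun k hk => hreach k i hk
  obtain ⟨p, -, -, -, c, γ, hc, hγ, hγ1, hcγ⟩ := hP.exists_limit hN hδ hr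
  refine ⟨p, c, γ, hc, hγ, hγ1, fun t i j => ?_⟩
  have e : ((1 + C) ^ t) i j = ((1 + C.transpose) ^ t) j i := by
    rw [← Matrix.transpose_apply (M := (1 + C) ^ t), Matrix.transpose_pow, Matrix.transpose_add,
      Matrix.transpose_one]
  rw [e]; exact hcγ t j i

/-- Rows of R sum to zero, so the recursion is left multiplication by I + R, started at the
identity. -/
theorem CouplingAssumption.zEst_eq {R C : Matrix (Fin m) (Fin m) ℝ}
    (h : CouplingAssumption R C) (t : ℕ) (i : Fin m) : zEst R t i = ((1 + R) ^ t) i := by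
  induction t generalizing i with
  | zero => funext k; simp [zEst, Matrix.one_apply, Pi.single_apply, eq_comm]
  | succ t ih =>
    have h1 := sum_inNbrs h.R_offdiag h.R_diag_neg i fun j => zEst R t j - zEst R t i
    have h2 : ∑ j, R i j = 0 := by
      have := h.rowStoch_R.row_sum i
      simpa [Matrix.add_apply, Finset.sum_add_distrib, Matrix.one_apply] using this
    change zEst R t i + ∑ j ∈ inNbrs R i, R i j • (zEst R t j - zEst R t i) = _
    rw [h1]
    simp_rw [smul_sub, Finset.sum_sub_distrib, ← Finset.sum_smul, h2]
    funext k
    rw [pow_succ', Matrix.mul_apply]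
    simp [ih, Matrix.add_apply, add_mul, Finset.sum_add_distrib, Matrix.one_apply]

theorem RowStoch.pow_diag_pos {ι : Type*} [Fintype ι] [DecidableEq ι] {P : Matrix ι ι ℝ}
    (hP : RowStoch P) {i : ι} (hd : 0 < P i i) (t : ℕ) : 0 < (P ^ t) i i := by
  induction t with
  | zero => simp
  | succ s ih =>
    rw [pow_succ, Matrix.mul_apply]
    refine (mul_pos ih hd).trans_le ?_
    exact Finset.single_le_sum (f := fun k => (P ^ s) i k * P k i)
      (fun k _ => mul_nonneg ((hP.pow s).nonneg i k) (hP.nonneg k i)) (Finset.mem_univ i)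

theorem CouplingAssumption.zEst_pos {R C : Matrix (Fin m) (Fin m) ℝ}
    (h : CouplingAssumption R C) (t : ℕ) (i : Fin m) : 0 < zEst R t i i := by
  rw [h.zEst_eq]
  refine h.rowStoch_R.pow_diag_pos ?_ t
  simp only [Matrix.add_apply, Matrix.one_apply_eq]; linarith [h.R_diag_gt i]

theorem CouplingAssumption.existsUnique_isLeftPerron {R C : Matrix (Fin m) (Fin m) ℝ}
    (h : CouplingAssumption R C) : ∃! u, IsLeftPerron R u := by
  obtain ⟨p, hp, hp1, hpP, c, γ, -, hγ, hγ1, hcγ⟩ := h.exists_limit_R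
  have hm : (0 : ℝ) < m := by exact_mod_cast h.m_pos
  refine ⟨fun j => (m : ℝ) * p j, ⟨fun j => mul_pos hm (hp j), ?_, ?_⟩, ?_⟩
  · have : (fun j => (m : ℝ) * p j) = (m : ℝ) • p := rfl
    rw [this, Matrix.smul_vecMul, hpP]
  · rw [← Finset.mul_sum, hp1, mul_one]
  · rintro q ⟨-, hq, hqs⟩
    rw [eq_of_vecMul_eq hγ hγ1 hcγ hq, hqs]

theorem CouplingAssumption.exists_isEigenRate {R C : Matrix (Fin m) (Fin m) ℝ}
    (h : CouplingAssumption R C) {u : Fin m → ℝ} (hu : IsLeftPerron R u) :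
    ∃ cz γz, IsEigenRate R u cz γz := by
  obtain ⟨p, hp, hp1, hpP, c, γ, hc, hγ, hγ1, hcγ⟩ := h.exists_limit_R
  have hm : (0 : ℝ) < m := by exact_mod_cast h.m_pos
  have hup : ∀ i, u i = m * p i := by
    intro i
    rw [eq_of_vecMul_eq hγ hγ1 hcγ hu.2.1, hu.2.2]
  -- The diagonal estimates converge to p i > 0, so their reciprocals are bounded; the rate for z
  -- thus passes to 1 / z.
  have hb : ∀ i, ∃ B, ∀ t, (zEst R t i i)⁻¹ ≤ B := by
    intro i
    have hg : Tendsto (fun t : ℕ => c * γ ^ t) atTop (𝓝 0) := by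
      simpa using (tendsto_pow_atTop_nhds_zero_of_lt_one hγ.le hγ1).const_mul c
    have h1 : Tendsto (fun t => zEst R t i i) atTop (𝓝 (p i)) :=
      tendsto_iff_dist_tendsto_zero.2 (squeeze_zero (fun _ => dist_nonneg)
        (fun t => by rw [Real.dist_eq, h.zEst_eq]; exact hcγ t i i) hg)
    obtain ⟨B, hB⟩ := (h1.inv₀ (hp i).ne').bddAbove_range
    exact ⟨B, fun t => hB ⟨t, rfl⟩⟩
  choose B hB using hb
  have hB0 : ∀ i, 0 < B i := fun i => (inv_pos.2 (h.zEst_pos 0 i)).trans_le (hB i 0)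
  have hterm : ∀ i, 0 < c * B i / (m * p i) := fun i =>
    div_pos (mul_pos hc (hB0 i)) (mul_pos hm (hp i))
  refine ⟨∑ i, c * B i / (m * p i), γ, ?_, hγ, hγ1, fun i t => ?_⟩
  · exact Finset.sum_pos (fun i _ => hterm i) ⟨⟨0, h.m_pos⟩, Finset.mem_univ _⟩
  · have hz := h.zEst_pos t i
    have e : 1 / ((m : ℝ) * zEst R t i i) - 1 / u i
        = (p i - zEst R t i i) * (zEst R t i i)⁻¹ / (m * p i) := by
      rw [hup]; have := (hp i).ne'; have := hm.ne'; have := hz.ne'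
      field_simp
    have hd : |p i - zEst R t i i| ≤ c * γ ^ t := by
      rw [abs_sub_comm, h.zEst_eq]; exact hcγ t i i
    rw [e, abs_div, abs_mul, abs_of_pos (inv_pos.2 hz), abs_of_pos (mul_pos hm (hp i))]
    calc _ ≤ c * γ ^ t * B i / (m * p i) := by
          refine div_le_div_of_nonneg_right ?_ (mul_pos hm (hp i)).le
          exact mul_le_mul hd (hB i t) (inv_pos.2 hz).le (by positivity)
      _ = c * B i / (m * p i) * γ ^ t := by ring
      _ ≤ _ := mul_le_mul_of_nonneg_right
          (Finset.single_le_sum (f := fun i => c * B i / (m * p i)) (fun i _ => (hterm i).le)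
            (Finset.mem_univ i)) (by positivity)

end OnlineLDP

/-! ### Sensitivities -/

namespace OnlineLDP

section L1

variable {n : ℕ}

theorem l1norm_nonneg (x : Vec n) : 0 ≤ l1norm x := Finset.sum_nonneg fun _ _ => abs_nonneg _

theorem l1norm_zero : l1norm (0 : Vec n) = 0 := by simp [l1norm]

theorem l1norm_add_le (x y : Vec n) : l1norm (x + y) ≤ l1norm x + l1norm y := by
  unfold l1norm
  rw [← Finset.sum_add_distrib]
  exact Finset.sum_le_sum fun k _ => abs_add_le _ _

theorem l1norm_smul (c : ℝ) (x : Vec n) : l1norm (c • x) = |c| * l1norm x := by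
  simp [l1norm, Finset.mul_sum, abs_mul]

theorem l1norm_neg (x : Vec n) : l1norm (-x) = l1norm x := by simp [l1norm]

theorem l1norm_sub_le (x y : Vec n) : l1norm (x - y) ≤ l1norm x + l1norm y := by
  rw [sub_eq_add_neg]; exact (l1norm_add_le _ _).trans (by rw [l1norm_neg])

theorem l1norm_sum_le {ι : Type*} (s : Finset ι) (f : ι → Vec n) :
    l1norm (∑ j ∈ s, f j) ≤ ∑ j ∈ s, l1norm (f j) := by
  classical
  induction s using Finset.induction_on with
  | empty => simp [l1norm_zero]
  | insert a s ha ih =>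
    rw [Finset.sum_insert ha, Finset.sum_insert ha]
    exact (l1norm_add_le _ _).trans (by linarith)

theorem abs_apply_le_norm (x : Vec n) (k : Fin n) : |x k| ≤ ‖x‖ := by
  simpa using PiLp.norm_apply_le x k

theorem l1norm_le (x : Vec n) : l1norm x ≤ n * ‖x‖ := by
  unfold l1norm
  refine (Finset.sum_le_sum fun k _ => abs_apply_le_norm x k).trans ?_
  simp

theorem norm_le_l1norm (x : Vec n) : ‖x‖ ≤ l1norm x := by
  rw [EuclideanSpace.norm_eq]
  refine Real.sqrt_le_iff.2 ⟨l1norm_nonneg x, ?_⟩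
  exact Finset.sum_sq_le_sq_sum_of_nonneg fun k _ => abs_nonneg _

end L1

/-! ### Contractive scalar recursions. -/

section Conv

theorem sum_Icc_geom_succ (a : ℝ) (f : ℕ → ℝ) (t : ℕ) :
    ∑ q ∈ Finset.Icc 1 (t + 1), a ^ (t + 1 - q) * f q
      = a * ∑ q ∈ Finset.Icc 1 t, a ^ (t - q) * f q + f (t + 1) := by
  rw [Finset.sum_Icc_succ_top (by omega), Finset.mul_sum]
  congr 1
  · refine Finset.sum_congr rfl fun q hq => ?_
    rw [Finset.mem_Icc] at hq
    rw [Nat.sub_add_comm hq.2, pow_succ']; ring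
  · simp

/-- A nonnegative sequence that eventually satisfies a contractive recursion with summable
perturbations is summable. -/
theorem summable_of_contractive {y h : ℕ → ℝ} {ρ : ℝ} (hy : ∀ t, 0 ≤ y t) (hh : ∀ t, 0 ≤ h t)
    (hρ1 : ρ < 1) (hs : Summable h)
    (hrec : ∀ᶠ t in atTop, y (t + 1) ≤ ρ * y t + h t) : Summable y := by
  obtain ⟨T, hT⟩ := eventually_atTop.1 hrec
  rw [← summable_nat_add_iff T]
  set H := ∑' t, h (t + T)
  have hs' : Summable fun t => h (t + T) := (summable_nat_add_iff T).2 hs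
  refine summable_of_sum_range_le (c := (y T + H) / (1 - ρ)) (fun t => hy _) fun N => ?_
  rw [le_div_iff₀ (by linarith)]
  have h1 : ∑ t ∈ Finset.range (N + 1), y (t + T)
      ≤ ρ * ∑ t ∈ Finset.range N, y (t + T) + (y T + H) := by
    rw [Finset.sum_range_succ', zero_add, Finset.mul_sum]
    have h2 : ∑ t ∈ Finset.range N, h (t + T) ≤ H := hs'.sum_le_tsum _ fun t _ => hh _
    have h3 : ∑ t ∈ Finset.range N, y (t + 1 + T)
        ≤ ∑ t ∈ Finset.range N, (ρ * y (t + T) + h (t + T)) :=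
      Finset.sum_le_sum fun t _ => by
        rw [add_right_comm]; exact hT _ (by omega)
    rw [Finset.sum_add_distrib] at h3
    linarith
  rw [Finset.sum_range_succ] at h1
  linarith [hy (N + T)]

/-- Weighted summability of a coupled pair of contractive recursions whose coupling vanishes. -/
theorem summable_coupled {x y lam : ℕ → ℝ} {a r M c K lam0 v ς : ℝ} (hx : ∀ t, 0 ≤ x t)
    (hy : ∀ t, 0 ≤ y t) (ha : 0 ≤ a) (ha1 : a < 1) (hr1 : r < 1) (hM : 0 ≤ M)
    (hc : 0 ≤ c) (hK : 0 ≤ K) (hl : 0 < lam0) (hς : 0 ≤ ς) (hς1 : ς ≤ 1) (hv : ς < v)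
    (hlam : ∀ t : ℕ, lam t = lam0 / ((t : ℝ) + 1) ^ v)
    (hxr : ∀ t, x (t + 1) ≤ a * x t + lam t * (c / ((t : ℝ) + 1) + K * y t))
    (hyr : ∀ t, y (t + 1) ≤ r * y t + M * (x (t + 1) + x t)) :
    Summable (fun t : ℕ => ((t : ℝ) + 1) ^ ς * x t) ∧
      Summable fun t : ℕ => ((t : ℝ) + 1) ^ ς * y t := by
  have hv0 : 0 < v := hς.trans_lt hv
  have hlam0 : ∀ t, 0 ≤ lam t := fun t => by rw [hlam]; positivity
  -- Weight of the Lyapunov function x + κ y: with κ M ≤ (1 - a) / 4 the feedback of x into y raises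
  -- the factor a to at most (1 + a) / 2. The feedback of y into x carries λ_t → 0 and is eventually
  -- absorbed by the gap (1 - r) / 2.
  set κ := (1 - a) / (4 * (M + 1)) with hκ
  have hκ0 : 0 < κ := by rw [hκ]; apply div_pos <;> linarith
  have hκM : κ * M ≤ (1 - a) / 4 := by
    rw [hκ, div_mul_eq_mul_div, div_le_div_iff₀ (by linarith) (by norm_num)]
    nlinarith
  set ρ := max ((1 + a) / 2) ((1 + r) / 2) with hρ
  have hρ0 : 0 ≤ ρ := le_max_of_le_left (by linarith)
  have hρ1 : ρ < 1 := max_lt (by linarith) (by linarith)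
  have htop : Tendsto (fun t : ℕ => (t : ℝ) + 1) atTop atTop :=
    tendsto_atTop_add_const_right _ _ tendsto_natCast_atTop_atTop
  have hlamlim : Tendsto lam atTop (𝓝 0) := by
    have : lam = fun t : ℕ => lam0 / ((t : ℝ) + 1) ^ v := funext hlam
    rw [this]
    exact ((tendsto_rpow_atTop hv0).comp htop).const_div_atTop lam0
  have hev1 : ∀ᶠ t in atTop, 2 * lam t * K ≤ κ * ((1 - r) / 2) := by
    have h1 : Tendsto (fun t => 2 * lam t * K) atTop (𝓝 (2 * 0 * K)) :=
      (hlamlim.const_mul 2).mul_const K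
    refine h1.eventually_le_const ?_
    have : 0 < κ * ((1 - r) / 2) := mul_pos hκ0 (by linarith)
    simpa using this
  have hev2 : ∀ᶠ t : ℕ in atTop, (1 + 1 / ((t : ℝ) + 1)) * ρ ≤ (1 + ρ) / 2 := by
    have h1 : Tendsto (fun t : ℕ => (1 + 1 / ((t : ℝ) + 1)) * ρ) atTop (𝓝 ((1 + 0) * ρ)) :=
      ((htop.const_div_atTop 1).const_add 1).mul_const ρ
    refine h1.eventually_le_const ?_
    linarith
  -- Since ς ≤ 1, the weight grows by a factor tending to 1, which does not spoil the contraction.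
  have hW : ∀ t : ℕ, ((t : ℝ) + 1 + 1) ^ ς ≤ (1 + 1 / ((t : ℝ) + 1)) * ((t : ℝ) + 1) ^ ς := by
    intro t
    have e : (t : ℝ) + 1 + 1 = (1 + 1 / ((t : ℝ) + 1)) * ((t : ℝ) + 1) := by field_simp
    have h0 : 1 ≤ 1 + 1 / ((t : ℝ) + 1) := by
      have : 0 ≤ 1 / ((t : ℝ) + 1) := by positivity
      linarith
    rw [e, Real.mul_rpow (by positivity) (by positivity)]
    refine mul_le_mul_of_nonneg_right ?_ (by positivity)
    calc _ ≤ (1 + 1 / ((t : ℝ) + 1)) ^ (1 : ℝ) := Real.rpow_le_rpow_of_exponent_le h0 hς1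
      _ = _ := Real.rpow_one _
  set w : ℕ → ℝ := fun t => x t + κ * y t with hw
  have hw0 : ∀ t, 0 ≤ w t := fun t => add_nonneg (hx t) (mul_nonneg hκ0.le (hy t))
  have hwrec : ∀ᶠ t : ℕ in atTop, w (t + 1) ≤ ρ * w t + 2 * c * lam t / ((t : ℝ) + 1) := by
    filter_upwards [hev1] with t ht
    set d := lam t * (c / ((t : ℝ) + 1)) with hd
    have hd0 : 0 ≤ d := mul_nonneg (hlam0 t) (by positivity)
    have e1 : 2 * c * lam t / ((t : ℝ) + 1) = 2 * d := by rw [hd]; ring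
    have h1 : x (t + 1) ≤ a * x t + d + lam t * K * y t := (hxr t).trans (le_of_eq (by rw [hd]; ring))
    have h2 := mul_le_mul_of_nonneg_left (hyr t) hκ0.le
    have hκM0 : 0 ≤ κ * M := mul_nonneg hκ0.le hM
    have h3 : w (t + 1) ≤ (1 + κ * M) * x (t + 1) + κ * M * x t + κ * r * y t := by
      simp only [hw]; linarith
    have h4 := mul_le_mul_of_nonneg_left h1 (by linarith : 0 ≤ 1 + κ * M)
    have h5 : (1 + κ * M) * (a * x t) + κ * M * x t ≤ ρ * x t := by
      have : (1 + κ * M) * a + κ * M ≤ ρ := by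
        refine le_trans ?_ (le_max_left _ _)
        nlinarith
      calc _ = ((1 + κ * M) * a + κ * M) * x t := by ring
        _ ≤ _ := mul_le_mul_of_nonneg_right this (hx t)
    have hκM1 : 1 + κ * M ≤ 2 := by linarith
    have h6 : (1 + κ * M) * d ≤ 2 * d := mul_le_mul_of_nonneg_right hκM1 hd0
    have h7 : (1 + κ * M) * (lam t * K * y t) + κ * r * y t ≤ ρ * (κ * y t) := by
      have h8 : (1 + κ * M) * (lam t * K) ≤ 2 * (lam t * K) :=
        mul_le_mul_of_nonneg_right hκM1 (mul_nonneg (hlam0 t) hK)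
      have h9 : (1 + r) / 2 ≤ ρ := le_max_right _ _
      have h10 : (1 + κ * M) * (lam t * K) + κ * r ≤ ρ * κ := by nlinarith
      calc _ = ((1 + κ * M) * (lam t * K) + κ * r) * y t := by ring
        _ ≤ ρ * κ * y t := mul_le_mul_of_nonneg_right h10 (hy t)
        _ = _ := by ring
    rw [e1]
    simp only [hw] at h3 ⊢
    linarith
  have hsum : Summable fun t : ℕ => ((t : ℝ) + 1) ^ ς * w t := by
    -- The exponent of the forcing is below -1 exactly because ς < v; the factor 4 is 2 from the
    -- recursion times 2 from the growth of the weight.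
    refine summable_of_contractive (ρ := (1 + ρ) / 2)
      (h := fun t : ℕ => 4 * c * lam0 * ((t : ℝ) + 1) ^ (ς - v - 1))
      (fun t => mul_nonneg (by positivity) (hw0 t)) (fun t => by positivity)
      (by linarith) ?_ ?_
    · refine Summable.mul_left _ ?_
      have := (summable_nat_add_iff 1).2 (Real.summable_nat_rpow.2 (by linarith : ς - v - 1 < -1))
      simpa using this
    · filter_upwards [hwrec, hev2] with t h1 h2
      have ht : (0 : ℝ) < (t : ℝ) + 1 := by positivity
      push_cast
      have h3 : ((t : ℝ) + 1 + 1) ^ ς ≤ 2 * ((t : ℝ) + 1) ^ ς := by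
        refine (hW t).trans (mul_le_mul_of_nonneg_right ?_ (by positivity))
        have : 1 / ((t : ℝ) + 1) ≤ 1 := by
          rw [div_le_one ht]; linarith [(Nat.cast_nonneg t : (0 : ℝ) ≤ t)]
        linarith
      have h4 : 0 ≤ 2 * c * lam t / ((t : ℝ) + 1) := by have := hlam0 t; positivity
      calc _ ≤ ((t : ℝ) + 1 + 1) ^ ς * (ρ * w t + 2 * c * lam t / ((t : ℝ) + 1)) :=
            mul_le_mul_of_nonneg_left h1 (by positivity)
        _ = ((t : ℝ) + 1 + 1) ^ ς * (ρ * w t)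
            + ((t : ℝ) + 1 + 1) ^ ς * (2 * c * lam t / ((t : ℝ) + 1)) := by ring
        _ ≤ ((1 + 1 / ((t : ℝ) + 1)) * ((t : ℝ) + 1) ^ ς) * (ρ * w t)
            + (2 * ((t : ℝ) + 1) ^ ς) * (2 * c * lam t / ((t : ℝ) + 1)) :=
            add_le_add (mul_le_mul_of_nonneg_right (hW t) (mul_nonneg hρ0 (hw0 t)))
              (mul_le_mul_of_nonneg_right h3 h4)
        _ ≤ _ := by
            refine add_le_add ?_ (le_of_eq ?_)
            · calc _ = ((1 + 1 / ((t : ℝ) + 1)) * ρ) * (((t : ℝ) + 1) ^ ς * w t) := by ring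
                _ ≤ _ := mul_le_mul_of_nonneg_right h2 (mul_nonneg (by positivity) (hw0 t))
            · rw [hlam, Real.rpow_sub ht, Real.rpow_sub ht, Real.rpow_one]
              field_simp
              ring
  constructor
  · refine Summable.of_nonneg_of_le (fun t => mul_nonneg (by positivity) (hx t)) (fun t => ?_) hsum
    refine mul_le_mul_of_nonneg_left ?_ (by positivity)
    simp only [hw]; linarith [mul_nonneg hκ0.le (hy t)]
  · refine Summable.of_nonneg_of_le (fun t => mul_nonneg (by positivity) (hy t)) (fun t => ?_)
      (hsum.mul_left κ⁻¹)
    rw [mul_left_comm]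
    refine mul_le_mul_of_nonneg_left ?_ (by positivity)
    rw [le_inv_mul_iff₀ hκ0]
    simp only [hw]; linarith [hx t]

end Conv

/-! ### Sensitivity recursions of a single learner. -/

namespace Algo

variable {m n : ℕ} {Ξ : Type*} (A : Algo m n Ξ)

theorem learner_fst_succ (i : Fin m) (D : ℕ → Ξ)
    (msg : (ℕ → Fin m → Vec n) × (ℕ → Fin m → Vec n)) (t : ℕ) :
    (A.learner i D msg (t + 1)).1 = (1 + A.C i i) • (A.learner i D msg t).1
      + ∑ j ∈ inNbrs A.C i, A.C i j • msg.1 t j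
      + A.lam t • A.empGrad D t (A.learner i D msg t).2 := rfl

theorem learner_snd_succ (i : Fin m) (D : ℕ → Ξ)
    (msg : (ℕ → Fin m → Vec n) × (ℕ → Fin m → Vec n)) (t : ℕ) :
    (A.learner i D msg (t + 1)).2 = (1 + A.R i i) • (A.learner i D msg t).2
      + ∑ j ∈ inNbrs A.R i, A.R i j • msg.2 t j
      - (1 / ((m : ℝ) * zEst A.R t i i)) •
        ((A.learner i D msg (t + 1)).1 - (A.learner i D msg t).1) := rfl

variable {A}

theorem l1norm_empGrad_le {cl : ℝ} (hloss : ∀ θ x, l1norm (A.gradLoss θ x) ≤ cl) (D : ℕ → Ξ)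
    (t : ℕ) (θ : Vec n) : l1norm (A.empGrad D t θ) ≤ cl := by
  have ht : (0 : ℝ) < (t : ℝ) + 1 := by positivity
  rw [empGrad, l1norm_smul, abs_of_pos (by positivity), one_div, inv_mul_le_iff₀ ht]
  refine (l1norm_sum_le _ _).trans ((Finset.sum_le_sum fun k _ => hloss _ _).trans ?_)
  simp

/-- Only one of the t + 1 averaged samples differs, which costs 2 * cl / (t + 1); at the common
samples only the parameters differ, and the Lipschitz bound applies. The factor n converts the
Euclidean norm to ℓ¹. -/
theorem l1norm_empGrad_sub_le {cl L : ℝ} (hloss : ∀ θ x, l1norm (A.gradLoss θ x) ≤ cl)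
    (hL : 0 ≤ L) (hlip : ∀ ξ θ₁ θ₂, ‖A.gradLoss θ₁ ξ - A.gradLoss θ₂ ξ‖ ≤ L * ‖θ₁ - θ₂‖)
    {D D' : ℕ → Ξ} (hD : Adjacent D D') (t : ℕ) (θ θ' : Vec n) :
    l1norm (A.empGrad D t θ - A.empGrad D' t θ')
      ≤ 2 * cl / ((t : ℝ) + 1) + n * L * l1norm (θ - θ') := by
  obtain ⟨k, -, hk⟩ := hD
  have ht : (0 : ℝ) < (t : ℝ) + 1 := by positivity
  have hcl : 0 ≤ cl := (l1norm_nonneg _).trans (hloss 0 (D 0))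
  have hnL : 0 ≤ n * L * l1norm (θ - θ') :=
    mul_nonneg (by positivity) (l1norm_nonneg _)
  rw [empGrad, empGrad, ← smul_sub, l1norm_smul, abs_of_pos (by positivity), one_div,
    inv_mul_le_iff₀ ht, ← Finset.sum_sub_distrib]
  refine (l1norm_sum_le _ _).trans ?_
  have h1 : ∀ j ∈ Finset.range (t + 1), l1norm (A.gradLoss θ (D j) - A.gradLoss θ' (D' j))
      ≤ (if j = k then 2 * cl else 0) + n * L * l1norm (θ - θ') := by
    intro j _
    split_ifs with hj
    · have := (l1norm_sub_le (A.gradLoss θ (D j)) (A.gradLoss θ' (D' j)))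
      linarith [hloss θ (D j), hloss θ' (D' j)]
    · rw [hk j hj, zero_add, mul_assoc]
      refine (l1norm_le _).trans (mul_le_mul_of_nonneg_left ?_ (Nat.cast_nonneg n))
      exact (hlip _ _ _).trans (mul_le_mul_of_nonneg_left (norm_le_l1norm _) hL)
  refine (Finset.sum_le_sum h1).trans ?_
  rw [Finset.sum_add_distrib, Finset.sum_ite_eq']
  have h2 : (if k ∈ Finset.range (t + 1) then 2 * cl else 0) ≤ 2 * cl := by
    split_ifs <;> linarith
  have e : ((t : ℝ) + 1) * (2 * cl / ((t : ℝ) + 1) + n * L * l1norm (θ - θ'))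
      = 2 * cl + ((t : ℝ) + 1) * (n * L * l1norm (θ - θ')) := by field_simp
  rw [e]
  simp only [Finset.sum_const, Finset.card_range, nsmul_eq_mul]
  push_cast
  linarith

theorem rhoS_zero (cl : ℝ) : A.rhoS cl 0 = 0 := by simp [rhoS]

theorem rhoS_succ (cl : ℝ) (t : ℕ) :
    A.rhoS cl (t + 1) = (1 - ⨅ j, |A.C j j|) * A.rhoS cl t + 2 * cl * A.lam t := by
  rw [rhoS, sum_Icc_geom_succ _ (fun p => A.lam (p - 1)), rhoS, Nat.add_sub_cancel]
  ring

theorem rhoθ_zero (cl cz γz ui : ℝ) : A.rhoθ cl cz γz ui 0 = 0 := by simp [rhoθ]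

theorem rhoθ_succ (cl cz γz ui : ℝ) (t : ℕ) :
    A.rhoθ cl cz γz ui (t + 1) = (1 - ⨅ j, |A.R j j|) * A.rhoθ cl cz γz ui t
      + (cz * γz ^ t + 1 / |ui|) * (A.rhoS cl (t + 1) + A.rhoS cl t) := by
  simp only [rhoθ, mul_assoc]
  rw [sum_Icc_geom_succ _ (fun q => (cz * γz ^ (q - 1) + 1 / |ui|)
    * (A.rhoS cl q + A.rhoS cl (q - 1)))]
  simp

theorem lam_pos (hl : 0 < A.lam0) (t : ℕ) : 0 < A.lam t := by
  unfold lam; positivity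

theorem diag_bounds {W : Matrix (Fin m) (Fin m) ℝ} (hneg : ∀ i, W i i < 0)
    (hgt : ∀ i, -1 < W i i) (i : Fin m) :
    |1 + W i i| = 1 + W i i ∧ 0 < 1 + W i i ∧ 1 + W i i < 1 ∧
      1 + W i i ≤ 1 - ⨅ j, |W j j| := by
  have h1 := hneg i
  have h2 := hgt i
  refine ⟨abs_of_pos (by linarith), by linarith, by linarith, ?_⟩
  have h3 : ⨅ j, |W j j| ≤ |W i i| :=
    ciInf_le (Set.finite_range fun j => |W j j|).bddBelow i
  rw [abs_of_neg h1] at h3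
  linarith

section Sens

variable {cl L : ℝ} (hc : CouplingAssumption A.R A.C) (hl : 0 < A.lam0)
  (hloss : ∀ θ x, l1norm (A.gradLoss θ x) ≤ cl)

include hc hl in
theorem l1norm_learner_fst_succ_le (i : Fin m) (D D' : ℕ → Ξ)
    (msg : (ℕ → Fin m → Vec n) × (ℕ → Fin m → Vec n)) (t : ℕ) :
    l1norm ((A.learner i D msg (t + 1)).1 - (A.learner i D' msg (t + 1)).1)
      ≤ (1 + A.C i i) * l1norm ((A.learner i D msg t).1 - (A.learner i D' msg t).1)
        + A.lam t * l1norm (A.empGrad D t (A.learner i D msg t).2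
          - A.empGrad D' t (A.learner i D' msg t).2) := by
  have e : (A.learner i D msg (t + 1)).1 - (A.learner i D' msg (t + 1)).1
      = (1 + A.C i i) • ((A.learner i D msg t).1 - (A.learner i D' msg t).1)
        + A.lam t • (A.empGrad D t (A.learner i D msg t).2
          - A.empGrad D' t (A.learner i D' msg t).2) := by
    rw [learner_fst_succ, learner_fst_succ, smul_sub, smul_sub]; abel
  rw [e]
  refine (l1norm_add_le _ _).trans ?_
  rw [l1norm_smul, l1norm_smul, (diag_bounds hc.C_diag_neg hc.C_diag_gt i).1,
    abs_of_pos (lam_pos hl t)]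

include hc in
theorem l1norm_learner_snd_succ_le (i : Fin m) (D D' : ℕ → Ξ)
    (msg : (ℕ → Fin m → Vec n) × (ℕ → Fin m → Vec n)) (t : ℕ) :
    l1norm ((A.learner i D msg (t + 1)).2 - (A.learner i D' msg (t + 1)).2)
      ≤ (1 + A.R i i) * l1norm ((A.learner i D msg t).2 - (A.learner i D' msg t).2)
        + |1 / ((m : ℝ) * zEst A.R t i i)| *
          (l1norm ((A.learner i D msg (t + 1)).1 - (A.learner i D' msg (t + 1)).1)
            + l1norm ((A.learner i D msg t).1 - (A.learner i D' msg t).1)) := by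
  have e : (A.learner i D msg (t + 1)).2 - (A.learner i D' msg (t + 1)).2
      = (1 + A.R i i) • ((A.learner i D msg t).2 - (A.learner i D' msg t).2)
        - (1 / ((m : ℝ) * zEst A.R t i i)) •
          (((A.learner i D msg (t + 1)).1 - (A.learner i D' msg (t + 1)).1)
            - ((A.learner i D msg t).1 - (A.learner i D' msg t).1)) := by
    rw [learner_snd_succ, learner_snd_succ]
    simp only [smul_sub]; abel
  rw [e]
  refine (l1norm_sub_le _ _).trans ?_
  rw [l1norm_smul, l1norm_smul, (diag_bounds hc.R_diag_neg hc.R_diag_gt i).1]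
  exact add_le_add le_rfl (mul_le_mul_of_nonneg_left (l1norm_sub_le _ _) (abs_nonneg _))

include hc hl hloss in
-- The averaging is ignored: two empirical gradients differ by at most 2 * cl whatever the data and
-- parameters, so the difference obeys the recursion of ϱ_{t,s}.
theorem l1norm_learner_fst_le (i : Fin m) (D D' : ℕ → Ξ)
    (msg : (ℕ → Fin m → Vec n) × (ℕ → Fin m → Vec n)) (t : ℕ) :
    l1norm ((A.learner i D msg t).1 - (A.learner i D' msg t).1) ≤ A.rhoS cl t := by
  induction t with
  | zero => simp [learner, l1norm_zero, rhoS_zero]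
  | succ t ih =>
    obtain ⟨-, h0, -, h1⟩ := diag_bounds hc.C_diag_neg hc.C_diag_gt i
    refine (l1norm_learner_fst_succ_le hc hl i D D' msg t).trans ?_
    rw [rhoS_succ]
    refine add_le_add (mul_le_mul h1 ih (l1norm_nonneg _) (h0.le.trans h1)) ?_
    rw [mul_comm]
    refine mul_le_mul_of_nonneg_right ((l1norm_sub_le _ _).trans ?_) (lam_pos hl t).le
    linarith [l1norm_empGrad_le hloss D t (A.learner i D msg t).2,
      l1norm_empGrad_le hloss D' t (A.learner i D' msg t).2]

theorem abs_inv_le_of_isEigenRate {R : Matrix (Fin m) (Fin m) ℝ} {u : Fin m → ℝ} {cz γz : ℝ}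
    (hr : IsEigenRate R u cz γz) (i : Fin m) (t : ℕ) :
    |1 / ((m : ℝ) * zEst R t i i)| ≤ cz * γz ^ t + 1 / |u i| := by
  have h1 := hr.2.2.2 i t
  have h2 := abs_sub_abs_le_abs_sub (1 / ((m : ℝ) * zEst R t i i)) (1 / u i)
  rw [abs_div 1 (u i), abs_one] at h2
  linarith

include hc hl hloss in
theorem l1norm_learner_snd_le {u : Fin m → ℝ} {cz γz : ℝ}
    (hr : IsEigenRate A.R u cz γz) (i : Fin m) (D D' : ℕ → Ξ)
    (msg : (ℕ → Fin m → Vec n) × (ℕ → Fin m → Vec n)) (t : ℕ) :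
    l1norm ((A.learner i D msg t).2 - (A.learner i D' msg t).2) ≤ A.rhoθ cl cz γz (u i) t := by
  induction t with
  | zero => simp [learner, l1norm_zero, rhoθ_zero]
  | succ t ih =>
    obtain ⟨-, h0, -, h1⟩ := diag_bounds hc.R_diag_neg hc.R_diag_gt i
    refine (l1norm_learner_snd_succ_le hc i D D' msg t).trans ?_
    rw [rhoθ_succ]
    refine add_le_add (mul_le_mul h1 ih (l1norm_nonneg _) (h0.le.trans h1)) ?_
    have h2 := abs_inv_le_of_isEigenRate hr i t
    exact mul_le_mul h2 (add_le_add (l1norm_learner_fst_le hc hl hloss i D D' msg _)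
      (l1norm_learner_fst_le hc hl hloss i D D' msg _))
      (add_nonneg (l1norm_nonneg _) (l1norm_nonneg _)) ((abs_nonneg _).trans h2)

include hc hl hloss in
theorem sensS_le (i : Fin m) (t : ℕ) : A.sensS i t ≤ ENNReal.ofReal (A.rhoS cl t) :=
  iSup_le fun D => iSup_le fun D' => iSup_le fun _ => iSup_le fun msg =>
    ENNReal.ofReal_le_ofReal (l1norm_learner_fst_le hc hl hloss i D D' msg t)

include hc hl hloss in
theorem sensθ_le {u : Fin m → ℝ} {cz γz : ℝ} (hr : IsEigenRate A.R u cz γz) (i : Fin m) (t : ℕ) :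
    A.sensθ i t ≤ ENNReal.ofReal (A.rhoθ cl cz γz (u i) t) :=
  iSup_le fun D => iSup_le fun D' => iSup_le fun _ => iSup_le fun msg =>
    ENNReal.ofReal_le_ofReal (l1norm_learner_snd_le hc hl hloss hr i D D' msg t)

end Sens

end Algo

/-! ### Privacy budgets from sensitivity bounds. -/

theorem noiseScale_pos {σ0 ς : ℝ} (hσ : 0 < σ0) (t : ℕ) : 0 < noiseScale σ0 ς t := by
  unfold noiseScale noiseStd; positivity

theorem div_noiseScale {σ0 ς : ℝ} (hσ : 0 < σ0) (ρ : ℝ) (t : ℕ) :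
    ρ / noiseScale σ0 ς t = √2 * ρ * ((t : ℝ) + 1) ^ ς / σ0 := by
  have h : (0 : ℝ) < ((t : ℝ) + 1) ^ ς := by positivity
  unfold noiseScale noiseStd
  field_simp

theorem budget_le {Δ : ℕ → ℝ≥0∞} {ρ : ℕ → ℝ} {σ0 ς : ℝ} (hσ : 0 < σ0) (hρ : ∀ t, 0 ≤ ρ t)
    (h : ∀ t, Δ t ≤ ENNReal.ofReal (ρ t)) (T : ℕ) :
    budget Δ (noiseScale σ0 ς) T
      ≤ ENNReal.ofReal (∑ t ∈ Finset.Icc 1 T, √2 * ρ t * ((t : ℝ) + 1) ^ ς / σ0) := by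
  rw [ENNReal.ofReal_sum_of_nonneg fun t _ => by have := hρ t; positivity]
  refine Finset.sum_le_sum fun t _ => ?_
  rw [← div_noiseScale hσ, ENNReal.ofReal_div_of_pos (noiseScale_pos hσ t)]
  exact ENNReal.div_le_div_right (h t) _

/-- Sensitivities that are summable against the weights `(t + 1) ^ ς` have a finite total budget. -/
theorem exists_budget_le {Δ : ℕ → ℝ≥0∞} {ρ : ℕ → ℝ} {σ0 ς : ℝ} (hσ : 0 < σ0) (hρ : ∀ t, 0 ≤ ρ t)
    (h : ∀ t, Δ t ≤ ENNReal.ofReal (ρ t)) (hs : Summable fun t : ℕ => ((t : ℝ) + 1) ^ ς * ρ t) :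
    ∃ B : ℝ, ∀ T, budget Δ (noiseScale σ0 ς) T ≤ ENNReal.ofReal B := by
  refine ⟨∑' t : ℕ, √2 / σ0 * (((t : ℝ) + 1) ^ ς * ρ t), fun T => ?_⟩
  refine (budget_le hσ hρ h T).trans (ENNReal.ofReal_le_ofReal ?_)
  have e : ∀ t : ℕ, √2 * ρ t * ((t : ℝ) + 1) ^ ς / σ0 = √2 / σ0 * (((t : ℝ) + 1) ^ ς * ρ t) :=
    fun t => by ring
  simp_rw [e]
  exact (hs.mul_left _).sum_le_tsum _ fun t _ => by have := hρ t; positivity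

/-- Sensitivity bounds with sharper decay, solving the coupled sensitivity recursion. -/
noncomputable def sensRec (lam : ℕ → ℝ) (a r M c K : ℝ) : ℕ → ℝ × ℝ
  | 0 => (0, 0)
  | t + 1 =>
    let x := sensRec lam a r M c K t
    let x' := a * x.1 + lam t * (c / ((t : ℝ) + 1) + K * x.2)
    (x', r * x.2 + M * (x' + x.1))

theorem sensRec_nonneg {lam : ℕ → ℝ} {a r M c K : ℝ} (hl : ∀ t, 0 ≤ lam t) (ha : 0 ≤ a)
    (hr : 0 ≤ r) (hM : 0 ≤ M) (hc : 0 ≤ c) (hK : 0 ≤ K) (t : ℕ) :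
    0 ≤ (sensRec lam a r M c K t).1 ∧ 0 ≤ (sensRec lam a r M c K t).2 := by
  induction t with
  | zero => simp [sensRec]
  | succ t ih =>
    obtain ⟨h1, h2⟩ := ih
    have h3 := hl t
    simp only [sensRec]
    constructor <;> positivity

/-- Both differences are tracked together, because the gradient difference involves that of the
parameters. The gain over ϱ is the forcing 2 * cl / (t + 1), at the price of the coupling n * L. -/
theorem Algo.sens_le_sensRec {m n : ℕ} {Ξ : Type*} {A : Algo m n Ξ} {cl L M : ℝ}
    (hc : CouplingAssumption A.R A.C) (hl : 0 < A.lam0)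
    (hloss : ∀ θ x, l1norm (A.gradLoss θ x) ≤ cl) (hL : 0 ≤ L)
    (hlip : ∀ ξ θ₁ θ₂, ‖A.gradLoss θ₁ ξ - A.gradLoss θ₂ ξ‖ ≤ L * ‖θ₁ - θ₂‖)
    (i : Fin m) (hM : ∀ t, |1 / ((m : ℝ) * zEst A.R t i i)| ≤ M) (t : ℕ) :
    A.sensS i t ≤ ENNReal.ofReal
        (sensRec A.lam (1 + A.C i i) (1 + A.R i i) M (2 * cl) (n * L) t).1 ∧
      A.sensθ i t ≤ ENNReal.ofReal
        (sensRec A.lam (1 + A.C i i) (1 + A.R i i) M (2 * cl) (n * L) t).2 := by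
  have hM0 : 0 ≤ M := (abs_nonneg _).trans (hM 0)
  obtain ⟨-, hC0, -, -⟩ := diag_bounds hc.C_diag_neg hc.C_diag_gt i
  obtain ⟨-, hR0, -, -⟩ := diag_bounds hc.R_diag_neg hc.R_diag_gt i
  have key : ∀ (D D' : ℕ → Ξ), Adjacent D D' → ∀ msg,
      l1norm ((A.learner i D msg t).1 - (A.learner i D' msg t).1)
        ≤ (sensRec A.lam (1 + A.C i i) (1 + A.R i i) M (2 * cl) (n * L) t).1 ∧
      l1norm ((A.learner i D msg t).2 - (A.learner i D' msg t).2)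
        ≤ (sensRec A.lam (1 + A.C i i) (1 + A.R i i) M (2 * cl) (n * L) t).2 := by
    intro D D' hD msg
    induction t with
    | zero => simp [learner, l1norm_zero, sensRec]
    | succ t ih =>
      obtain ⟨ih1, ih2⟩ := ih
      have hs : l1norm ((A.learner i D msg (t + 1)).1 - (A.learner i D' msg (t + 1)).1)
          ≤ (sensRec A.lam (1 + A.C i i) (1 + A.R i i) M (2 * cl) (n * L) (t + 1)).1 := by
        refine (l1norm_learner_fst_succ_le hc hl i D D' msg t).trans ?_
        simp only [sensRec]
        refine add_le_add (mul_le_mul_of_nonneg_left ih1 hC0.le)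
          (mul_le_mul_of_nonneg_left ?_ (lam_pos hl t).le)
        refine (l1norm_empGrad_sub_le hloss hL hlip hD t _ _).trans ?_
        exact add_le_add le_rfl (mul_le_mul_of_nonneg_left ih2 (by positivity))
      refine ⟨hs, (l1norm_learner_snd_succ_le hc i D D' msg t).trans ?_⟩
      simp only [sensRec] at hs ⊢
      refine add_le_add (mul_le_mul_of_nonneg_left ih2 hR0.le) ?_
      exact mul_le_mul (hM t) (add_le_add hs ih1)
        (add_nonneg (l1norm_nonneg _) (l1norm_nonneg _)) hM0
  exact ⟨iSup_le fun D => iSup_le fun D' => iSup_le fun h => iSup_le fun msg =>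
      ENNReal.ofReal_le_ofReal (key D D' h msg).1,
    iSup_le fun D => iSup_le fun D' => iSup_le fun h => iSup_le fun msg =>
      ENNReal.ofReal_le_ofReal (key D D' h msg).2⟩

/-- The cumulative privacy budgets are bounded uniformly in the horizon. -/
theorem Algo.exists_budgets_le {m n : ℕ} {Ξ : Type*} {A : Algo m n Ξ} {N : NoiseParams m}
    {cl L : ℝ} (hc : CouplingAssumption A.R A.C) (hrate : RateAssumption A.lam0 A.v N)
    (hcl : 0 ≤ cl) (hloss : ∀ θ x, l1norm (A.gradLoss θ x) ≤ cl) (hL : 0 ≤ L)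
    (hlip : ∀ ξ θ₁ θ₂, ‖A.gradLoss θ₁ ξ - A.gradLoss θ₂ ξ‖ ≤ L * ‖θ₁ - θ₂‖) (i : Fin m) :
    ∃ B : ℝ, ∀ T, budget (A.sensS i) (noiseScale (N.σζ i) (N.ςζ i)) T
      + budget (A.sensθ i) (noiseScale (N.σϑ i) (N.ςϑ i)) T ≤ ENNReal.ofReal B := by
  obtain ⟨u, hu, -⟩ := hc.existsUnique_isLeftPerron
  obtain ⟨cz, γz, hr⟩ := hc.exists_isEigenRate hu
  set M := cz + 1 / |u i| with hMdef
  have hM : ∀ t, |1 / ((m : ℝ) * zEst A.R t i i)| ≤ M := fun t => by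
    refine (abs_inv_le_of_isEigenRate hr i t).trans (add_le_add ?_ le_rfl)
    exact mul_le_of_le_one_right hr.1.le (pow_le_one₀ hr.2.1.le hr.2.2.1.le)
  have hM0 : 0 ≤ M := (abs_nonneg _).trans (hM 0)
  obtain ⟨-, hC0, hC1, -⟩ := diag_bounds hc.C_diag_neg hc.C_diag_gt i
  obtain ⟨-, hR0, hR1, -⟩ := diag_bounds hc.R_diag_neg hc.R_diag_gt i
  have hlam := lam_pos hrate.lam0_pos
  have hsens := sens_le_sensRec hc hrate.lam0_pos hloss hL hlip i hM
  have hnn := sensRec_nonneg (fun t => (hlam t).le) hC0.le hR0.le hM0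
    (by linarith : 0 ≤ 2 * cl) (by positivity : 0 ≤ (n : ℝ) * L)
  -- Kept general in ς because the two noises may decay at different rates.
  have hsum : ∀ ς : ℝ, 0 ≤ ς → ς ≤ 1 → ς < A.v → _ := fun ς h0 h1 h2 =>
    summable_coupled (ς := ς) (fun t => (hnn t).1) (fun t => (hnn t).2) hC0.le hC1 hR1 hM0
      (by linarith : 0 ≤ 2 * cl) (by positivity : 0 ≤ (n : ℝ) * L) hrate.lam0_pos h0 h1 h2
      (fun t => rfl : ∀ t : ℕ, A.lam t = A.lam0 / ((t : ℝ) + 1) ^ A.v)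
      (fun t => le_rfl) (fun t => le_rfl)
  obtain ⟨B₁, hB₁⟩ := exists_budget_le (hrate.σζ_pos i) (fun t => (hnn t).1)
    (fun t => (hsens t).1) (hsum (N.ςζ i) (by linarith [(hrate.ςζ_mem i).1])
      (hrate.ςζ_mem i).2.le (hrate.ςζ_lt i)).1
  obtain ⟨B₂, hB₂⟩ := exists_budget_le (hrate.σϑ_pos i) (fun t => (hnn t).2)
    (fun t => (hsens t).2) (hsum (N.ςϑ i) (by linarith [(hrate.ςϑ_mem i).1])
      (hrate.ςϑ_mem i).2.le (hrate.ςϑ_lt i)).2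
  -- Nonnegative parts, so that `ENNReal.ofReal` is additive.
  refine ⟨max B₁ 0 + max B₂ 0, fun T => ?_⟩
  rw [ENNReal.ofReal_add (le_max_right _ _) (le_max_right _ _)]
  exact add_le_add ((hB₁ T).trans (ENNReal.ofReal_le_ofReal (le_max_left _ _)))
    ((hB₂ T).trans (ENNReal.ofReal_le_ofReal (le_max_left _ _)))

end OnlineLDP

/-! ### Local differential privacy of the Laplace mechanism -/

namespace OnlineLDP

/-- A product measure comes from the largest outer measure bounded by products on boxes, so the
comparison need only be made on boxes. -/
theorem measurePi_mono {ι : Type*} [Fintype ι] {α : ι → Type*} [∀ i, MeasurableSpace (α i)]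
    {μ ν : ∀ i, Measure (α i)} [∀ i, SigmaFinite (μ i)] (h : ∀ i, μ i ≤ ν i) :
    Measure.pi μ ≤ Measure.pi ν := by
  refine Measure.le_iff.2 fun s hs => ?_
  rw [Measure.pi_def ν, toMeasure_apply _ _ hs]
  have h1 : (Measure.pi μ).toOuterMeasure ≤ OuterMeasure.pi fun i => (ν i).toOuterMeasure := by
    refine OuterMeasure.le_pi.2 fun s _ => ?_
    change Measure.pi μ _ ≤ _
    rw [Measure.pi_pi]
    exact Finset.prod_le_prod' fun i _ => Measure.le_iff'.1 (h i) (s i)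
  exact h1 s

/-- The constants multiply, so privacy losses add; used once over the coordinates of a round and
once over the rounds. -/
theorem measurePi_le_smul {ι : Type*} [Fintype ι] {α : ι → Type*} [∀ i, MeasurableSpace (α i)]
    {μ ν : ∀ i, Measure (α i)} [∀ i, IsFiniteMeasure (μ i)] [∀ i, IsFiniteMeasure (ν i)]
    {K : ι → ℝ≥0∞} (hK : ∀ i, K i ≠ ∞) (h : ∀ i, μ i ≤ K i • ν i) :
    Measure.pi μ ≤ (∏ i, K i) • Measure.pi ν := by
  have hfin : ∀ i, IsFiniteMeasure (K i • ν i) := fun i =>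
    ⟨by simpa using ENNReal.mul_lt_top (hK i).lt_top (measure_lt_top (ν i) _)⟩
  refine (measurePi_mono h).trans (le_of_eq ?_)
  refine Measure.pi_eq fun s _ => ?_
  simp [Measure.pi_pi, Finset.prod_mul_distrib]

/-- The density of the Laplace distribution. -/
noncomputable def laplaceDensity (ν x : ℝ) : ℝ≥0∞ :=
  ENNReal.ofReal (1 / (2 * ν) * Real.exp (-|x| / ν))

theorem measurable_laplaceDensity (ν : ℝ) : Measurable (laplaceDensity ν) := by
  unfold laplaceDensity; fun_prop

/-- Translation invariance of Lebesgue measure. -/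
theorem laplace_map_add (ν a : ℝ) :
    (laplace ν).map (fun x => x + a) = volume.withDensity fun x => laplaceDensity ν (x - a) := by
  ext s hs
  have hm : Measurable fun x : ℝ => x + a := measurable_id.add_const a
  rw [Measure.map_apply hm hs, laplace, withDensity_apply _ (hm hs), withDensity_apply _ hs,
    ← lintegral_indicator (hm hs), ← lintegral_indicator hs,
    ← lintegral_sub_right_eq_self (fun x => ((fun x => x + a) ⁻¹' s).indicator _ x) a]
  refine lintegral_congr fun x => ?_
  have hx : x - a ∈ (fun x => x + a) ⁻¹' s ↔ x ∈ s := by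
    rw [Set.mem_preimage, sub_add_cancel]
  by_cases h : x ∈ s
  · rw [Set.indicator_of_mem (hx.2 h), Set.indicator_of_mem h, laplaceDensity]
  · rw [Set.indicator_of_notMem (mt hx.1 h), Set.indicator_of_notMem h]

/-- By the triangle inequality |x - b| - |x - a| ≤ |a - b|, which bounds the quotient of the two
shifted densities pointwise. -/
theorem laplace_map_add_le {ν : ℝ} (hν : 0 < ν) (a b : ℝ) :
    (laplace ν).map (fun x => x + a)
      ≤ ENNReal.ofReal (Real.exp (|a - b| / ν)) • (laplace ν).map (fun x => x + b) := by
  have hmb : Measurable fun x => laplaceDensity ν (x - b) :=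
    (measurable_laplaceDensity ν).comp (measurable_id.sub_const b)
  rw [laplace_map_add, laplace_map_add, ← withDensity_smul _ hmb]
  refine withDensity_mono (ae_of_all _ fun x => ?_)
  simp only [Pi.smul_apply, smul_eq_mul, laplaceDensity]
  rw [← ENNReal.ofReal_mul (Real.exp_nonneg _)]
  refine ENNReal.ofReal_le_ofReal ?_
  rw [mul_left_comm]
  refine mul_le_mul_of_nonneg_left ?_ (by positivity)
  rw [← Real.exp_add, Real.exp_le_exp, ← add_div]
  refine div_le_div_of_nonneg_right ?_ hν.le
  have := abs_sub_abs_le_abs_sub (x - b) (x - a)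
  rw [show x - b - (x - a) = a - b by ring] at this
  linarith

section Mechanism

variable {Ω : Type*} [MeasurableSpace Ω] {P : Measure Ω} [IsProbabilityMeasure P]

/-- Independent real variables with comparable shifted laws have comparable shifted joint laws. -/
theorem map_add_le_of_iIndepFun {ι : Type*} [Fintype ι] {X : ι → Ω → ℝ}
    (hm : ∀ c, Measurable (X c)) (hi : iIndepFun X P) {ν : ι → ℝ} (hν : ∀ c, 0 < ν c)
    (hlaw : ∀ c, P.map (X c) = laplace (ν c)) (a b : ι → ℝ) :
    P.map (fun ω c => X c ω + a c)
      ≤ ENNReal.ofReal (Real.exp (∑ c, |a c - b c| / ν c)) • P.map (fun ω c => X c ω + b c) := by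
  have key : ∀ a : ι → ℝ, P.map (fun ω c => X c ω + a c)
      = Measure.pi fun c => P.map (fun ω => X c ω + a c) := fun a =>
    (iIndepFun_iff_map_fun_eq_pi_map fun c => ((hm c).add_const _).aemeasurable).1
      (hi.comp (fun c x => x + a c) fun c => measurable_id.add_const _)
  have hprob : ∀ (a : ι → ℝ) c, IsProbabilityMeasure (P.map (fun ω => X c ω + a c)) := fun a c =>
    Measure.isProbabilityMeasure_map ((hm c).add_const _).aemeasurable
  rw [key a, key b, Real.exp_sum, ENNReal.ofReal_prod_of_nonneg fun c _ => Real.exp_nonneg _]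
  have := hprob a
  have := hprob b
  refine measurePi_le_smul (fun c => ENNReal.ofReal_ne_top) fun c => ?_
  have e : ∀ x : ℝ, P.map (fun ω => X c ω + x) = (laplace (ν c)).map (fun y => y + x) := by
    intro x
    have hx : Measurable fun y : ℝ => y + x := measurable_id.add_const x
    rw [← hlaw c, Measure.map_map hx (hm c)]
    rfl
  rw [e, e]
  exact laplace_map_add_le (hν c) _ _

/-- Privacy loss of one round: both shared variables are perturbed by Laplace noise. -/
theorem map_round_le {n : ℕ} {Z V : Ω → Vec n} (hZ : Measurable Z) (hV : Measurable V)
    (hi : iIndepFun (fun (c : Fin n ⊕ Fin n) (ω : Ω) =>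
      Sum.elim (fun k => Z ω k) (fun k => V ω k) c) P) {ν₁ ν₂ : ℝ} (hν₁ : 0 < ν₁) (hν₂ : 0 < ν₂)
    (hZl : ∀ k, P.map (fun ω => Z ω k) = laplace ν₁)
    (hVl : ∀ k, P.map (fun ω => V ω k) = laplace ν₂) (a b a' b' : Vec n) :
    P.map (fun ω => (a + Z ω, b + V ω))
      ≤ ENNReal.ofReal (Real.exp (l1norm (a - a') / ν₁ + l1norm (b - b') / ν₂)) •
        P.map (fun ω => (a' + Z ω, b' + V ω)) := by
  -- Both noises are treated as one family of 2n independent real variables, and the pair of vectors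
  -- is recovered from it by g.
  set g : (Fin n ⊕ Fin n → ℝ) → Vec n × Vec n := fun x =>
    (WithLp.toLp 2 fun k => x (Sum.inl k), WithLp.toLp 2 fun k => x (Sum.inr k)) with hg
  have hgm : Measurable g := by
    refine Measurable.prodMk ?_ ?_ <;>
      exact (WithLp.measurable_toLp 2 _).comp (measurable_pi_lambda _ fun k => measurable_pi_apply _)
  have hZk : ∀ k, Measurable fun ω => Z ω k := fun k =>
    (measurable_pi_apply k).comp ((WithLp.measurable_ofLp 2 _).comp hZ)
  have hVk : ∀ k, Measurable fun ω => V ω k := fun k =>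
    (measurable_pi_apply k).comp ((WithLp.measurable_ofLp 2 _).comp hV)
  set X : Fin n ⊕ Fin n → Ω → ℝ := fun c ω => Sum.elim (fun k => Z ω k) (fun k => V ω k) c with hX
  have hXm : ∀ c, Measurable (X c) := by
    rintro (k | k)
    · exact hZk k
    · exact hVk k
  have e : ∀ a b : Vec n, P.map (fun ω => (a + Z ω, b + V ω))
      = (P.map fun ω c => X c ω + Sum.elim (fun k => a k) (fun k => b k) c).map g := by
    intro a b
    rw [Measure.map_map hgm (measurable_pi_lambda _ fun c => (hXm c).add_const _)]
    congr 1
    funext ω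
    refine Prod.ext ?_ ?_ <;> ext k <;> simp [hg, hX, add_comm]
  rw [e, e, ← Measure.map_smul]
  refine Measure.map_mono ?_ hgm
  have h := map_add_le_of_iIndepFun (ν := Sum.elim (fun _ => ν₁) fun _ => ν₂) hXm hi
    (by rintro (k | k) <;> simpa) (by rintro (k | k); exacts [hZl k, hVl k])
    (Sum.elim (fun k => a k) (fun k => b k)) (Sum.elim (fun k => a' k) (fun k => b' k))
  simpa [l1norm, Finset.sum_div] using h

end Mechanism

/-- Privacy of the implementation with any finite budget above the sum of the two cumulative
budgets. -/
theorem isLDP_implementation {m n : ℕ} {Ω Ξ : Type*} [MeasurableSpace Ω] [MeasurableSpace Ξ]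
    {P : Measure Ω} [IsProbabilityMeasure P] {A : Algo m n Ξ} {N : NoiseParams m}
    {ξ : Fin m → ℕ → Ω → Ξ} {ζ ϑ : Fin m → ℕ → Ω → Vec n}
    (hrate : RateAssumption A.lam0 A.v N) (hnoise : NoiseAssumption P N ξ ζ ϑ) (i : Fin m) (T : ℕ)
    {ε : ℝ≥0∞} (hε : ε ≠ ∞)
    (hb : budget (A.sensS i) (noiseScale (N.σζ i) (N.ςζ i)) T
      + budget (A.sensθ i) (noiseScale (N.σϑ i) (N.ςϑ i)) T ≤ ε) :
    IsLDP P (A.implementation i (ζ i) (ϑ i) T) ε.toReal := by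
  intro D D' hD msg O hO
  set ν₁ := noiseScale (N.σζ i) (N.ςζ i)
  set ν₂ := noiseScale (N.σϑ i) (N.ςϑ i)
  have hν₁ : ∀ t, 0 < ν₁ t := noiseScale_pos (hrate.σζ_pos i)
  have hν₂ : ∀ t, 0 < ν₂ t := noiseScale_pos (hrate.σϑ_pos i)
  set x : ℕ → ℝ := fun t => l1norm ((A.learner i D msg t).1 - (A.learner i D' msg t).1) / ν₁ t
    + l1norm ((A.learner i D msg t).2 - (A.learner i D' msg t).2) / ν₂ t with hx
  have hx1 : ∀ t, 0 ≤ l1norm ((A.learner i D msg t).1 - (A.learner i D' msg t).1) / ν₁ t :=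
    fun t => div_nonneg (l1norm_nonneg _) (hν₁ t).le
  have hx2 : ∀ t, 0 ≤ l1norm ((A.learner i D msg t).2 - (A.learner i D' msg t).2) / ν₂ t :=
    fun t => div_nonneg (l1norm_nonneg _) (hν₂ t).le
  -- The initial values do not depend on the data; hence round 0 costs nothing and the budgets start
  -- at t = 1.
  have hx0 : x 0 = 0 := by simp [hx, Algo.learner, l1norm_zero]
  have hsum : ∑ t : Fin (T + 1), x t ≤ ε.toReal := by
    rw [Fin.sum_univ_eq_sum_range, ← ENNReal.ofReal_le_iff_le_toReal hε]
    refine le_trans ?_ hb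
    have e : ∑ t ∈ Finset.range (T + 1), x t = ∑ t ∈ Finset.Icc 1 T, x t := by
      rw [Finset.range_eq_Ico, Finset.sum_eq_sum_Ico_succ_bot (by omega), hx0, zero_add]
      rfl
    rw [e, ENNReal.ofReal_sum_of_nonneg fun t _ => add_nonneg (hx1 t) (hx2 t), budget, budget,
      ← Finset.sum_add_distrib]
    refine Finset.sum_le_sum fun t _ => ?_
    rw [ENNReal.ofReal_add (hx1 t) (hx2 t), ENNReal.ofReal_div_of_pos (hν₁ t),
      ENNReal.ofReal_div_of_pos (hν₂ t)]
    refine add_le_add (ENNReal.div_le_div_right ?_ _) (ENNReal.div_le_div_right ?_ _)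
    · exact le_iSup_of_le D (le_iSup_of_le D' (le_iSup_of_le hD (le_iSup_of_le msg le_rfl)))
    · exact le_iSup_of_le D (le_iSup_of_le D' (le_iSup_of_le hD (le_iSup_of_le msg le_rfl)))
  have hround : ∀ (D : ℕ → Ξ) t, Measurable fun y : Fin m → Vec n × Vec n =>
      ((A.learner i D msg t).1 + (y i).1, (A.learner i D msg t).2 + (y i).2) := fun D t =>
    ((measurable_fst.comp (measurable_pi_apply i)).const_add _).prodMk
      ((measurable_snd.comp (measurable_pi_apply i)).const_add _)
  have hmt : ∀ (D : ℕ → Ξ) t, Measurable fun ω =>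
      ((A.learner i D msg t).1 + ζ i t ω, (A.learner i D msg t).2 + ϑ i t ω) := fun D t =>
    ((hnoise.measζ i t).const_add _).prodMk ((hnoise.measϑ i t).const_add _)
  have hm : ∀ D : ℕ → Ξ, Measurable (A.implementation i (ζ i) (ϑ i) T D msg) := fun D =>
    measurable_pi_lambda _ fun t => hmt D t
  -- With messages and data fixed, the states are constants, and independence of the noises over
  -- time makes the law of the output a product.
  have hpi : ∀ D : ℕ → Ξ, P.map (A.implementation i (ζ i) (ϑ i) T D msg)
      = Measure.pi fun t : Fin (T + 1) => P.map fun ω =>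
        ((A.learner i D msg t).1 + ζ i t ω, (A.learner i D msg t).2 + ϑ i t ω) := fun D =>
    (iIndepFun_iff_map_fun_eq_pi_map fun t : Fin (T + 1) => (hmt D t).aemeasurable).1
      ((hnoise.indep_time.precomp (g := fun t : Fin (T + 1) => (t : ℕ))
        Fin.val_injective).comp _ fun t => hround D t)
  have hprob : ∀ (D : ℕ → Ξ) (t : Fin (T + 1)), IsProbabilityMeasure (P.map fun ω =>
      ((A.learner i D msg t).1 + ζ i t ω, (A.learner i D msg t).2 + ϑ i t ω)) := fun D t =>
    Measure.isProbabilityMeasure_map (hmt D t).aemeasurable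
  have hle : P.map (A.implementation i (ζ i) (ϑ i) T D msg)
      ≤ ENNReal.ofReal (Real.exp (∑ t : Fin (T + 1), x t)) •
        P.map (A.implementation i (ζ i) (ϑ i) T D' msg) := by
    have := hprob D
    have := hprob D'
    rw [hpi, hpi, Real.exp_sum, ENNReal.ofReal_prod_of_nonneg fun c _ => Real.exp_nonneg _]
    exact measurePi_le_smul (fun c => ENNReal.ofReal_ne_top) fun t =>
      map_round_le (hnoise.measζ i t) (hnoise.measϑ i t) (hnoise.indep_coord i t) (hν₁ t) (hν₂ t)
        (hnoise.lawζ i t) (hnoise.lawϑ i t) _ _ _ _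
  have h1 := Measure.le_iff.1 hle O hO
  rw [Measure.smul_apply, smul_eq_mul, Measure.map_apply (hm D) hO,
    Measure.map_apply (hm D') hO] at h1
  refine h1.trans (mul_le_mul_left ?_ _)
  exact ENNReal.ofReal_le_ofReal (Real.exp_le_exp.2 hsum)

end OnlineLDP

/-! ### Gradients of the loss and of the objective -/

namespace OnlineLDP

theorem measurable_vec_iff {α : Type*} [MeasurableSpace α] {n : ℕ} {f : α → Vec n} :
    Measurable f ↔ ∀ k, Measurable fun x => f x k := by
  constructor
  · intro h k
    exact (measurable_pi_apply k).comp ((WithLp.measurable_ofLp 2 _).comp h)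
  · intro h
    exact (WithLp.measurable_toLp 2 (Fin n → ℝ)).comp (measurable_pi_lambda _ h)

theorem apply_eq_inner {n : ℕ} (x : Vec n) (k : Fin n) :
    x k = inner ℝ x (EuclideanSpace.single k (1 : ℝ)) := by
  simp [EuclideanSpace.inner_single_right]

namespace Algo

variable {m n : ℕ} {Ξ : Type*} {A : Algo m n Ξ}

theorem hasGradientAt_loss (hdiff : ∀ ξ, Differentiable ℝ fun θ => A.loss θ ξ) (θ : Vec n) (ξ : Ξ) :
    HasGradientAt (fun x => A.loss x ξ) (A.gradLoss θ ξ) θ :=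
  (hdiff ξ θ).hasGradientAt

theorem norm_gradLoss_le {cl : ℝ} (hloss : ∀ θ x, l1norm (A.gradLoss θ x) ≤ cl) (θ : Vec n)
    (ξ : Ξ) : ‖A.gradLoss θ ξ‖ ≤ cl := (norm_le_l1norm _).trans (hloss θ ξ)

theorem continuous_gradLoss {L : ℝ}
    (hlip : ∀ ξ θ₁ θ₂, ‖A.gradLoss θ₁ ξ - A.gradLoss θ₂ ξ‖ ≤ L * ‖θ₁ - θ₂‖) (ξ : Ξ) :
    Continuous fun θ => A.gradLoss θ ξ := by
  refine (LipschitzWith.of_dist_le_mul (K := L.toNNReal) fun x y => ?_).continuous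
  rw [dist_eq_norm, dist_eq_norm]
  exact (hlip ξ x y).trans (mul_le_mul_of_nonneg_right (Real.le_coe_toNNReal L) (norm_nonneg _))

variable [MeasurableSpace Ξ]

/-- Each coordinate is a pointwise limit of difference quotients, which are measurable in ξ. -/
theorem measurable_gradLoss (hmeas : ∀ θ, Measurable (A.loss θ))
    (hdiff : ∀ ξ, Differentiable ℝ fun θ => A.loss θ ξ) (θ : Vec n) :
    Measurable fun ξ => A.gradLoss θ ξ := by
  refine measurable_vec_iff.2 fun k => ?_
  set e : Vec n := EuclideanSpace.single k (1 : ℝ)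
  have hlim : ∀ ξ, Tendsto (fun j : ℕ => ((j : ℝ) + 1) •
      (A.loss (θ + ((j : ℝ) + 1)⁻¹ • e) ξ - A.loss θ ξ)) atTop (𝓝 (A.gradLoss θ ξ k)) := by
    intro ξ
    have h := (hasGradientAt_loss hdiff θ ξ).hasFDerivAt.hasLineDerivAt e
    have h1 : Tendsto (fun j : ℕ => ((j : ℝ) + 1)⁻¹) atTop (𝓝[≠] 0) := by
      refine tendsto_nhdsWithin_iff.2 ⟨?_, Eventually.of_forall fun j => ?_⟩
      · exact tendsto_inv_atTop_zero.comp
          (tendsto_atTop_add_const_right _ _ tendsto_natCast_atTop_atTop)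
      · have : (0 : ℝ) < (j : ℝ) + 1 := by positivity
        exact (inv_pos.2 this).ne'
    have h2 := (hasLineDerivAt_iff_tendsto_slope_zero.1 h).comp h1
    rw [apply_eq_inner]
    refine h2.congr fun j => ?_
    simp
  exact measurable_of_tendsto_metrizable
    (fun j => ((hmeas _).sub (hmeas _)).const_smul ((j : ℝ) + 1)) (tendsto_pi_nhds.2 hlim)

/-- Carathéodory: continuous in θ and measurable in ξ. Joint measurability is needed because the
algorithm evaluates gradients at random points. -/
theorem measurable_uncurry_gradLoss {L : ℝ} (hmeas : ∀ θ, Measurable (A.loss θ))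
    (hdiff : ∀ ξ, Differentiable ℝ fun θ => A.loss θ ξ)
    (hlip : ∀ ξ θ₁ θ₂, ‖A.gradLoss θ₁ ξ - A.gradLoss θ₂ ξ‖ ≤ L * ‖θ₁ - θ₂‖) :
    Measurable fun x : Vec n × Ξ => A.gradLoss x.1 x.2 :=
  measurable_uncurry_of_continuous_of_measurable (fun ξ => continuous_gradLoss hlip ξ)
    (fun θ => measurable_gradLoss hmeas hdiff θ)

variable {Q : Fin m → Measure Ξ} [∀ i, IsProbabilityMeasure (Q i)] {κ L cl D : ℝ}

/-- Differentiation under the integral sign, dominated by the constant cl. It excludes that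
`gradient` takes its default value 0 at a point of nondifferentiability. -/
theorem hasGradientAt_localObj (hgrad : GradientAssumption A Q κ L)
    (hloss : ∀ θ x, l1norm (A.gradLoss θ x) ≤ cl) (i : Fin m) (θ : Vec n) :
    HasGradientAt (A.localObj Q i) (gradient (A.localObj Q i) θ) θ := by
  have h := hasFDerivAt_integral_of_dominated_of_fderiv_le (μ := Q i) (s := Set.univ) (x₀ := θ)
    (F := A.loss) (F' := fun θ ξ => InnerProductSpace.toDual ℝ (Vec n) (A.gradLoss θ ξ))
    (bound := fun _ => cl) Filter.univ_mem
    (Eventually.of_forall fun θ => (hgrad.integrable i θ).aestronglyMeasurable)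
    (hgrad.integrable i θ)
    ((InnerProductSpace.toDual ℝ (Vec n)).continuous.comp_aestronglyMeasurable
      (hgrad.unbiased i θ).1.aestronglyMeasurable)
    (ae_of_all _ fun ξ θ _ => by
      rw [LinearIsometryEquiv.norm_map]; exact norm_gradLoss_le hloss θ ξ)
    (integrable_const _)
    (ae_of_all _ fun ξ θ _ => (hasGradientAt_loss hgrad.diff θ ξ).hasFDerivAt)
  exact h.differentiableAt.hasGradientAt

theorem hasGradientAt_obj (hgrad : GradientAssumption A Q κ L)
    (hloss : ∀ θ x, l1norm (A.gradLoss θ x) ≤ cl) (θ : Vec n) :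
    HasGradientAt (A.obj Q) ((1 / (m : ℝ)) • ∑ i, gradient (A.localObj Q i) θ) θ := by
  have h := (HasFDerivAt.fun_sum (u := Finset.univ) fun i _ =>
    (hasGradientAt_localObj hgrad hloss i θ).hasFDerivAt).const_mul (1 / (m : ℝ))
  rw [hasGradientAt_iff_hasFDerivAt, map_smulₛₗ, map_sum]
  exact h

theorem gradient_obj (hgrad : GradientAssumption A Q κ L)
    (hloss : ∀ θ x, l1norm (A.gradLoss θ x) ≤ cl) (θ : Vec n) :
    gradient (A.obj Q) θ = (1 / (m : ℝ)) • ∑ i, gradient (A.localObj Q i) θ :=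
  (hasGradientAt_obj hgrad hloss θ).gradient

theorem norm_average_le (hm : 0 < m) {E : Type*} [NormedAddCommGroup E] [NormedSpace ℝ E]
    {f : Fin m → E} {B : ℝ} (h : ∀ i, ‖f i‖ ≤ B) : ‖(1 / (m : ℝ)) • ∑ i, f i‖ ≤ B := by
  have hm' : (0 : ℝ) < m := by exact_mod_cast hm
  rw [norm_smul, Real.norm_of_nonneg (by positivity), one_div, inv_mul_le_iff₀ hm']
  refine (norm_sum_le _ _).trans ((Finset.sum_le_sum fun i _ => h i).trans ?_)
  simp

theorem norm_gradient_obj_le (hm : 0 < m) (hgrad : GradientAssumption A Q κ L)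
    (hloss : ∀ θ x, l1norm (A.gradLoss θ x) ≤ cl)
    (hbdd : ∀ i θ, ‖gradient (A.localObj Q i) θ‖ ≤ D) (θ : Vec n) :
    ‖gradient (A.obj Q) θ‖ ≤ D := by
  rw [gradient_obj hgrad hloss]
  exact norm_average_le hm fun i => hbdd i θ

theorem norm_gradient_localObj_sub_le (hgrad : GradientAssumption A Q κ L) (i : Fin m)
    (x y : Vec n) :
    ‖gradient (A.localObj Q i) x - gradient (A.localObj Q i) y‖ ≤ L * ‖x - y‖ := by
  rw [← (hgrad.unbiased i x).2, ← (hgrad.unbiased i y).2,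
    ← integral_sub (hgrad.unbiased i x).1 (hgrad.unbiased i y).1]
  have h := norm_integral_le_of_norm_le_const (μ := Q i)
    (ae_of_all _ fun ξ => hgrad.lipschitz ξ x y)
  simpa using h

theorem norm_gradient_obj_sub_le (hm : 0 < m) (hgrad : GradientAssumption A Q κ L)
    (hloss : ∀ θ x, l1norm (A.gradLoss θ x) ≤ cl) (x y : Vec n) :
    ‖gradient (A.obj Q) x - gradient (A.obj Q) y‖ ≤ L * ‖x - y‖ := by
  rw [gradient_obj hgrad hloss, gradient_obj hgrad hloss, ← smul_sub, ← Finset.sum_sub_distrib]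
  exact norm_average_le hm fun i => norm_gradient_localObj_sub_le hgrad i x y

end Algo

/-! ### First-order convexity, descent and growth. -/

section Convexity

variable {n : ℕ} {F : Vec n → ℝ} {D L : ℝ}

/-- First-order characterization of convexity. -/
def FirstOrderConvex (F : Vec n → ℝ) : Prop :=
  ∀ x y, F x + inner ℝ (gradient F x) (y - x) ≤ F y

theorem firstOrderConvex_of_bound (h : ∀ x y, ∃ μ : ℝ, 0 ≤ μ ∧ ConvexityBound F μ x y) :
    FirstOrderConvex F := by
  intro x y
  obtain ⟨μ, hμ, hb⟩ := h x y
  have : 0 ≤ μ / 2 * ‖x - y‖ ^ 2 := by positivity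
  unfold ConvexityBound at hb
  linarith

theorem FirstOrderConvex.sub_le (hF : FirstOrderConvex F) (hD : ∀ x, ‖gradient F x‖ ≤ D)
    (x y : Vec n) : F x - F y ≤ D * ‖x - y‖ := by
  have h1 := hF x y
  have h2 : -inner ℝ (gradient F x) (y - x) ≤ ‖gradient F x‖ * ‖y - x‖ :=
    (neg_le_abs _).trans (abs_real_inner_le_norm _ _)
  have h3 := mul_le_mul_of_nonneg_right (hD x) (norm_nonneg (y - x))
  rw [norm_sub_rev x y]
  linarith

theorem FirstOrderConvex.abs_sub_le (hF : FirstOrderConvex F) (hD : ∀ x, ‖gradient F x‖ ≤ D)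
    (x y : Vec n) : |F x - F y| ≤ D * ‖x - y‖ := by
  rw [abs_le]
  constructor
  · have := hF.sub_le hD y x
    rw [norm_sub_rev] at this
    linarith
  · exact hF.sub_le hD x y

theorem FirstOrderConvex.continuous (hF : FirstOrderConvex F) (hD : ∀ x, ‖gradient F x‖ ≤ D) :
    Continuous F := by
  refine (LipschitzWith.of_dist_le_mul (K := D.toNNReal) fun x y => ?_).continuous
  rw [Real.dist_eq, dist_eq_norm]
  exact (hF.abs_sub_le hD x y).trans
    (mul_le_mul_of_nonneg_right (Real.le_coe_toNNReal D) (norm_nonneg _))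

/-- The descent inequality for a convex function with Lipschitz gradient. -/
theorem FirstOrderConvex.descent (hF : FirstOrderConvex F)
    (hL : ∀ x y, ‖gradient F x - gradient F y‖ ≤ L * ‖x - y‖) (x h : Vec n) :
    F (x + h) ≤ F x + inner ℝ (gradient F x) h + L * ‖h‖ ^ 2 := by
  -- Convexity is used at x + h looking back to x, which avoids integration along the segment and
  -- costs only L in place of L / 2.
  have h1 := hF (x + h) x
  rw [show x - (x + h) = -h by abel, inner_neg_right] at h1
  have h2 : inner ℝ (gradient F (x + h) - gradient F x) h
      ≤ ‖gradient F (x + h) - gradient F x‖ * ‖h‖ := real_inner_le_norm _ _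
  have h3 := mul_le_mul_of_nonneg_right (hL (x + h) x) (norm_nonneg h)
  rw [show x + h - x = h by abel] at h3
  rw [inner_sub_left] at h2
  nlinarith

/-- A strictly convex function grows at least linearly away from its minimizer. -/
theorem exists_linear_growth {x₀ : Vec n} (hF : FirstOrderConvex F)
    (hstrict : ∀ x y, ∃ μ : ℝ, 0 < μ ∧ ConvexityBound F μ x y) (hcont : Continuous F)
    (hmin : ∀ x, F x₀ ≤ F x) {δ : ℝ} (hδ : 0 < δ) :
    ∃ c : ℝ, 0 ≤ c ∧ ∀ x, ‖x - x₀‖ ≤ δ + c * (F x - F x₀) := by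
  -- At the midpoint of x and x₀ the strict bound towards x₀ and the plain bound towards x have
  -- opposite linear terms; adding them gives a strict inequality without using that the gradient at
  -- x₀ vanishes.
  have hlt : ∀ x, x ≠ x₀ → F x₀ < F x := by
    intro x hx
    set p : Vec n := (1 / 2 : ℝ) • (x + x₀) with hp
    obtain ⟨μ₁, hμ₁, h1⟩ := hstrict p x₀
    have h2 := hF p x
    have e1 : x - p = -(x₀ - p) := by rw [hp]; module
    have e2 : p - x₀ = (1 / 2 : ℝ) • (x - x₀) := by rw [hp]; module
    rw [e1, inner_neg_right] at h2
    unfold ConvexityBound at h1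
    rw [e2, norm_smul] at h1
    have h3 : 0 < ‖x - x₀‖ := norm_pos_iff.2 (sub_ne_zero.2 hx)
    have h4 : 0 < μ₁ / 2 * (‖(1 / 2 : ℝ)‖ * ‖x - x₀‖) ^ 2 := by
      have : 0 < ‖(1 / 2 : ℝ)‖ := by norm_num
      positivity
    linarith [hmin p]
  -- The sphere is empty only in dimension 0.
  rcases (Metric.sphere x₀ δ).eq_empty_or_nonempty with hempty | hne
  · refine ⟨0, le_rfl, fun x => ?_⟩
    by_contra hcon
    rw [zero_mul, add_zero, not_le] at hcon
    have h0 : 0 < ‖x - x₀‖ := hδ.trans hcon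
    have : x₀ + (δ / ‖x - x₀‖) • (x - x₀) ∈ Metric.sphere x₀ δ := by
      rw [mem_sphere_iff_norm, add_sub_cancel_left, norm_smul,
        Real.norm_of_nonneg (by positivity), div_mul_cancel₀ _ h0.ne']
    rw [hempty] at this
    exact this
  -- Compactness replaces a uniform μ: the gap has a positive minimum on the sphere, and beyond it
  -- convexity along the ray from x₀ makes the gap grow at least proportionally to the distance.
  · obtain ⟨q, hq, hqmin⟩ := (isCompact_sphere x₀ δ).exists_isMinOn hne hcont.continuousOn
    have hqne : q ≠ x₀ := by
      rintro rfl
      rw [mem_sphere_iff_norm, sub_self, norm_zero] at hq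
      exact hδ.ne hq
    have hg : 0 < F q - F x₀ := sub_pos.2 (hlt q hqne)
    refine ⟨δ / (F q - F x₀), by positivity, fun x => ?_⟩
    rcases le_or_gt ‖x - x₀‖ δ with hle | hgt
    · have : 0 ≤ δ / (F q - F x₀) * (F x - F x₀) :=
        mul_nonneg (by positivity) (sub_nonneg.2 (hmin x))
      linarith
    · have h0 : 0 < ‖x - x₀‖ := hδ.trans hgt
      set τ := δ / ‖x - x₀‖ with hτ
      have hτ0 : 0 < τ := by positivity
      set p : Vec n := x₀ + τ • (x - x₀) with hp
      have hps : p ∈ Metric.sphere x₀ δ := by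
        rw [mem_sphere_iff_norm, hp, add_sub_cancel_left, norm_smul,
          Real.norm_of_nonneg hτ0.le, hτ, div_mul_cancel₀ _ h0.ne']
      have h1 : F q ≤ F p := hqmin hps
      have h2 := hF p x
      have h3 := hF p x₀
      have e1 : x - p = (1 - τ) • (x - x₀) := by rw [hp]; module
      have e2 : x₀ - p = (-τ) • (x - x₀) := by rw [hp]; module
      rw [e1, inner_smul_right] at h2
      rw [e2, inner_smul_right] at h3
      have hτ1 : τ ≤ 1 := by rw [hτ, div_le_one h0]; exact hgt.le
      have h4 : F p ≤ (1 - τ) * F x₀ + τ * F x := by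
        nlinarith [mul_le_mul_of_nonneg_left h2 hτ0.le,
          mul_le_mul_of_nonneg_left h3 (sub_nonneg.2 hτ1)]
      have h5 : F q - F x₀ ≤ τ * (F x - F x₀) := by linarith
      have h6 : ‖x - x₀‖ ≤ δ / (F q - F x₀) * (F x - F x₀) := by
        rw [div_mul_eq_mul_div, le_div_iff₀ hg]
        calc ‖x - x₀‖ * (F q - F x₀) ≤ ‖x - x₀‖ * (τ * (F x - F x₀)) :=
              mul_le_mul_of_nonneg_left h5 h0.le
          _ = δ * (F x - F x₀) := by rw [hτ]; field_simp
      linarith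

end Convexity

end OnlineLDP

/-! ### Moments of the noise, and its independence of the past -/

namespace OnlineLDP

/-- The integrand is even, and the half line gives the Gamma integral Γ(3) = 2. -/
theorem integral_sq_mul_laplace {ν : ℝ} (hν : 0 < ν) :
    ∫ x : ℝ, 1 / (2 * ν) * Real.exp (-|x| / ν) * x ^ 2 = 2 * ν ^ 2 := by
  have h := integral_comp_abs (f := fun x => 1 / (2 * ν) * Real.exp (-x / ν) * x ^ 2)
  simp only [sq_abs] at h
  rw [h]
  have h2 := Real.integral_rpow_mul_exp_neg_mul_Ioi (a := 3) (r := 1 / ν) (by norm_num)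
    (by positivity)
  have e : ∀ x : ℝ, 1 / (2 * ν) * Real.exp (-x / ν) * x ^ 2
      = 1 / (2 * ν) * (x ^ (3 - 1 : ℝ) * Real.exp (-(1 / ν * x))) := by
    intro x
    rw [show (3 - 1 : ℝ) = (2 : ℕ) by norm_num, Real.rpow_natCast,
      show -(1 / ν * x) = -x / ν by ring]
    ring
  simp_rw [e]
  rw [integral_const_mul, h2, one_div_one_div,
    show (3 : ℝ) = ((2 : ℕ) : ℝ) + 1 by norm_num, Real.Gamma_nat_eq_factorial,
    show ((2 : ℕ) : ℝ) + 1 = ((3 : ℕ) : ℝ) by norm_num, Real.rpow_natCast]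
  simp [Nat.factorial]
  field_simp

theorem integrable_sq_laplace {ν : ℝ} (hν : 0 < ν) :
    Integrable (fun x : ℝ => x ^ 2) (laplace ν) ∧ ∫ x, x ^ 2 ∂(laplace ν) = 2 * ν ^ 2 := by
  have hm := measurable_laplaceDensity ν
  have h := integral_sq_mul_laplace hν
  have htop : ∀ᵐ x : ℝ, laplaceDensity ν x < ∞ := ae_of_all _ fun x => ENNReal.ofReal_lt_top
  have e : ∀ x : ℝ, (laplaceDensity ν x).toReal • x ^ 2
      = 1 / (2 * ν) * Real.exp (-|x| / ν) * x ^ 2 := by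
    intro x
    rw [laplaceDensity, ENNReal.toReal_ofReal (by positivity), smul_eq_mul]
  constructor
  · change Integrable _ (volume.withDensity (laplaceDensity ν))
    rw [integrable_withDensity_iff_integrable_smul' hm htop]
    simp_rw [e]
    -- A nonintegrable function would have integral 0, whereas the value 2 * ν ^ 2 is nonzero.
    refine Integrable.of_integral_ne_zero ?_
    rw [h]; positivity
  · change ∫ x, x ^ 2 ∂(volume.withDensity (laplaceDensity ν)) = _
    rw [integral_withDensity_eq_integral_toReal_smul hm htop]
    simp_rw [e]
    exact h

theorem integral_id_laplace (ν : ℝ) : ∫ x, x ∂(laplace ν) = 0 := by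
  have hm := measurable_laplaceDensity ν
  have htop : ∀ᵐ x : ℝ, laplaceDensity ν x < ∞ := ae_of_all _ fun x => ENNReal.ofReal_lt_top
  change ∫ x, x ∂(volume.withDensity (laplaceDensity ν)) = _
  rw [integral_withDensity_eq_integral_toReal_smul hm htop]
  have h := integral_neg_eq_self (fun x : ℝ => (laplaceDensity ν x).toReal • x) volume
  have e : ∀ x : ℝ, (laplaceDensity ν (-x)).toReal • (-x)
      = -((laplaceDensity ν x).toReal • x) := by
    intro x; simp [laplaceDensity, abs_neg]
  simp_rw [e, integral_neg] at h
  linarith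

section Random

variable {Ω : Type*} [MeasurableSpace Ω] {P : Measure Ω}

theorem laplace_moments {X : Ω → ℝ} (hX : Measurable X) {ν : ℝ} (hν : 0 < ν)
    (hlaw : P.map X = laplace ν) :
    MemLp X 2 P ∧ ∫ ω, X ω ∂P = 0 ∧ ∫ ω, X ω ^ 2 ∂P = 2 * ν ^ 2 := by
  obtain ⟨h1, h2⟩ := integrable_sq_laplace hν
  rw [← hlaw] at h1 h2
  refine ⟨?_, ?_, ?_⟩
  · rw [memLp_two_iff_integrable_sq hX.aestronglyMeasurable]
    exact h1.comp_measurable hX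
  · have := integral_id_laplace ν
    rwa [← hlaw, integral_map hX.aemeasurable (by fun_prop)] at this
  · rwa [integral_map hX.aemeasurable (by fun_prop)] at h2

/-- Associativity of the product measure of the three laws. -/
theorem indepFun_prodMk_right [IsProbabilityMeasure P] {α β γ : Type*} [MeasurableSpace α]
    [MeasurableSpace β] [MeasurableSpace γ] {U : Ω → α} {V : Ω → β} {W : Ω → γ}
    (hU : Measurable U) (hV : Measurable V) (hW : Measurable W) (h1 : IndepFun U V P)
    (h2 : IndepFun (fun ω => (U ω, V ω)) W P) : IndepFun U (fun ω => (V ω, W ω)) P := by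
  have := Measure.isProbabilityMeasure_map (μ := P) hU.aemeasurable
  have := Measure.isProbabilityMeasure_map (μ := P) hV.aemeasurable
  have := Measure.isProbabilityMeasure_map (μ := P) hW.aemeasurable
  have h3 : IndepFun V W P := h2.comp measurable_snd measurable_id
  rw [indepFun_iff_map_prod_eq_prod_map_map hU.aemeasurable (hV.prodMk hW).aemeasurable,
    (indepFun_iff_map_prod_eq_prod_map_map hV.aemeasurable hW.aemeasurable).1 h3,
    ← (measurePreserving_prodAssoc (P.map U) (P.map V) (P.map W)).map_eq,
    ← (indepFun_iff_map_prod_eq_prod_map_map hU.aemeasurable hV.aemeasurable).1 h1,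
    ← (indepFun_iff_map_prod_eq_prod_map_map (hU.prodMk hV).aemeasurable hW.aemeasurable).1 h2,
    Measure.map_map MeasurableEquiv.prodAssoc.measurable ((hU.prodMk hV).prodMk hW)]
  rfl

end Random

namespace Algo

variable {m n : ℕ} {Ξ : Type*} {A : Algo m n Ξ}

/-- The state of the network depends only on the noises of the past. -/
theorem network_congr (D : Fin m → ℕ → Ξ) {ζ ϑ ζ' ϑ' : Fin m → ℕ → Vec n} {t : ℕ}
    (hζ : ∀ k < t, ∀ i, ζ i k = ζ' i k) (hϑ : ∀ k < t, ∀ i, ϑ i k = ϑ' i k) :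
    A.network D ζ ϑ t = A.network D ζ' ϑ' t := by
  induction t with
  | zero => rfl
  | succ t ih =>
    have h := ih (fun k hk => hζ k (hk.trans t.lt_succ_self)) fun k hk => hϑ k (hk.trans t.lt_succ_self)
    funext i
    simp only [network, h, hζ t t.lt_succ_self, hϑ t t.lt_succ_self]

variable [MeasurableSpace Ξ]

theorem measurable_empGrad {α : Type*} [MeasurableSpace α]
    (hg : Measurable fun x : Vec n × Ξ => A.gradLoss x.1 x.2) {D : α → ℕ → Ξ} {θ : α → Vec n}
    (hD : ∀ k, Measurable fun x => D x k) (hθ : Measurable θ) (t : ℕ) :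
    Measurable fun x => A.empGrad (D x) t (θ x) := by
  unfold empGrad
  have h : Measurable fun x => ∑ k ∈ Finset.range (t + 1), A.gradLoss (θ x) (D x k) :=
    Finset.measurable_fun_sum _ fun k _ => hg.comp (hθ.prodMk (hD k))
  exact h.const_smul (1 / ((t : ℝ) + 1))

theorem measurable_network {α : Type*} [MeasurableSpace α]
    (hg : Measurable fun x : Vec n × Ξ => A.gradLoss x.1 x.2) {D : α → Fin m → ℕ → Ξ}
    {ζ ϑ : α → Fin m → ℕ → Vec n} (hD : ∀ i k, Measurable fun x => D x i k)
    (hζ : ∀ i k, Measurable fun x => ζ x i k) (hϑ : ∀ i k, Measurable fun x => ϑ x i k)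
    (t : ℕ) (i : Fin m) : Measurable fun x => A.network (D x) (ζ x) (ϑ x) t i := by
  induction t generalizing i with
  | zero => exact measurable_const
  | succ t ih =>
    have h1 : ∀ i, Measurable fun x => (A.network (D x) (ζ x) (ϑ x) t i).1 :=
      fun i => (ih i).fst
    have h2 : ∀ i, Measurable fun x => (A.network (D x) (ζ x) (ϑ x) t i).2 :=
      fun i => (ih i).snd
    have h3 : Measurable fun x => ∑ j ∈ inNbrs A.C i,
        A.C i j • ((A.network (D x) (ζ x) (ϑ x) t j).1 + ζ x j t) :=
      Finset.measurable_fun_sum _ fun j _ => ((h1 j).add (hζ j t)).const_smul (A.C i j)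
    have h4 : Measurable fun x => ∑ j ∈ inNbrs A.R i,
        A.R i j • ((A.network (D x) (ζ x) (ϑ x) t j).2 + ϑ x j t) :=
      Finset.measurable_fun_sum _ fun j _ => ((h2 j).add (hϑ j t)).const_smul (A.R i j)
    have h5 := (measurable_empGrad hg (fun k => hD i k) (h2 i) t).const_smul (A.lam t)
    have hs : Measurable fun x => (1 + A.C i i) • (A.network (D x) (ζ x) (ϑ x) t i).1
        + ∑ j ∈ inNbrs A.C i, A.C i j • ((A.network (D x) (ζ x) (ϑ x) t j).1 + ζ x j t)
        + A.lam t • A.empGrad (D x i) t (A.network (D x) (ζ x) (ϑ x) t i).2 :=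
      (((h1 i).const_smul (1 + A.C i i)).add h3).add h5
    have h6 : Measurable fun x => (1 + A.R i i) • (A.network (D x) (ζ x) (ϑ x) t i).2 :=
      (h2 i).const_smul (1 + A.R i i)
    have h7 := (hs.sub (h1 i)).const_smul (1 / ((m : ℝ) * zEst A.R t i i))
    exact hs.prodMk ((h6.add h4).sub h7)

variable {Ω : Type*} [MeasurableSpace Ω] {P : Measure Ω} [IsProbabilityMeasure P]

/-- The noises at time `t` are independent of the state of the network at time `t`. -/
theorem indepFun_noise_network (hg : Measurable fun x : Vec n × Ξ => A.gradLoss x.1 x.2)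
    {N : NoiseParams m} {Q : Fin m → Measure Ξ} {ξ : Fin m → ℕ → Ω → Ξ}
    {ζ ϑ : Fin m → ℕ → Ω → Vec n} (hdata : DataAssumption P Q ξ)
    (hnoise : NoiseAssumption P N ξ ζ ϑ) (t : ℕ) :
    IndepFun (fun ω (i : Fin m) => (ζ i t ω, ϑ i t ω)) (fun ω (i : Fin m) =>
      A.network (fun j k => ξ j k ω) (fun j k => ζ j k ω) (fun j k => ϑ j k ω) t i) P := by
  classical
  set Z : ℕ → Ω → Fin m → Vec n × Vec n := fun t ω i => (ζ i t ω, ϑ i t ω) with hZ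
  have hZm : ∀ t, Measurable (Z t) := fun t => measurable_pi_lambda _ fun i =>
    (hnoise.measζ i t).prodMk (hnoise.measϑ i t)
  set V : Ω → (Finset.range t → Fin m → Vec n × Vec n) := fun ω k => Z k ω with hV
  have hVm : Measurable V := measurable_pi_lambda _ fun k => hZm k
  set W : Ω → Fin m → ℕ → Ξ := fun ω i t => ξ i t ω with hW
  have hWm : Measurable W := measurable_pi_lambda _ fun i => measurable_pi_lambda _ fun k =>
    hdata.meas i k
  have h1 : IndepFun (Z t) V P := by
    have h := hnoise.indep_time.indepFun_finset {t} (Finset.range t) (by simp) hZm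
    exact h.comp (measurable_pi_apply (⟨t, Finset.mem_singleton_self t⟩ : ({t} : Finset ℕ)))
      measurable_id
  have h2 : IndepFun (fun ω => (Z t ω, V ω)) W P := by
    set g : (Fin m → ℕ → Vec n × Vec n) → (Fin m → Vec n × Vec n) ×
        (Finset.range t → Fin m → Vec n × Vec n) := fun y => (fun i => y i t, fun k i => y i k)
    have hgm : Measurable g := by
      refine Measurable.prodMk ?_ ?_
      · exact measurable_pi_lambda _ fun i => (measurable_pi_apply t).comp (measurable_pi_apply i)
      · exact measurable_pi_lambda _ fun k => measurable_pi_lambda _ fun i =>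
          (measurable_pi_apply (k : ℕ)).comp (measurable_pi_apply i)
    exact hnoise.indep_data.comp hgm measurable_id
  have h3 := indepFun_prodMk_right (hZm t) hVm hWm h1 h2
  -- The state at time t is a measurable function Φ of the data and of the noises before t;
  -- extending these by zero is harmless by `network_congr`. The noise at time t is independent of
  -- this pair.
  set ext : (Finset.range t → Fin m → Vec n × Vec n) → ℕ → Fin m → Vec n × Vec n :=
    fun y k i => if h : k ∈ Finset.range t then y ⟨k, h⟩ i else 0 with hext
  have hextm : ∀ k i, Measurable fun y => ext y k i := by
    intro k i
    by_cases h : k ∈ Finset.range t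
    · simp only [hext, h, dite_true]
      exact (measurable_pi_apply i).comp (measurable_pi_apply _)
    · simp only [hext, h, dite_false]
      exact measurable_const
  set Φ : (Finset.range t → Fin m → Vec n × Vec n) × (Fin m → ℕ → Ξ) →
      Fin m → Vec n × Vec n := fun y i =>
    A.network y.2 (fun j k => (ext y.1 k j).1) (fun j k => (ext y.1 k j).2) t i with hΦ
  have hΦm : Measurable Φ := measurable_pi_lambda _ fun i => measurable_network hg
    (fun i k => (measurable_pi_apply k).comp ((measurable_pi_apply i).comp measurable_snd))
    (fun i k => ((hextm k i).comp measurable_fst).fst)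
    (fun i k => ((hextm k i).comp measurable_fst).snd) t i
  have h4 := h3.comp measurable_id hΦm
  have e : (fun ω (i : Fin m) => A.network (fun j k => ξ j k ω) (fun j k => ζ j k ω)
      (fun j k => ϑ j k ω) t i) = Φ ∘ fun ω => (V ω, W ω) := by
    funext ω
    refine network_congr _ (fun k hk i => ?_) fun k hk i => ?_
    · simp [hext, hk, hV, hZ]
    · simp [hext, hk, hV, hZ]
  rw [e]
  exact h4

end Algo

end OnlineLDP

/-! ### Linear recursions driven by stochastic matrices -/

namespace OnlineLDP

/-- First-order geometric filter of a sequence. -/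
noncomputable def geoFilter (γ : ℝ) (N : ℕ → ℝ) : ℕ → ℝ
  -- The extra 1 makes the filter dominate γ ^ t and so absorb the influence of the initial state.
  | 0 => 1 + N 0
  | t + 1 => γ * geoFilter γ N t + N (t + 1)

theorem geoFilter_eq (γ : ℝ) (N : ℕ → ℝ) (t : ℕ) :
    geoFilter γ N t = γ ^ t + ∑ k ∈ Finset.range (t + 1), γ ^ (t - k) * N k := by
  induction t with
  | zero => simp [geoFilter]
  | succ t ih =>
    rw [geoFilter, ih, Finset.sum_range_succ _ (t + 1), Nat.sub_self, pow_zero, one_mul, mul_add,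
      Finset.mul_sum, add_assoc, pow_succ']
    congr 2
    refine Finset.sum_congr rfl fun k hk => ?_
    rw [Finset.mem_range] at hk
    rw [Nat.sub_add_comm (by omega : k ≤ t), pow_succ', mul_assoc]

section Linear

variable {ι E : Type*} [Fintype ι] [DecidableEq ι] [NormedAddCommGroup E] [NormedSpace ℝ E]

omit [DecidableEq ι] in
theorem norm_sum_smul_le {s : Finset ι} {a : ι → ℝ} {B : ℝ} (hB : ∀ j, |a j| ≤ B) (f : ι → E) :
    ‖∑ j ∈ s, a j • f j‖ ≤ B * ∑ j, ‖f j‖ := by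
  calc ‖∑ j ∈ s, a j • f j‖ ≤ ∑ j ∈ s, ‖a j • f j‖ := norm_sum_le _ _
    _ ≤ ∑ j, ‖a j • f j‖ :=
        Finset.sum_le_sum_of_subset_of_nonneg (Finset.subset_univ s) fun _ _ _ => norm_nonneg _
    _ ≤ ∑ j, B * ‖f j‖ := Finset.sum_le_sum fun j _ => by
        rw [norm_smul]; exact mul_le_mul_of_nonneg_right (hB j) (norm_nonneg _)
    _ = _ := by rw [Finset.mul_sum]

/-- Discrete variation of constants. The natural subtraction t - 1 - k is exact since k < t. -/
theorem linear_recursion_eq {P : Matrix ι ι ℝ} {x d : ℕ → ι → E}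
    (hx : ∀ t i, x (t + 1) i = ∑ j, P i j • x t j + d t i) (t : ℕ) (i : ι) :
    x t i = ∑ j, (P ^ t) i j • x 0 j
      + ∑ k ∈ Finset.range t, ∑ j, (P ^ (t - 1 - k)) i j • d k j := by
  induction t generalizing i with
  | zero => simp [Matrix.one_apply]
  | succ t ih =>
    have hmul : ∀ (s : ℕ) (f : ι → E),
        ∑ j, P i j • ∑ l, (P ^ s) j l • f l = ∑ l, (P ^ (s + 1)) i l • f l := by
      intro s f
      simp_rw [Finset.smul_sum, smul_smul]
      rw [Finset.sum_comm]
      simp_rw [← Finset.sum_smul, pow_succ', Matrix.mul_apply]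
    rw [hx, Finset.sum_range_succ]
    simp_rw [ih, smul_add, Finset.sum_add_distrib, hmul, Finset.smul_sum]
    rw [Finset.sum_comm]
    have e1 : ∑ j, (P ^ (t + 1 - 1 - t)) i j • d t j = d t i := by
      simp [Matrix.one_apply]
    rw [e1, add_assoc]
    congr 2
    refine Finset.sum_congr rfl fun k hk => ?_
    rw [Finset.mem_range] at hk
    have e2 : t + 1 - 1 - k = t - 1 - k + 1 := by omega
    rw [e2, ← hmul]
    simp_rw [Finset.smul_sum]

variable {P : Matrix ι ι ℝ} {x d : ℕ → ι → E} {c γ : ℝ} {N : ℕ → ℝ}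

/-- The left side has the shape of the variation of constants formula; shifting t - 1 - k to t - k
costs the factor 1 / γ. -/
theorem geo_sum_le_geoFilter (hγ : 0 < γ) (hc : 0 ≤ c) {X₀ : ℝ} (hX : 0 ≤ X₀)
    (hN : ∀ t, 0 ≤ N t) (t : ℕ) :
    c * γ ^ t * X₀ + ∑ k ∈ Finset.range t, c * γ ^ (t - 1 - k) * N k + N t
      ≤ (c * X₀ + c / γ + 1) * geoFilter γ N t := by
  have h0 : 0 ≤ ∑ k ∈ Finset.range t, γ ^ (t - k) * N k :=
    Finset.sum_nonneg fun k _ => mul_nonneg (by positivity) (hN k)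
  have e : ∑ k ∈ Finset.range t, c * γ ^ (t - 1 - k) * N k
      = c / γ * ∑ k ∈ Finset.range t, γ ^ (t - k) * N k := by
    rw [Finset.mul_sum]
    refine Finset.sum_congr rfl fun k hk => ?_
    rw [Finset.mem_range] at hk
    rw [show t - k = t - 1 - k + 1 by omega, pow_succ]
    field_simp
  rw [e, geoFilter_eq, Finset.sum_range_succ, Nat.sub_self, pow_zero, one_mul]
  have h1 : 0 ≤ c / γ := by positivity
  have h2 : 0 ≤ c * X₀ := by positivity
  have h3 : 0 ≤ γ ^ t := by positivity
  have h4 := hN t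
  nlinarith [mul_nonneg h1 h3, mul_nonneg h2 h0, mul_nonneg h1 h4, mul_nonneg h2 h4]

/-- Increments of a recursion driven by a matrix whose powers converge. -/
theorem norm_increment_le (hx : ∀ t i, x (t + 1) i = ∑ j, P i j • x t j + d t i)
    (hγ : 0 < γ) (hγ1 : γ < 1) (hc : 0 ≤ c) {p : ι → ℝ}
    (hP : ∀ t i j, |(P ^ t) i j - p i| ≤ c * γ ^ t)
    (hN : ∀ t, ∑ j, ‖d t j‖ ≤ N t) (t : ℕ) (i : ι) :
    ‖x (t + 1) i - x t i‖
      ≤ (2 * c * ∑ j, ‖x 0 j‖ + 2 * c / γ + 1) * geoFilter γ N t := by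
  have hN0 : ∀ t, 0 ≤ N t := fun t => (Finset.sum_nonneg fun _ _ => norm_nonneg _).trans (hN t)
  -- Consecutive powers differ by a geometrically small amount, so past perturbations are forgotten
  -- in the increments, though not necessarily in x itself.
  have hd : ∀ s i j, |(P ^ (s + 1)) i j - (P ^ s) i j| ≤ 2 * c * γ ^ s := by
    intro s i j
    have h1 := hP (s + 1) i j
    have h2 := hP s i j
    have h3 : c * γ ^ (s + 1) ≤ c * γ ^ s :=
      mul_le_mul_of_nonneg_left (pow_le_pow_of_le_one hγ.le hγ1.le (Nat.le_succ s)) hc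
    calc _ = |((P ^ (s + 1)) i j - p i) - ((P ^ s) i j - p i)| := by ring_nf
      _ ≤ _ := abs_sub _ _
      _ ≤ _ := by linarith
  have e : x (t + 1) i - x t i = ∑ j, ((P ^ (t + 1)) i j - (P ^ t) i j) • x 0 j
      + ∑ k ∈ Finset.range t, ∑ j, ((P ^ (t - 1 - k + 1)) i j - (P ^ (t - 1 - k)) i j) • d k j
      + d t i := by
    rw [linear_recursion_eq hx (t + 1), linear_recursion_eq hx t, Finset.sum_range_succ]
    simp_rw [sub_smul, Finset.sum_sub_distrib]
    have e1 : ∑ j, (P ^ (t + 1 - 1 - t)) i j • d t j = d t i := by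
      simp [Matrix.one_apply]
    have e2 : ∑ k ∈ Finset.range t, ∑ j, (P ^ (t + 1 - 1 - k)) i j • d k j
        = ∑ k ∈ Finset.range t, ∑ j, (P ^ (t - 1 - k + 1)) i j • d k j := by
      refine Finset.sum_congr rfl fun k hk => ?_
      rw [Finset.mem_range] at hk
      rw [show t + 1 - 1 - k = t - 1 - k + 1 by omega]
    rw [e1, e2]
    abel
  rw [e]
  refine le_trans ?_ (geo_sum_le_geoFilter hγ (by positivity : 0 ≤ 2 * c)
    (Finset.sum_nonneg fun _ _ => norm_nonneg _) hN0 t)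
  refine (norm_add₃_le).trans (add_le_add (add_le_add ?_ ?_) ?_)
  · exact norm_sum_smul_le (fun j => hd t i j) _
  · refine (norm_sum_le _ _).trans (Finset.sum_le_sum fun k _ => ?_)
    exact (norm_sum_smul_le (fun j => hd _ i j) _).trans
      (mul_le_mul_of_nonneg_left (hN k) (by positivity))
  · exact (Finset.single_le_sum (f := fun j => ‖d t j‖) (fun _ _ => norm_nonneg _)
      (Finset.mem_univ i)).trans (hN t)

omit [DecidableEq ι] in
-- The weights are left invariant, so the average moves only through the driving term.
theorem average_succ (hx : ∀ t i, x (t + 1) i = ∑ j, P i j • x t j + d t i) {p : ι → ℝ}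
    (hp : Matrix.vecMul p P = p) (t : ℕ) :
    ∑ i, p i • x (t + 1) i = ∑ i, p i • x t i + ∑ i, p i • d t i := by
  simp_rw [hx, smul_add, Finset.sum_add_distrib, Finset.smul_sum, smul_smul]
  congr 1
  rw [Finset.sum_comm]
  simp_rw [← Finset.sum_smul]
  exact Finset.sum_congr rfl fun j _ => by rw [← congrFun hp j]; rfl

/-- Deviations from the weighted average of a recursion driven by an ergodic matrix. -/
theorem norm_consensus_le (hx : ∀ t i, x (t + 1) i = ∑ j, P i j • x t j + d t i)
    (hγ : 0 < γ) (hc : 0 ≤ c) {p : ι → ℝ} (hp : Matrix.vecMul p P = p)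
    (hP : ∀ t i j, |(P ^ t) i j - p j| ≤ c * γ ^ t)
    (hN : ∀ t, ∑ j, ‖d t j‖ ≤ N t) (t : ℕ) (i : ι) :
    ‖x t i - ∑ l, p l • x t l‖ ≤ (c * ∑ j, ‖x 0 j‖ + c / γ + 1) * geoFilter γ N t := by
  have hN0 : ∀ t, 0 ≤ N t := fun t => (Finset.sum_nonneg fun _ _ => norm_nonneg _).trans (hN t)
  have havg : ∑ l, p l • x t l
      = ∑ j, p j • x 0 j + ∑ k ∈ Finset.range t, ∑ j, p j • d k j := by
    clear hN
    induction t with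
    | zero => simp
    | succ t ih => rw [average_succ hx hp, ih, Finset.sum_range_succ, add_assoc]
  have e : x t i - ∑ l, p l • x t l = ∑ j, ((P ^ t) i j - p j) • x 0 j
      + ∑ k ∈ Finset.range t, ∑ j, ((P ^ (t - 1 - k)) i j - p j) • d k j := by
    rw [havg, linear_recursion_eq hx t]
    simp_rw [sub_smul, Finset.sum_sub_distrib]
    abel
  rw [e]
  refine le_trans ?_ (geo_sum_le_geoFilter hγ hc
    (Finset.sum_nonneg fun _ _ => norm_nonneg _) hN0 t)
  refine ((norm_add_le _ _).trans (add_le_add ?_ ?_)).trans (le_add_of_nonneg_right (hN0 t))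
  · exact norm_sum_smul_le (fun j => hP t i j) _
  · refine (norm_sum_le _ _).trans (Finset.sum_le_sum fun k _ => ?_)
    exact (norm_sum_smul_le (fun j => hP _ i j) _).trans
      (mul_le_mul_of_nonneg_left (hN k) (by positivity))

end Linear

/-! ### The network as a pair of linear recursions -/

namespace Algo

variable {m n : ℕ} {Ξ : Type*} (A : Algo m n Ξ)

/-- The weighted average of the model parameters. -/
noncomputable def avgθ (p : Fin m → ℝ) (D : Fin m → ℕ → Ξ) (ζ ϑ : Fin m → ℕ → Vec n) (t : ℕ) :
    Vec n := ∑ i, p i • (A.network D ζ ϑ t i).2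

/-- The contribution of the noises to the evolution of the weighted average. -/
noncomputable def avgNoise (p : Fin m → ℝ) (z h : Fin m → Vec n) : Vec n :=
  ∑ i, ∑ j ∈ inNbrs A.R i, (p i * A.R i j) • h j
    + ∑ i, ∑ j ∈ inNbrs A.C i, (-(1 / (m : ℝ)) * A.C i j) • z j

/-- The averaged empirical gradient used by the network. -/
noncomputable def avgGrad (D : Fin m → ℕ → Ξ) (ζ ϑ : Fin m → ℕ → Vec n) (t : ℕ) : Vec n :=
  (1 / (m : ℝ)) • ∑ i, A.empGrad (D i) t (A.network D ζ ϑ t i).2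

/-- The total increment of the tracking variables. -/
noncomputable def incr (D : Fin m → ℕ → Ξ) (ζ ϑ : Fin m → ℕ → Vec n) (t : ℕ) : ℝ :=
  ∑ i, ‖(A.network D ζ ϑ (t + 1) i).1 - (A.network D ζ ϑ t i).1‖

variable {A}

theorem network_fst_succ (hc : CouplingAssumption A.R A.C) (D : Fin m → ℕ → Ξ)
    (ζ ϑ : Fin m → ℕ → Vec n) (t : ℕ) (i : Fin m) :
    (A.network D ζ ϑ (t + 1) i).1 = ∑ j, (1 + A.C) i j • (A.network D ζ ϑ t j).1
      + (∑ j ∈ inNbrs A.C i, A.C i j • ζ j t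
        + A.lam t • A.empGrad (D i) t (A.network D ζ ϑ t i).2) := by
  have h := sum_inNbrs hc.C_offdiag hc.C_diag_neg i fun j => (A.network D ζ ϑ t j).1
  have e : (A.network D ζ ϑ (t + 1) i).1 = (1 + A.C i i) • (A.network D ζ ϑ t i).1
      + ∑ j ∈ inNbrs A.C i, A.C i j • ((A.network D ζ ϑ t j).1 + ζ j t)
      + A.lam t • A.empGrad (D i) t (A.network D ζ ϑ t i).2 := rfl
  rw [e]
  simp_rw [smul_add, Finset.sum_add_distrib, h, Matrix.add_apply, add_smul, Finset.sum_add_distrib]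
  simp only [Matrix.one_apply, ite_smul, one_smul, zero_smul, Finset.sum_ite_eq, Finset.mem_univ,
    if_true]
  abel

theorem network_snd_succ (hc : CouplingAssumption A.R A.C) (D : Fin m → ℕ → Ξ)
    (ζ ϑ : Fin m → ℕ → Vec n) (t : ℕ) (i : Fin m) :
    (A.network D ζ ϑ (t + 1) i).2 = ∑ j, (1 + A.R) i j • (A.network D ζ ϑ t j).2
      + (∑ j ∈ inNbrs A.R i, A.R i j • ϑ j t - (1 / ((m : ℝ) * zEst A.R t i i)) •
        ((A.network D ζ ϑ (t + 1) i).1 - (A.network D ζ ϑ t i).1)) := by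
  have h := sum_inNbrs hc.R_offdiag hc.R_diag_neg i fun j => (A.network D ζ ϑ t j).2
  have e : (A.network D ζ ϑ (t + 1) i).2 = (1 + A.R i i) • (A.network D ζ ϑ t i).2
      + ∑ j ∈ inNbrs A.R i, A.R i j • ((A.network D ζ ϑ t j).2 + ϑ j t)
      - (1 / ((m : ℝ) * zEst A.R t i i)) •
        ((A.network D ζ ϑ (t + 1) i).1 - (A.network D ζ ϑ t i).1) := rfl
  rw [e]
  simp_rw [smul_add, Finset.sum_add_distrib, h, Matrix.add_apply, add_smul, Finset.sum_add_distrib]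
  simp only [Matrix.one_apply, ite_smul, one_smul, zero_smul, Finset.sum_ite_eq, Finset.mem_univ,
    if_true]
  abel

theorem norm_empGrad_le {cl : ℝ} (hloss : ∀ θ x, l1norm (A.gradLoss θ x) ≤ cl) (D : ℕ → Ξ)
    (t : ℕ) (θ : Vec n) : ‖A.empGrad D t θ‖ ≤ cl :=
  (norm_le_l1norm _).trans (l1norm_empGrad_le hloss D t θ)

theorem exists_entry_bound (W : Matrix (Fin m) (Fin m) ℝ) :
    ∃ B : ℝ, 0 ≤ B ∧ ∀ i j, |W i j| ≤ B :=
  ⟨∑ i, ∑ j, |W i j|, Finset.sum_nonneg fun _ _ => Finset.sum_nonneg fun _ _ => abs_nonneg _,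
    fun i j => (Finset.single_le_sum (f := fun j => |W i j|) (fun _ _ => abs_nonneg _)
      (Finset.mem_univ j)).trans (Finset.single_le_sum (f := fun i => ∑ j, |W i j|)
      (fun _ _ => Finset.sum_nonneg fun _ _ => abs_nonneg _) (Finset.mem_univ i))⟩

/-- The increments of the tracking variables are controlled by the noises and the stepsizes. -/
theorem exists_incr_le {cl : ℝ} (hc : CouplingAssumption A.R A.C) (hl : 0 < A.lam0)
    (hcl : 0 ≤ cl) (hloss : ∀ θ x, l1norm (A.gradLoss θ x) ≤ cl) :
    ∃ B K γ : ℝ, 0 ≤ B ∧ 0 ≤ K ∧ 0 < γ ∧ γ < 1 ∧ ∀ (D : Fin m → ℕ → Ξ) (ζ ϑ : Fin m → ℕ → Vec n)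
      (t : ℕ), A.incr D ζ ϑ t
        ≤ K * geoFilter γ (fun t => B * (∑ j, ‖ζ j t‖ + A.lam t)) t := by
  obtain ⟨p, c, γ, hc0, hγ, hγ1, hP⟩ := hc.exists_limit_C
  obtain ⟨B, hB0, hB⟩ := exists_entry_bound A.C
  refine ⟨m * (B + cl), m * (2 * c * ∑ j, ‖A.s0 j‖ + 2 * c / γ + 1), γ, by positivity,
    by positivity, hγ, hγ1, fun D ζ ϑ t => ?_⟩
  have hN : ∀ t, ∑ j, ‖∑ k ∈ inNbrs A.C j, A.C j k • ζ k t
      + A.lam t • A.empGrad (D j) t (A.network D ζ ϑ t j).2‖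
        ≤ m * (B + cl) * (∑ j, ‖ζ j t‖ + A.lam t) := by
    intro t
    have hlam := (lam_pos hl t).le
    have h1 : ∀ j ∈ Finset.univ, ‖∑ k ∈ inNbrs A.C j, A.C j k • ζ k t
        + A.lam t • A.empGrad (D j) t (A.network D ζ ϑ t j).2‖
          ≤ (B + cl) * (∑ j, ‖ζ j t‖ + A.lam t) := by
      intro j _
      have hz : 0 ≤ ∑ j, ‖ζ j t‖ := Finset.sum_nonneg fun _ _ => norm_nonneg _
      have h2 : ‖∑ k ∈ inNbrs A.C j, A.C j k • ζ k t‖ ≤ B * ∑ j, ‖ζ j t‖ :=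
        norm_sum_smul_le (fun k => hB j k) _
      have h3 : ‖A.lam t • A.empGrad (D j) t (A.network D ζ ϑ t j).2‖ ≤ A.lam t * cl := by
        rw [norm_smul, Real.norm_of_nonneg hlam]
        exact mul_le_mul_of_nonneg_left (norm_empGrad_le hloss _ _ _) hlam
      refine (norm_add_le _ _).trans ?_
      nlinarith [mul_nonneg hcl hz, mul_nonneg hB0 hlam]
    refine (Finset.sum_le_sum h1).trans (le_of_eq ?_)
    simp [mul_assoc]
  have h := fun i => norm_increment_le (x := fun t i => (A.network D ζ ϑ t i).1)
    (network_fst_succ hc D ζ ϑ) hγ hγ1 hc0.le hP hN t i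
  refine (Finset.sum_le_sum fun i _ => h i).trans (le_of_eq ?_)
  simp [network, mul_assoc]

/-- The disagreement of the model parameters is controlled by the noises and the increments of the
tracking variables. -/
theorem exists_consensus_le (hc : CouplingAssumption A.R A.C) {p : Fin m → ℝ} {c γ : ℝ}
    (hp : Matrix.vecMul p (1 + A.R) = p) (hc0 : 0 ≤ c) (hγ : 0 < γ)
    (hP : ∀ t i j, |((1 + A.R) ^ t) i j - p j| ≤ c * γ ^ t) {M : ℝ}
    (hM : ∀ t i, |1 / ((m : ℝ) * zEst A.R t i i)| ≤ M) :
    ∃ B K : ℝ, 0 ≤ B ∧ 0 ≤ K ∧ ∀ (D : Fin m → ℕ → Ξ) (ζ ϑ : Fin m → ℕ → Vec n)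
      (t : ℕ), ∑ i, ‖(A.network D ζ ϑ t i).2 - A.avgθ p D ζ ϑ t‖
        ≤ K * geoFilter γ (fun t => B * (∑ j, ‖ϑ j t‖ + A.incr D ζ ϑ t)) t := by
  obtain ⟨B, hB0, hB⟩ := exists_entry_bound A.R
  have hM0 : 0 ≤ M := (abs_nonneg _).trans (hM 0 ⟨0, hc.m_pos⟩)
  refine ⟨m * (B + M), m * (c * ∑ j, ‖A.θ0 j‖ + c / γ + 1), by positivity,
    by positivity, fun D ζ ϑ t => ?_⟩
  have hN : ∀ t, ∑ j, ‖∑ k ∈ inNbrs A.R j, A.R j k • ϑ k t - (1 / ((m : ℝ) * zEst A.R t j j)) •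
      ((A.network D ζ ϑ (t + 1) j).1 - (A.network D ζ ϑ t j).1)‖
        ≤ m * (B + M) * (∑ j, ‖ϑ j t‖ + A.incr D ζ ϑ t) := by
    intro t
    have hi0 : 0 ≤ A.incr D ζ ϑ t := Finset.sum_nonneg fun _ _ => norm_nonneg _
    have h1 : ∀ j ∈ Finset.univ, ‖∑ k ∈ inNbrs A.R j, A.R j k • ϑ k t
        - (1 / ((m : ℝ) * zEst A.R t j j)) •
          ((A.network D ζ ϑ (t + 1) j).1 - (A.network D ζ ϑ t j).1)‖
          ≤ (B + M) * (∑ j, ‖ϑ j t‖ + A.incr D ζ ϑ t) := by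
      intro j _
      have hz : 0 ≤ ∑ j, ‖ϑ j t‖ := Finset.sum_nonneg fun _ _ => norm_nonneg _
      have h2 : ‖∑ k ∈ inNbrs A.R j, A.R j k • ϑ k t‖ ≤ B * ∑ j, ‖ϑ j t‖ :=
        norm_sum_smul_le (fun k => hB j k) _
      have h4 : ‖(A.network D ζ ϑ (t + 1) j).1 - (A.network D ζ ϑ t j).1‖ ≤ A.incr D ζ ϑ t :=
        Finset.single_le_sum (f := fun j =>
          ‖(A.network D ζ ϑ (t + 1) j).1 - (A.network D ζ ϑ t j).1‖)
          (fun _ _ => norm_nonneg _) (Finset.mem_univ j)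
      have h3 : ‖(1 / ((m : ℝ) * zEst A.R t j j)) •
          ((A.network D ζ ϑ (t + 1) j).1 - (A.network D ζ ϑ t j).1)‖ ≤ M * A.incr D ζ ϑ t := by
        rw [norm_smul, Real.norm_eq_abs]
        exact mul_le_mul (hM t j) h4 (norm_nonneg _) hM0
      refine (norm_sub_le _ _).trans ?_
      nlinarith [mul_nonneg hM0 hz, mul_nonneg hB0 hi0]
    refine (Finset.sum_le_sum h1).trans (le_of_eq ?_)
    simp [mul_assoc]
  have h := fun i => norm_consensus_le (x := fun t i => (A.network D ζ ϑ t i).2)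
    (network_snd_succ hc D ζ ϑ) hγ hc0 hp hP hN t i
  refine (Finset.sum_le_sum fun i _ => h i).trans (le_of_eq ?_)
  simp [network, mul_assoc]

/-- The evolution of the weighted average: a gradient step, noise, and a small remainder. -/
theorem avgθ_succ (hc : CouplingAssumption A.R A.C) {p : Fin m → ℝ} {cz γz : ℝ}
    (hp0 : ∀ i, 0 < p i) (hp1 : ∑ i, p i = 1) (hp : Matrix.vecMul p (1 + A.R) = p)
    (hr : IsEigenRate A.R (fun i => m * p i) cz γz) (D : Fin m → ℕ → Ξ)
    (ζ ϑ : Fin m → ℕ → Vec n) (t : ℕ) :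
    ∃ r : Vec n, A.avgθ p D ζ ϑ (t + 1) = A.avgθ p D ζ ϑ t
        + (A.avgNoise p (fun j => ζ j t) (fun j => ϑ j t) - A.lam t • A.avgGrad D ζ ϑ t - r) ∧
      ‖r‖ ≤ cz * γz ^ t * A.incr D ζ ϑ t := by
  have hm : (0 : ℝ) < m := by exact_mod_cast hc.m_pos
  set y : Fin m → Vec n := fun i => (A.network D ζ ϑ (t + 1) i).1 - (A.network D ζ ϑ t i).1 with hy
  set e : Fin m → ℝ := fun i => p i * (1 / ((m : ℝ) * zEst A.R t i i) - 1 / (m * p i)) with he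
  refine ⟨∑ i, e i • y i, ?_, ?_⟩
  · have h1 := average_succ (x := fun t i => (A.network D ζ ϑ t i).2)
      (network_snd_succ hc D ζ ϑ) hp t
    rw [avgθ, avgθ, h1]
    congr 1
    -- Columns of I + C sum to 1: in the total increment the tracking variables cancel, leaving
    -- noise and current gradients.
    have hsum : ∑ i, y i = ∑ i, (∑ j ∈ inNbrs A.C i, A.C i j • ζ j t
        + A.lam t • A.empGrad (D i) t (A.network D ζ ϑ t i).2) := by
      simp only [hy, network_fst_succ hc, Finset.sum_sub_distrib]
      rw [Finset.sum_add_distrib, Finset.sum_comm]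
      simp_rw [← Finset.sum_smul]
      have hcol : ∀ j, ∑ i, (1 + A.C) i j = 1 := by
        intro j
        have := hc.rowStoch_C.row_sum j
        simpa [Matrix.add_apply, Matrix.one_apply, eq_comm] using this
      simp_rw [hcol, one_smul]
      abel
    -- With the exact eigenvector every learner would get the weight p i / (m * p i) = 1 / m; e i is
    -- the error of its estimate.
    have hsplit : ∀ i, p i • (1 / ((m : ℝ) * zEst A.R t i i)) • y i
        = (1 / (m : ℝ)) • y i + e i • y i := by
      intro i
      rw [smul_smul, ← add_smul, he]
      congr 1
      have := (hp0 i).ne'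
      field_simp
      ring
    change ∑ i, p i • (∑ j ∈ inNbrs A.R i, A.R i j • ϑ j t
      - (1 / ((m : ℝ) * zEst A.R t i i)) • y i) = _
    simp_rw [smul_sub, Finset.sum_sub_distrib, hsplit, Finset.sum_add_distrib]
    rw [← Finset.smul_sum, hsum, avgNoise, avgGrad, Finset.sum_add_distrib]
    simp_rw [neg_mul, neg_smul, Finset.sum_neg_distrib, Finset.smul_sum, smul_add, Finset.smul_sum,
      smul_smul]
    simp_rw [mul_comm (A.lam t)]
    abel
  · have hple : ∀ i, p i ≤ 1 := fun i => by
      rw [← hp1]; exact Finset.single_le_sum (fun j _ => (hp0 j).le) (Finset.mem_univ i)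
    refine norm_sum_smul_le (fun i => ?_) _
    rw [he, abs_mul, abs_of_pos (hp0 i)]
    exact (mul_le_mul (hple i) (hr.2.2.2 i t) (abs_nonneg _) zero_le_one).trans (by rw [one_mul])

end Algo

end OnlineLDP

/-! ### Processes with summable second moments -/

namespace OnlineLDP

section SqSummable

variable {Ω : Type*} [MeasurableSpace Ω] {P : Measure Ω}

/-- Square-integrable processes with summable second moments. -/
structure SqSummable (P : Measure Ω) (X : ℕ → Ω → ℝ) : Prop where
  memLp : ∀ t, MemLp (X t) 2 P
  summable : Summable fun t => ∫ ω, X t ω ^ 2 ∂P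

variable {X Y : ℕ → Ω → ℝ}

theorem SqSummable.mono (hX : SqSummable P X) (hY : ∀ t, AEStronglyMeasurable (Y t) P)
    (h : ∀ t ω, |Y t ω| ≤ X t ω) : SqSummable P Y := by
  have hm : ∀ t, MemLp (Y t) 2 P := fun t => (hX.memLp t).mono (hY t)
    (ae_of_all _ fun ω => by simpa using (h t ω).trans (le_abs_self _))
  refine ⟨hm, Summable.of_nonneg_of_le (fun t => integral_nonneg fun ω => sq_nonneg _)
    (fun t => ?_) hX.summable⟩
  exact integral_mono (hm t).integrable_sq (hX.memLp t).integrable_sq fun ω =>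
    sq_le_sq.2 ((h t ω).trans (le_abs_self _))

theorem SqSummable.const_mul (hX : SqSummable P X) (c : ℝ) :
    SqSummable P fun t ω => c * X t ω := by
  refine ⟨fun t => (hX.memLp t).const_mul c, ?_⟩
  simp_rw [mul_pow, integral_const_mul]
  exact hX.summable.mul_left _

theorem SqSummable.add (hX : SqSummable P X) (hY : SqSummable P Y) :
    SqSummable P fun t ω => X t ω + Y t ω := by
  have hm : ∀ t, MemLp (fun ω => X t ω + Y t ω) 2 P := fun t => (hX.memLp t).add (hY.memLp t)
  refine ⟨hm, Summable.of_nonneg_of_le (fun t => integral_nonneg fun ω => sq_nonneg _)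
    (fun t => ?_) ((hX.summable.mul_left 2).add (hY.summable.mul_left 2))⟩
  have h1 := (hX.memLp t).integrable_sq
  have h2 := (hY.memLp t).integrable_sq
  rw [← integral_const_mul, ← integral_const_mul,
    ← integral_add (h1.const_mul 2) (h2.const_mul 2)]
  refine integral_mono (hm t).integrable_sq ((h1.const_mul 2).add (h2.const_mul 2)) fun ω => ?_
  nlinarith [sq_nonneg (X t ω - Y t ω)]

theorem SqSummable.sum {ι : Type*} (s : Finset ι) {Z : ι → ℕ → Ω → ℝ}
    (h : ∀ j ∈ s, SqSummable P (Z j)) : SqSummable P fun t ω => ∑ j ∈ s, Z j t ω := by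
  classical
  induction s using Finset.induction_on with
  | empty => exact ⟨fun t => by simp, by simp⟩
  | insert a s ha ih =>
    simp_rw [Finset.sum_insert ha]
    exact (h a (Finset.mem_insert_self a s)).add
      (ih fun j hj => h j (Finset.mem_insert_of_mem hj))

theorem SqSummable.const [IsProbabilityMeasure P] {c : ℕ → ℝ} (hc : Summable fun t => c t ^ 2) :
    SqSummable P fun t _ => c t :=
  ⟨fun t => memLp_const _, by simpa using hc⟩

theorem SqSummable.geo [IsProbabilityMeasure P] {γ : ℝ} (hγ : 0 ≤ γ) (hγ1 : γ < 1)
    (hX : SqSummable P X) : SqSummable P fun t ω => geoFilter γ (fun k => X k ω) t := by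
  have hm : ∀ t, MemLp (fun ω => geoFilter γ (fun k => X k ω) t) 2 P := by
    intro t
    induction t with
    | zero =>
      have h : MemLp (fun ω => 1 + X 0 ω) 2 P := (memLp_const (1 : ℝ)).add (hX.memLp 0)
      exact h
    | succ t ih =>
      have h : MemLp (fun ω => γ * geoFilter γ (fun k => X k ω) t + X (t + 1) ω) 2 P :=
        (ih.const_mul γ).add (hX.memLp (t + 1))
      exact h
  have h1γ : 0 < 1 - γ := by linarith
  refine ⟨hm, summable_of_contractive (ρ := γ)
    (h := fun t => (1 - γ)⁻¹ * ∫ ω, X (t + 1) ω ^ 2 ∂P)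
    (fun t => integral_nonneg fun ω => sq_nonneg _)
    (fun t => mul_nonneg (inv_nonneg.2 h1γ.le) (integral_nonneg fun ω => sq_nonneg _)) hγ1
    (((summable_nat_add_iff 1).2 hX.summable).mul_left _) (Eventually.of_forall fun t => ?_)⟩
  have i1 := (hm t).integrable_sq
  have i2 := (hX.memLp (t + 1)).integrable_sq
  rw [← integral_const_mul, ← integral_const_mul,
    ← integral_add (i1.const_mul γ) (i2.const_mul _)]
  refine integral_mono (hm (t + 1)).integrable_sq ((i1.const_mul γ).add (i2.const_mul _))
    fun ω => ?_
  simp only [geoFilter]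
  set a := geoFilter γ (fun k => X k ω) t
  set b := X (t + 1) ω
  -- Convexity of the square with weights γ and 1 - γ, written as an explicit square; second moments
  -- thus contract by γ up to those of the input.
  have e : γ * a ^ 2 + (1 - γ)⁻¹ * b ^ 2 - (γ * a + b) ^ 2
      = γ * (1 - γ)⁻¹ * ((1 - γ) * a - b) ^ 2 := by
    field_simp
    ring
  have : 0 ≤ γ * (1 - γ)⁻¹ * ((1 - γ) * a - b) ^ 2 := by positivity
  linarith

theorem SqSummable.tendsto (hX : SqSummable P X) :
    Tendsto (fun t => ∫ ω, X t ω ^ 2 ∂P) atTop (𝓝 0) := hX.summable.tendsto_atTop_zero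

/-- Nonnegativity of the variance gives (E X) ^ 2 ≤ E X ^ 2. -/
theorem SqSummable.tendsto_integral [IsProbabilityMeasure P] (hX : SqSummable P X)
    (h0 : ∀ t ω, 0 ≤ X t ω) : Tendsto (fun t => ∫ ω, X t ω ∂P) atTop (𝓝 0) := by
  refine squeeze_zero (fun t => integral_nonneg (h0 t)) (fun t => ?_)
    (by simpa using hX.tendsto.sqrt)
  refine Real.le_sqrt_of_sq_le ?_
  have h1 := (hX.memLp t).integrable_sq
  have h2 : Integrable (X t) P := (hX.memLp t).integrable one_le_two
  set c := ∫ ω, X t ω ∂P with hc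
  have h3 : 0 ≤ ∫ ω, (X t ω ^ 2 - 2 * c * X t ω + c ^ 2) ∂P :=
    integral_nonneg fun ω => by
      have := sq_nonneg (X t ω - c)
      simp only [Pi.zero_apply]; nlinarith
  have h4 : Integrable (fun ω => X t ω ^ 2 - 2 * c * X t ω) P := h1.sub (h2.const_mul _)
  rw [integral_add h4 (integrable_const _), integral_sub h1 (h2.const_mul _),
    integral_const_mul, ← hc] at h3
  simp at h3
  nlinarith

end SqSummable

/-! ### Square summability of noises, increments and disagreements. -/

section Noise

variable {m n : ℕ} {Ω Ξ : Type*} [MeasurableSpace Ω] [MeasurableSpace Ξ] {P : Measure Ω}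

theorem summable_inv_rpow {a : ℝ} (ha : 1 < a) :
    Summable fun t : ℕ => (((t : ℝ) + 1) ^ a)⁻¹ := by
  have := (summable_nat_add_iff 1).2 (Real.summable_nat_rpow_inv.2 ha)
  simpa using this

theorem summable_div_rpow_sq {c a : ℝ} (ha : 1 / 2 < a) :
    Summable fun t : ℕ => (c / ((t : ℝ) + 1) ^ a) ^ 2 := by
  refine ((summable_inv_rpow (by linarith : 1 < a * 2)).mul_left (c ^ 2)).congr fun t => ?_
  rw [div_pow, Real.rpow_mul (by positivity), div_eq_mul_inv]
  norm_num

/-- Each coordinate has variance σ0 ^ 2 / (t + 1) ^ (2 * ς), and 2 * ς > 1. -/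
theorem sqSummable_laplace {Z : ℕ → Ω → Vec n} (hZ : ∀ t, Measurable (Z t)) {σ0 ς : ℝ}
    (hσ : 0 < σ0) (hς : 1 / 2 < ς)
    (hlaw : ∀ t k, P.map (fun ω => Z t ω k) = laplace (noiseScale σ0 ς t)) :
    SqSummable P fun t ω => ‖Z t ω‖ := by
  have hk : ∀ k, SqSummable P fun t ω => |Z t ω k| := by
    intro k
    have hmom := fun t => laplace_moments (measurable_vec_iff.1 (hZ t) k) (noiseScale_pos hσ t)
      (hlaw t k)
    refine ⟨fun t => (hmom t).1.norm, ?_⟩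
    simp_rw [sq_abs, fun t => (hmom t).2.2, noiseScale, noiseStd, div_pow _ (√2), mul_div_left_comm]
    exact (summable_div_rpow_sq hς).mul_right _
  refine (SqSummable.sum Finset.univ fun k _ => hk k).mono
    (fun t => (hZ t).norm.aestronglyMeasurable) fun t ω => ?_
  rw [abs_norm]
  exact norm_le_l1norm _

theorem memLp_two_coord {Z : Ω → Vec n} (hZ : Measurable Z) (h : MemLp (fun ω => ‖Z ω‖) 2 P)
    (k : Fin n) : MemLp (fun ω => Z ω k) 2 P :=
  h.mono (measurable_vec_iff.1 hZ k).aestronglyMeasurable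
    (ae_of_all _ fun ω => by simpa using abs_apply_le_norm (Z ω) k)

/-- Independent square-integrable vectors, one of them centered, are orthogonal. -/
theorem integral_inner_eq_zero {U Z : Ω → Vec n} (hU : Measurable U) (hZ : Measurable Z)
    (hU2 : MemLp (fun ω => ‖U ω‖) 2 P) (hZ2 : MemLp (fun ω => ‖Z ω‖) 2 P)
    (hind : IndepFun Z U P) (h0 : ∀ k, ∫ ω, Z ω k ∂P = 0) :
    Integrable (fun ω => inner ℝ (U ω) (Z ω)) P ∧ ∫ ω, inner ℝ (U ω) (Z ω) ∂P = 0 := by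
  have hint : ∀ k, Integrable (fun ω => Z ω k * U ω k) P := fun k =>
    (memLp_two_coord hZ hZ2 k).integrable_mul (memLp_two_coord hU hU2 k)
  have e : ∀ ω, inner ℝ (U ω) (Z ω) = ∑ k, Z ω k * U ω k := fun ω => by
    simp [PiLp.inner_apply]
  simp_rw [e]
  refine ⟨integrable_finsetSum _ fun k _ => hint k, ?_⟩
  rw [integral_finsetSum _ fun k _ => hint k]
  refine Finset.sum_eq_zero fun k _ => ?_
  have hk : Measurable fun x : Vec n => x k := measurable_vec_iff.1 measurable_id k
  have := (hind.comp hk hk).integral_fun_mul_eq_mul_integral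
    (measurable_vec_iff.1 hZ k).aestronglyMeasurable
    (measurable_vec_iff.1 hU k).aestronglyMeasurable
  simp only [Function.comp_apply] at this
  rw [this, h0, zero_mul]

/-- The value of a family of processes at an outcome. -/
abbrev sample {α : Type*} (f : Fin m → ℕ → Ω → α) (ω : Ω) : Fin m → ℕ → α := fun j k => f j k ω

variable {A : Algo m n Ξ} {N : NoiseParams m} {Q : Fin m → Measure Ξ}
  {ξ : Fin m → ℕ → Ω → Ξ} {ζ ϑ : Fin m → ℕ → Ω → Vec n}

theorem measurable_network_sample (hg : Measurable fun x : Vec n × Ξ => A.gradLoss x.1 x.2)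
    (hdata : DataAssumption P Q ξ) (hnoise : NoiseAssumption P N ξ ζ ϑ) (t : ℕ) (i : Fin m) :
    Measurable fun ω => A.network (sample ξ ω) (sample ζ ω) (sample ϑ ω) t i :=
  Algo.measurable_network hg hdata.meas hnoise.measζ hnoise.measϑ t i

theorem measurable_avgθ (hg : Measurable fun x : Vec n × Ξ => A.gradLoss x.1 x.2)
    (hdata : DataAssumption P Q ξ) (hnoise : NoiseAssumption P N ξ ζ ϑ) (p : Fin m → ℝ) (t : ℕ) :
    Measurable fun ω => A.avgθ p (sample ξ ω) (sample ζ ω) (sample ϑ ω) t :=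
  Finset.measurable_fun_sum _ fun i _ =>
    (measurable_network_sample hg hdata hnoise t i).snd.const_smul (p i)

variable [IsProbabilityMeasure P] {lam0 v : ℝ}

omit [IsProbabilityMeasure P] in
theorem sqSummable_ζ (hrate : RateAssumption lam0 v N) (hnoise : NoiseAssumption P N ξ ζ ϑ)
    (j : Fin m) : SqSummable P fun t ω => ‖ζ j t ω‖ :=
  sqSummable_laplace (hnoise.measζ j) (hrate.σζ_pos j) (hrate.ςζ_mem j).1 (hnoise.lawζ j)

omit [IsProbabilityMeasure P] in
theorem sqSummable_ϑ (hrate : RateAssumption lam0 v N) (hnoise : NoiseAssumption P N ξ ζ ϑ)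
    (j : Fin m) : SqSummable P fun t ω => ‖ϑ j t ω‖ :=
  sqSummable_laplace (hnoise.measϑ j) (hrate.σϑ_pos j) (hrate.ςϑ_mem j).1 (hnoise.lawϑ j)

/-- The pathwise bound `exists_incr_le` is a geometric filter of noises and stepsizes, both square
summable, and filtering preserves this. -/
theorem sqSummable_incr {cl : ℝ} (hc : CouplingAssumption A.R A.C)
    (hrate : RateAssumption A.lam0 A.v N) (hcl : 0 ≤ cl)
    (hloss : ∀ θ x, l1norm (A.gradLoss θ x) ≤ cl)
    (hg : Measurable fun x : Vec n × Ξ => A.gradLoss x.1 x.2)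
    (hdata : DataAssumption P Q ξ) (hnoise : NoiseAssumption P N ξ ζ ϑ) :
    SqSummable P fun t ω => A.incr (sample ξ ω) (sample ζ ω) (sample ϑ ω) t := by
  obtain ⟨B, K, γ, hB, hK, hγ, hγ1, h⟩ := Algo.exists_incr_le hc hrate.lam0_pos hcl hloss
  have hlam : SqSummable P fun t (_ : Ω) => A.lam t :=
    SqSummable.const (summable_div_rpow_sq hrate.v_gt)
  have h1 := ((((SqSummable.sum Finset.univ fun j _ => sqSummable_ζ hrate hnoise j).add
    hlam).const_mul B).geo hγ.le hγ1).const_mul K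
  refine h1.mono (fun t => ?_) fun t ω => ?_
  · refine Measurable.aestronglyMeasurable (Finset.measurable_fun_sum _ fun i _ => ?_)
    exact ((measurable_network_sample hg hdata hnoise (t + 1) i).fst.sub
      (measurable_network_sample hg hdata hnoise t i).fst).norm
  · rw [Algo.incr, abs_of_nonneg (Finset.sum_nonneg fun _ _ => norm_nonneg _)]
    exact h _ _ _ t

/-- The same argument one level up: the driving terms are now the noises ϑ and the increments of the
tracking variables. -/
theorem sqSummable_consensus (hc : CouplingAssumption A.R A.C)
    (hrate : RateAssumption A.lam0 A.v N)
    (hg : Measurable fun x : Vec n × Ξ => A.gradLoss x.1 x.2)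
    (hdata : DataAssumption P Q ξ) (hnoise : NoiseAssumption P N ξ ζ ϑ)
    (hincr : SqSummable P fun t ω => A.incr (sample ξ ω) (sample ζ ω) (sample ϑ ω) t)
    {p : Fin m → ℝ} {c γ : ℝ} (hp : Matrix.vecMul p (1 + A.R) = p) (hc0 : 0 ≤ c) (hγ : 0 < γ)
    (hγ1 : γ < 1) (hP : ∀ t i j, |((1 + A.R) ^ t) i j - p j| ≤ c * γ ^ t) {M : ℝ}
    (hM : ∀ t i, |1 / ((m : ℝ) * zEst A.R t i i)| ≤ M) :
    SqSummable P fun t ω => ∑ i, ‖(A.network (sample ξ ω) (sample ζ ω) (sample ϑ ω) t i).2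
      - A.avgθ p (sample ξ ω) (sample ζ ω) (sample ϑ ω) t‖ := by
  obtain ⟨B, K, hB, hK, h⟩ := Algo.exists_consensus_le hc hp hc0 hγ hP hM
  have h1 := ((((SqSummable.sum Finset.univ fun j _ => sqSummable_ϑ hrate hnoise j).add
    hincr).const_mul B).geo hγ.le hγ1).const_mul K
  refine h1.mono (fun t => ?_) fun t ω => ?_
  · refine Measurable.aestronglyMeasurable (Finset.measurable_fun_sum _ fun i _ => ?_)
    exact ((measurable_network_sample hg hdata hnoise t i).snd.sub
      (measurable_avgθ hg hdata hnoise p t)).norm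
  · rw [abs_of_nonneg (Finset.sum_nonneg fun _ _ => norm_nonneg _)]
    exact h _ _ _ t

/-- The averaged noise is orthogonal to functions of the current average. -/
theorem integral_inner_avgNoise (hrate : RateAssumption A.lam0 A.v N)
    (hg : Measurable fun x : Vec n × Ξ => A.gradLoss x.1 x.2)
    (hdata : DataAssumption P Q ξ) (hnoise : NoiseAssumption P N ξ ζ ϑ) (p : Fin m → ℝ) (t : ℕ)
    {G : Vec n → Vec n} (hG : Measurable G) (hG2 : MemLp (fun ω =>
      ‖G (A.avgθ p (sample ξ ω) (sample ζ ω) (sample ϑ ω) t)‖) 2 P) :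
    Integrable (fun ω => inner ℝ (G (A.avgθ p (sample ξ ω) (sample ζ ω) (sample ϑ ω) t))
      (A.avgNoise p (fun j => ζ j t ω) (fun j => ϑ j t ω))) P ∧
    ∫ ω, inner ℝ (G (A.avgθ p (sample ξ ω) (sample ζ ω) (sample ϑ ω) t))
      (A.avgNoise p (fun j => ζ j t ω) (fun j => ϑ j t ω)) ∂P = 0 := by
  set U : Ω → Vec n := fun ω => G (A.avgθ p (sample ξ ω) (sample ζ ω) (sample ϑ ω) t) with hU
  have hUm : Measurable U := hG.comp (measurable_avgθ hg hdata hnoise p t)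
  have hind := Algo.indepFun_noise_network (A := A) hg hdata hnoise t
  have hW : Measurable fun y : Fin m → Vec n × Vec n => G (∑ i, p i • (y i).2) := by
    refine hG.comp (Finset.measurable_fun_sum _ fun i _ => ?_)
    exact (measurable_snd.comp (measurable_pi_apply i)).const_smul (p i)
  have hζ : ∀ j, Integrable (fun ω => inner ℝ (U ω) (ζ j t ω)) P ∧
      ∫ ω, inner ℝ (U ω) (ζ j t ω) ∂P = 0 := fun j =>
    integral_inner_eq_zero hUm (hnoise.measζ j t) hG2 ((sqSummable_ζ hrate hnoise j).memLp t)
      (hind.comp (measurable_fst.comp (measurable_pi_apply j)) hW) fun k =>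
        (laplace_moments (measurable_vec_iff.1 (hnoise.measζ j t) k)
          (noiseScale_pos (hrate.σζ_pos j) t) (hnoise.lawζ j t k)).2.1
  have hϑ : ∀ j, Integrable (fun ω => inner ℝ (U ω) (ϑ j t ω)) P ∧
      ∫ ω, inner ℝ (U ω) (ϑ j t ω) ∂P = 0 := fun j =>
    integral_inner_eq_zero hUm (hnoise.measϑ j t) hG2 ((sqSummable_ϑ hrate hnoise j).memLp t)
      (hind.comp (measurable_snd.comp (measurable_pi_apply j)) hW) fun k =>
        (laplace_moments (measurable_vec_iff.1 (hnoise.measϑ j t) k)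
          (noiseScale_pos (hrate.σϑ_pos j) t) (hnoise.lawϑ j t k)).2.1
  have e : ∀ ω, inner ℝ (U ω) (A.avgNoise p (fun j => ζ j t ω) (fun j => ϑ j t ω))
      = ∑ i, ∑ j ∈ inNbrs A.R i, (p i * A.R i j) * inner ℝ (U ω) (ϑ j t ω)
        + ∑ i, ∑ j ∈ inNbrs A.C i, (-(1 / (m : ℝ)) * A.C i j) * inner ℝ (U ω) (ζ j t ω) := by
    intro ω
    simp_rw [Algo.avgNoise, inner_add_right, inner_sum, inner_smul_right]
  have i1 : ∀ i ∈ Finset.univ, Integrable (fun ω => ∑ j ∈ inNbrs A.R i,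
      (p i * A.R i j) * inner ℝ (U ω) (ϑ j t ω)) P := fun i _ =>
    integrable_finsetSum _ fun j _ => (hϑ j).1.const_mul _
  have i2 : ∀ i ∈ Finset.univ, Integrable (fun ω => ∑ j ∈ inNbrs A.C i,
      (-(1 / (m : ℝ)) * A.C i j) * inner ℝ (U ω) (ζ j t ω)) P := fun i _ =>
    integrable_finsetSum _ fun j _ => (hζ j).1.const_mul _
  change Integrable (fun ω => inner ℝ (U ω) _) P ∧ ∫ ω, inner ℝ (U ω) _ ∂P = 0
  simp_rw [e]
  refine ⟨(integrable_finsetSum _ i1).add (integrable_finsetSum _ i2), ?_⟩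
  rw [integral_add (integrable_finsetSum _ i1) (integrable_finsetSum _ i2),
    integral_finsetSum _ i1, integral_finsetSum _ i2]
  have z1 : ∀ i, ∫ ω, ∑ j ∈ inNbrs A.R i, (p i * A.R i j) * inner ℝ (U ω) (ϑ j t ω) ∂P = 0 := by
    intro i
    rw [integral_finsetSum _ fun j _ => (hϑ j).1.const_mul _]
    exact Finset.sum_eq_zero fun j _ => by rw [integral_const_mul, (hϑ j).2, mul_zero]
  have z2 : ∀ i, ∫ ω, ∑ j ∈ inNbrs A.C i,
      (-(1 / (m : ℝ)) * A.C i j) * inner ℝ (U ω) (ζ j t ω) ∂P = 0 := by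
    intro i
    rw [integral_finsetSum _ fun j _ => (hζ j).1.const_mul _]
    exact Finset.sum_eq_zero fun j _ => by rw [integral_const_mul, (hζ j).2, mul_zero]
  simp_rw [z1, z2, Finset.sum_const_zero, add_zero]

end Noise

end OnlineLDP

/-! ### Uniform deviation of the empirical gradients -/

namespace OnlineLDP

section Deviation

variable {m n : ℕ} {Ω Ξ : Type*} [MeasurableSpace Ω] [MeasurableSpace Ξ] {P : Measure Ω}
  {A : Algo m n Ξ} {Q : Fin m → Measure Ξ} {ξ : Fin m → ℕ → Ω → Ξ} {κ L cl : ℝ}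

theorem DataAssumption.isProbabilityMeasure [IsProbabilityMeasure P]
    (hdata : DataAssumption P Q ξ) (i : Fin m) : IsProbabilityMeasure (Q i) := by
  rw [← hdata.law i 0]
  exact Measure.isProbabilityMeasure_map (hdata.meas i 0).aemeasurable

/-- The deviation of the empirical gradient from the gradient of the local objective. -/
noncomputable def gradDev (A : Algo m n Ξ) (Q : Fin m → Measure Ξ) (i : Fin m) (D : ℕ → Ξ) (t : ℕ)
    (θ : Vec n) : Vec n := A.empGrad D t θ - gradient (A.localObj Q i) θ

theorem norm_empGrad_sub_le (hgrad : GradientAssumption A Q κ L) (D : ℕ → Ξ) (t : ℕ)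
    (x y : Vec n) : ‖A.empGrad D t x - A.empGrad D t y‖ ≤ L * ‖x - y‖ := by
  have ht : (0 : ℝ) < (t : ℝ) + 1 := by positivity
  rw [Algo.empGrad, Algo.empGrad, ← smul_sub, norm_smul, Real.norm_of_nonneg (by positivity),
    one_div, inv_mul_le_iff₀ ht, ← Finset.sum_sub_distrib]
  refine (norm_sum_le _ _).trans
    ((Finset.sum_le_sum fun k _ => hgrad.lipschitz (D k) x y).trans ?_)
  simp

theorem norm_gradDev_sub_le [IsProbabilityMeasure P] (hgrad : GradientAssumption A Q κ L)
    (hdata : DataAssumption P Q ξ) (i : Fin m) (D : ℕ → Ξ) (t : ℕ) (x y : Vec n) :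
    ‖gradDev A Q i D t x‖ ≤ ‖gradDev A Q i D t y‖ + 2 * L * ‖x - y‖ := by
  have := hdata.isProbabilityMeasure
  have e : gradDev A Q i D t x = gradDev A Q i D t y
      + (A.empGrad D t x - A.empGrad D t y)
      - (gradient (A.localObj Q i) x - gradient (A.localObj Q i) y) := by
    unfold gradDev; abel
  have h1 := norm_empGrad_sub_le hgrad D t x y
  have h2 := Algo.norm_gradient_localObj_sub_le hgrad i x y
  rw [e]
  refine (norm_sub_le _ _).trans ?_
  have h3 := norm_add_le (gradDev A Q i D t y) (A.empGrad D t x - A.empGrad D t y)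
  linarith

theorem norm_gradient_localObj_le [IsProbabilityMeasure P] (hgrad : GradientAssumption A Q κ L)
    (hdata : DataAssumption P Q ξ) (hloss : ∀ θ x, l1norm (A.gradLoss θ x) ≤ cl) (i : Fin m)
    (θ : Vec n) : ‖gradient (A.localObj Q i) θ‖ ≤ cl := by
  have := hdata.isProbabilityMeasure
  rw [← (hgrad.unbiased i θ).2]
  simpa using norm_integral_le_of_norm_le_const (μ := Q i)
    (ae_of_all _ fun ξ => Algo.norm_gradLoss_le hloss θ ξ)

theorem norm_gradDev_le [IsProbabilityMeasure P] (hgrad : GradientAssumption A Q κ L)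
    (hdata : DataAssumption P Q ξ) (hloss : ∀ θ x, l1norm (A.gradLoss θ x) ≤ cl) (i : Fin m)
    (D : ℕ → Ξ) (t : ℕ) (θ : Vec n) : ‖gradDev A Q i D t θ‖ ≤ 2 * cl := by
  have h1 := norm_gradient_localObj_le hgrad hdata hloss i θ
  have h2 := Algo.norm_empGrad_le hloss D t θ
  refine (norm_sub_le _ _).trans ?_
  linarith

theorem measurable_gradDev [IsProbabilityMeasure P] (hgrad : GradientAssumption A Q κ L)
    (hdata : DataAssumption P Q ξ) (i : Fin m) (t : ℕ) {τ : Ω → Vec n} (hτ : Measurable τ) :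
    Measurable fun ω => gradDev A Q i (fun k => ξ i k ω) t (τ ω) := by
  have := hdata.isProbabilityMeasure
  have hc : Continuous (gradient (A.localObj Q i)) := by
    refine (LipschitzWith.of_dist_le_mul (K := L.toNNReal) fun x y => ?_).continuous
    rw [dist_eq_norm, dist_eq_norm]
    exact (Algo.norm_gradient_localObj_sub_le hgrad i x y).trans
      (mul_le_mul_of_nonneg_right (Real.le_coe_toNNReal L) (norm_nonneg _))
  exact (Algo.measurable_empGrad
    (Algo.measurable_uncurry_gradLoss hgrad.meas hgrad.diff hgrad.lipschitz)
    (fun k => hdata.meas i k) hτ t).sub (hc.measurable.comp hτ)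

variable [IsProbabilityMeasure P]

/-- Hoeffding's inequality in both directions for the centered coordinates of the sampled gradients,
which lie in an interval of length 2 * cl before centering and are independent over time. -/
theorem measureReal_gradDev_ge_le (hcl : 0 < cl) (hgrad : GradientAssumption A Q κ L)
    (hloss : ∀ θ x, l1norm (A.gradLoss θ x) ≤ cl) (hdata : DataAssumption P Q ξ) (i : Fin m)
    (θ : Vec n) (k : Fin n) (t : ℕ) {x : ℝ} (hx : 0 ≤ x) :
    P.real {ω | x ≤ |gradDev A Q i (fun j => ξ i j ω) t θ k|}
      ≤ 2 * Real.exp (-(((t : ℝ) + 1) * x ^ 2 / (2 * cl ^ 2))) := by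
  have hprob := hdata.isProbabilityMeasure
  have ht : (0 : ℝ) < (t : ℝ) + 1 := by positivity
  have hgm := Algo.measurable_gradLoss hgrad.meas hgrad.diff θ
  set φ : Ξ → ℝ := fun y => A.gradLoss θ y k with hφ
  have hφm : Measurable φ := measurable_vec_iff.1 hgm k
  have hφb : ∀ y, φ y ∈ Set.Icc (-cl) cl := fun y =>
    abs_le.1 ((abs_apply_le_norm _ k).trans (Algo.norm_gradLoss_le hloss θ y))
  have hmean : ∀ j, ∫ ω, φ (ξ i j ω) ∂P = gradient (A.localObj Q i) θ k := by
    intro j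
    have h1 : ∫ ω, φ (ξ i j ω) ∂P = ∫ y, φ y ∂(Q i) := by
      rw [← hdata.law i j, integral_map (hdata.meas i j).aemeasurable
        hφm.aestronglyMeasurable]
    rw [h1, ← (hgrad.unbiased i θ).2]
    have h2 := (EuclideanSpace.proj k : Vec n →L[ℝ] ℝ).integral_comp_comm (hgrad.unbiased i θ).1
    simpa using h2
  set X : ℕ → Ω → ℝ := fun j ω => φ (ξ i j ω) - gradient (A.localObj Q i) θ k with hX
  have hXi : iIndepFun X P := by
    have h := hdata.indep.comp (fun _ (y : Fin m → Ξ) => φ (y i) - gradient (A.localObj Q i) θ k)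
      fun _ => (hφm.comp (measurable_pi_apply i)).sub_const _
    exact h
  set c : NNReal := (‖cl - -cl‖₊ / 2) ^ 2 with hcdef
  have hc : (c : ℝ) = cl ^ 2 := by
    rw [hcdef]
    push_cast
    rw [Real.norm_of_nonneg (by linarith)]
    ring
  have hXs : ∀ j, HasSubgaussianMGF (X j) c P := by
    intro j
    have h := hasSubgaussianMGF_of_mem_Icc (μ := P) (X := fun ω => φ (ξ i j ω)) (a := -cl) (b := cl)
      (hφm.comp (hdata.meas i j)).aemeasurable (ae_of_all _ fun ω => hφb _)
    rw [hmean j] at h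
    exact h
  have hsum : ∀ ω, ∑ j ∈ Finset.range (t + 1), X j ω
      = ((t : ℝ) + 1) * gradDev A Q i (fun j => ξ i j ω) t θ k := by
    intro ω
    simp only [hX, Finset.sum_sub_distrib, gradDev, Algo.empGrad, hφ, PiLp.sub_apply,
      PiLp.smul_apply, smul_eq_mul, Finset.sum_const, Finset.card_range, nsmul_eq_mul]
    rw [WithLp.ofLp_sum, Finset.sum_apply]
    push_cast
    field_simp
  have hexp : -(((t : ℝ) + 1) * x) ^ 2 / (2 * ((t + 1 : ℕ) : ℝ) * c)
      = -(((t : ℝ) + 1) * x ^ 2 / (2 * cl ^ 2)) := by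
    rw [hc]
    push_cast
    field_simp
  have hp := HasSubgaussianMGF.measure_sum_range_ge_le_of_iIndepFun hXi (n := t + 1)
    (fun j _ => hXs j) (mul_nonneg ht.le hx)
  have hn := HasSubgaussianMGF.measure_sum_range_ge_le_of_iIndepFun (X := fun j ω => -X j ω)
    (hXi.comp (fun _ y => -y) fun _ => measurable_neg) (n := t + 1)
    (fun j _ => (hXs j).neg) (mul_nonneg ht.le hx)
  rw [hexp] at hp hn
  simp_rw [Finset.sum_neg_distrib, hsum, ← mul_neg] at hn
  simp_rw [hsum] at hp
  simp_rw [mul_le_mul_iff_right₀ ht] at hp hn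
  have hsub : {ω | x ≤ |gradDev A Q i (fun j => ξ i j ω) t θ k|}
      ⊆ {ω | x ≤ gradDev A Q i (fun j => ξ i j ω) t θ k}
        ∪ {ω | x ≤ -gradDev A Q i (fun j => ξ i j ω) t θ k} := fun ω hω => by
    simpa [le_abs] using hω
  have h1 := (measureReal_mono (μ := P) hsub).trans (measureReal_union_le _ _)
  linarith

/-- A grid point. -/
noncomputable def gridPoint (T : ℝ) (z : Fin n → ℤ) : Vec n := WithLp.toLp 2 fun k => (z k : ℝ) / T

/-- Coordinates are rounded down to multiples of 1 / (t + 1). On the ball of radius t + 1 the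
numerators are at most (t + 1) ^ 2 in absolute value, so the grid has polynomial size. -/
theorem exists_gridPoint {t : ℕ} {x : Vec n} (hx : ‖x‖ ≤ (t : ℝ) + 1) :
    ∃ z ∈ Fintype.piFinset fun _ : Fin n => Finset.Icc (-((t : ℤ) + 1) ^ 2) (((t : ℤ) + 1) ^ 2),
      ‖x - gridPoint ((t : ℝ) + 1) z‖ ≤ n / ((t : ℝ) + 1) := by
  have ht : (0 : ℝ) < (t : ℝ) + 1 := by positivity
  refine ⟨fun k => ⌊x k * ((t : ℝ) + 1)⌋, Fintype.mem_piFinset.2 fun k => ?_, ?_⟩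
  · obtain ⟨h1, h2⟩ := abs_le.1 ((abs_apply_le_norm x k).trans hx)
    rw [Finset.mem_Icc]
    constructor
    · rw [Int.le_floor]
      push_cast
      nlinarith
    · have h3 : x k * ((t : ℝ) + 1) ≤ ((t : ℝ) + 1) ^ 2 := by nlinarith
      have h4 := (Int.floor_le (x k * ((t : ℝ) + 1))).trans h3
      have h5 : ((⌊x k * ((t : ℝ) + 1)⌋ : ℤ) : ℝ) ≤ ((((t : ℤ) + 1) ^ 2 : ℤ) : ℝ) := by
        push_cast; exact h4
      exact Int.cast_le.1 h5
  · refine (norm_le_l1norm _).trans ?_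
    have h : ∀ k ∈ Finset.univ, |(x - gridPoint ((t : ℝ) + 1)
        fun k => ⌊x k * ((t : ℝ) + 1)⌋) k| ≤ 1 / ((t : ℝ) + 1) := by
      intro k _
      have e : (x - gridPoint ((t : ℝ) + 1) fun k => ⌊x k * ((t : ℝ) + 1)⌋) k
          = Int.fract (x k * ((t : ℝ) + 1)) / ((t : ℝ) + 1) := by
        simp only [gridPoint, PiLp.sub_apply, Int.fract]
        field_simp
      rw [e, abs_of_nonneg (div_nonneg (Int.fract_nonneg _) ht.le)]
      exact div_le_div_of_nonneg_right (Int.fract_lt_one _).le ht.le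
    refine (Finset.sum_le_sum h).trans (le_of_eq ?_)
    simp [div_eq_mul_inv]

theorem card_grid_le (n t : ℕ) :
    ((Fintype.piFinset fun _ : Fin n =>
      Finset.Icc (-((t : ℤ) + 1) ^ 2) (((t : ℤ) + 1) ^ 2)).card : ℝ)
      ≤ 3 ^ n * ((t : ℝ) + 1) ^ (2 * n) := by
  rw [Fintype.card_piFinset_const, Int.card_Icc]
  have e : (((t : ℤ) + 1) ^ 2 + 1 - -((t : ℤ) + 1) ^ 2).toNat = 2 * (t + 1) ^ 2 + 1 := by
    have : (((t : ℤ) + 1) ^ 2 + 1 - -((t : ℤ) + 1) ^ 2) = ((2 * (t + 1) ^ 2 + 1 : ℕ) : ℤ) := by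
      push_cast; ring
    rw [this, Int.toNat_natCast]
  rw [e, pow_mul, ← mul_pow]
  push_cast
  refine pow_le_pow_left₀ (by positivity) ?_ n
  have : (1 : ℝ) ≤ ((t : ℝ) + 1) ^ 2 := one_le_pow₀ (by linarith [(Nat.cast_nonneg t : (0 : ℝ) ≤ t)])
  linarith

/-- Mean square of the deviation at a random point, with no independence between the point and the
data; only the tail of the point matters. -/
theorem integral_gradDev_sq_le (hcl : 0 < cl) (hL : 0 ≤ L) (hgrad : GradientAssumption A Q κ L)
    (hloss : ∀ θ x, l1norm (A.gradLoss θ x) ≤ cl) (hdata : DataAssumption P Q ξ) (i : Fin m)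
    {B : ℝ} {t : ℕ} {τ : Ω → Vec n} (hτ : Measurable τ)
    (hB : P.real {ω | (t : ℝ) + 1 < ‖τ ω‖} ≤ B / ((t : ℝ) + 1)) :
    ∫ ω, ‖gradDev A Q i (fun k => ξ i k ω) t (τ ω)‖ ^ 2 ∂P
      ≤ (4 * n ^ 2 * cl ^ 2 * (2 * n + 1) * Real.log ((t : ℝ) + 1)
          + (8 * L ^ 2 * n ^ 2 + 4 * cl ^ 2 * (B + 2 * n * 3 ^ n))) / ((t : ℝ) + 1) := by
  classical
  set T : ℝ := (t : ℝ) + 1 with hT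
  have hT1 : 1 ≤ T := by rw [hT]; linarith [(Nat.cast_nonneg t : (0 : ℝ) ≤ t)]
  have hT0 : 0 < T := by linarith
  have hlog : 0 ≤ Real.log T := Real.log_nonneg hT1
  -- Chosen so that the Hoeffding bound equals 2 * T ^ (-(2 * n + 1)): summed over at most 3 ^ n * T
  -- ^ (2 * n) grid points and n coordinates it is still O(1 / T).
  set x : ℝ := cl * √(2 * (2 * n + 1) * Real.log T / T) with hx
  have hx0 : 0 ≤ x := by positivity
  have hx2 : x ^ 2 = cl ^ 2 * (2 * (2 * n + 1) * Real.log T / T) := by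
    rw [hx, mul_pow, Real.sq_sqrt (by positivity)]
  set S := Fintype.piFinset fun _ : Fin n =>
    Finset.Icc (-((t : ℤ) + 1) ^ 2) (((t : ℤ) + 1) ^ 2) with hS
  set E1 : (Fin n → ℤ) → Fin n → Set Ω := fun z k =>
    {ω | x ≤ |gradDev A Q i (fun j => ξ i j ω) t (gridPoint T z) k|} with hE1
  have hE1m : ∀ z k, MeasurableSet (E1 z k) := fun z k =>
    measurableSet_le measurable_const
      (measurable_vec_iff.1 (measurable_gradDev hgrad hdata i t measurable_const) k).abs
  set E : Set Ω := {ω | T < ‖τ ω‖} ∪ ⋃ z ∈ S, ⋃ k ∈ (Finset.univ : Finset (Fin n)), E1 z k with hE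
  have hEm : MeasurableSet E := (measurableSet_lt measurable_const hτ.norm).union
    (Finset.measurableSet_biUnion _ fun z _ => Finset.measurableSet_biUnion _ fun k _ => hE1m z k)
  have hexp : Real.exp (-(T * x ^ 2 / (2 * cl ^ 2))) = (T ^ (2 * n + 1))⁻¹ := by
    have : T * x ^ 2 / (2 * cl ^ 2) = ((2 * n + 1 : ℕ) : ℝ) * Real.log T := by
      rw [hx2]; push_cast; field_simp
    rw [this, Real.exp_neg, Real.exp_nat_mul, Real.exp_log hT0]
  have hPE : P.real E ≤ (B + 2 * n * 3 ^ n) / T := by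
    have h1 : ∀ z k, P.real (E1 z k) ≤ 2 * (T ^ (2 * n + 1))⁻¹ := fun z k => by
      rw [← hexp]
      exact measureReal_gradDev_ge_le hcl hgrad hloss hdata i _ k t hx0
    have h2 : P.real (⋃ z ∈ S, ⋃ k ∈ (Finset.univ : Finset (Fin n)), E1 z k)
        ≤ ∑ z ∈ S, ∑ k : Fin n, 2 * (T ^ (2 * n + 1))⁻¹ :=
      (measureReal_biUnion_finset_le _ _).trans (Finset.sum_le_sum fun z _ =>
        (measureReal_biUnion_finset_le _ _).trans (Finset.sum_le_sum fun k _ => h1 z k))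
    simp only [Finset.sum_const, nsmul_eq_mul, Finset.card_univ, Fintype.card_fin] at h2
    have h3 : (S.card : ℝ) * (n * (2 * (T ^ (2 * n + 1))⁻¹)) ≤ 2 * n * 3 ^ n / T := by
      refine (mul_le_mul_of_nonneg_right (card_grid_le n t) (by positivity)).trans (le_of_eq ?_)
      rw [pow_succ, ← hT]
      field_simp
    refine (measureReal_union_le _ _).trans ?_
    rw [add_div]
    exact add_le_add hB (h2.trans h3)
  -- Off the exceptional event: the deviation at the nearby grid point, with n coordinates of size
  -- x, plus the Lipschitz constant 2 * L of the deviation times the distance to the grid.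
  set b : ℝ := n * x + 2 * L * (n / T) with hb
  have hb0 : 0 ≤ b := by positivity
  have hout : ∀ ω, ω ∉ E → ‖gradDev A Q i (fun k => ξ i k ω) t (τ ω)‖ ≤ b := by
    intro ω hω
    rw [hE, Set.mem_union, not_or] at hω
    obtain ⟨h1, h2⟩ := hω
    rw [Set.mem_ofPred_eq, not_lt] at h1
    obtain ⟨z, hz, hzd⟩ := exists_gridPoint h1
    have h3 : ∀ k, |gradDev A Q i (fun j => ξ i j ω) t (gridPoint T z) k| ≤ x := by
      intro k
      by_contra hcon
      exact h2 (Set.mem_biUnion hz (Set.mem_biUnion (Finset.mem_coe.2 (Finset.mem_univ k))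
        (not_le.1 hcon).le))
    refine (norm_gradDev_sub_le hgrad hdata i _ t (τ ω) (gridPoint T z)).trans ?_
    refine add_le_add ((norm_le_l1norm _).trans ?_)
      (mul_le_mul_of_nonneg_left hzd (by positivity))
    refine (Finset.sum_le_sum fun k _ => h3 k).trans (le_of_eq ?_)
    simp
  have hdm := measurable_gradDev hgrad hdata i t hτ
  have hpt : ∀ ω, ‖gradDev A Q i (fun k => ξ i k ω) t (τ ω)‖ ^ 2
      ≤ b ^ 2 + E.indicator (fun _ => (2 * cl) ^ 2) ω := by
    intro ω
    by_cases h : ω ∈ E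
    · rw [Set.indicator_of_mem h]
      have := pow_le_pow_left₀ (norm_nonneg _)
        (norm_gradDev_le hgrad hdata hloss i (fun k => ξ i k ω) t (τ ω)) 2
      nlinarith [sq_nonneg b]
    · rw [Set.indicator_of_notMem h, add_zero]
      exact pow_le_pow_left₀ (norm_nonneg _) (hout ω h) 2
  have hint : Integrable (fun ω => ‖gradDev A Q i (fun k => ξ i k ω) t (τ ω)‖ ^ 2) P := by
    refine Integrable.of_bound (hdm.norm.pow_const 2).aestronglyMeasurable ((2 * cl) ^ 2)
      (ae_of_all _ fun ω => ?_)
    rw [Real.norm_of_nonneg (by positivity)]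
    exact pow_le_pow_left₀ (norm_nonneg _) (norm_gradDev_le hgrad hdata hloss i _ t _) 2
  have hind : Integrable (E.indicator fun _ => (2 * cl) ^ 2) P :=
    (integrable_const _).indicator hEm
  have hmain : ∫ ω, ‖gradDev A Q i (fun k => ξ i k ω) t (τ ω)‖ ^ 2 ∂P
      ≤ b ^ 2 + P.real E * (2 * cl) ^ 2 := by
    refine (integral_mono hint ((integrable_const _).add hind) hpt).trans (le_of_eq ?_)
    simp only [Pi.add_apply]
    rw [integral_add (integrable_const _) hind, integral_indicator_const _ hEm]
    simp
  refine hmain.trans ?_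
  have hb2 : b ^ 2 ≤ (4 * n ^ 2 * cl ^ 2 * (2 * n + 1) * Real.log T + 8 * L ^ 2 * n ^ 2) / T := by
    have h1 : b ^ 2 ≤ 2 * (n ^ 2 * x ^ 2) + 2 * (2 * L * (n / T)) ^ 2 := by
      rw [hb]; nlinarith [sq_nonneg (n * x - 2 * L * (n / T))]
    refine h1.trans ?_
    rw [hx2, add_div]
    refine add_le_add (le_of_eq (by ring)) ?_
    have h2 : 2 * (2 * L * (n / T)) ^ 2 = 8 * L ^ 2 * n ^ 2 / T / T := by field_simp; ring
    rw [h2]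
    exact div_le_self (by positivity) hT1
  have h3 : P.real E * (2 * cl) ^ 2 ≤ 4 * cl ^ 2 * (B + 2 * n * 3 ^ n) / T := by
    refine (mul_le_mul_of_nonneg_right hPE (by positivity)).trans (le_of_eq ?_)
    ring
  calc _ ≤ _ := add_le_add hb2 h3
    _ = _ := by rw [← add_div, add_assoc]

/-- The logarithm is absorbed in an arbitrarily small power. The constant is uniform over all random
points with the same tail bound, so it serves every x_t. -/
theorem exists_gradDev_bound (hcl : 0 < cl) (hL : 0 ≤ L) (hgrad : GradientAssumption A Q κ L)
    (hloss : ∀ θ x, l1norm (A.gradLoss θ x) ≤ cl) (hdata : DataAssumption P Q ξ) {B δ : ℝ}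
    (hB : 0 ≤ B) (hδ : 0 < δ) :
    ∃ C : ℝ, 0 ≤ C ∧ ∀ (i : Fin m) (t : ℕ) (τ : Ω → Vec n), Measurable τ →
      P.real {ω | (t : ℝ) + 1 < ‖τ ω‖} ≤ B / ((t : ℝ) + 1) →
      ∫ ω, ‖gradDev A Q i (fun k => ξ i k ω) t (τ ω)‖ ^ 2 ∂P ≤ C * ((t : ℝ) + 1) ^ (δ - 1) := by
  set C₁ : ℝ := 4 * n ^ 2 * cl ^ 2 * (2 * n + 1) with hC₁
  set C₂ : ℝ := 8 * L ^ 2 * n ^ 2 + 4 * cl ^ 2 * (B + 2 * n * 3 ^ n) with hC₂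
  have h1 : 0 ≤ C₁ := by positivity
  have h2 : 0 ≤ C₂ := by positivity
  refine ⟨C₁ / δ + C₂, by positivity, fun i t τ hτ hb => ?_⟩
  refine (integral_gradDev_sq_le hcl hL hgrad hloss hdata i hτ hb).trans ?_
  have hT1 : (1 : ℝ) ≤ (t : ℝ) + 1 := by linarith [(Nat.cast_nonneg t : (0 : ℝ) ≤ t)]
  have hT0 : (0 : ℝ) < (t : ℝ) + 1 := by linarith
  rw [Real.rpow_sub hT0, Real.rpow_one, ← mul_div_assoc]
  refine div_le_div_of_nonneg_right ?_ hT0.le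
  have h3 := Real.log_le_rpow_div hT0.le hδ
  have h4 : 1 ≤ ((t : ℝ) + 1) ^ δ := Real.one_le_rpow hT1 hδ.le
  rw [add_mul]
  refine add_le_add ?_ (le_mul_of_one_le_right h2 h4)
  calc C₁ * Real.log ((t : ℝ) + 1) ≤ C₁ * (((t : ℝ) + 1) ^ δ / δ) :=
        mul_le_mul_of_nonneg_left h3 h1
    _ = _ := by ring

end Deviation

end OnlineLDP

/-! ### Descent in mean -/

namespace OnlineLDP

/-! ### Almost decreasing scalar sequences. -/

section Sequences

theorem le_add_tsum_tail {b β : ℕ → ℝ} (hβ : ∀ t, 0 ≤ β t) (hs : Summable β)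
    (h : ∀ t, b (t + 1) ≤ b t + β t) (T s : ℕ) : b (s + T) ≤ b T + ∑' t, β (t + T) := by
  have h1 : b (s + T) ≤ b T + ∑ t ∈ Finset.range s, β (t + T) := by
    induction s with
    | zero => simp
    | succ s ih =>
      rw [Finset.sum_range_succ, add_right_comm]
      linarith [h (s + T)]
  have h2 : ∑ t ∈ Finset.range s, β (t + T) ≤ ∑' t, β (t + T) :=
    ((summable_nat_add_iff T).2 hs).sum_le_tsum _ fun t _ => hβ _
  linarith

/-- A deterministic Robbins–Siegmund lemma. -/
theorem robbins_siegmund {a b lam β : ℕ → ℝ} (ha : ∀ t, 0 ≤ a t) (hb : ∀ t, 0 ≤ b t)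
    (hl : ∀ t, 0 ≤ lam t) (hβ : ∀ t, 0 ≤ β t) (hs : Summable β)
    (h : ∀ t, a (t + 1) ≤ a t - lam t * b t + β t * (1 + a t)) :
    (∃ K : ℝ, ∀ t, 1 + a t ≤ K) ∧ Summable fun t => lam t * b t := by
  have hlb : ∀ t, 0 ≤ lam t * b t := fun t => mul_nonneg (hl t) (hb t)
  have h1 : ∀ t, 1 + a t ≤ (1 + a 0) * Real.exp (∑ s ∈ Finset.range t, β s) := by
    intro t
    induction t with
    | zero => simp
    | succ t ih =>
      rw [Finset.sum_range_succ, Real.exp_add, ← mul_assoc]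
      have h2 : 1 + a (t + 1) ≤ (1 + a t) * (1 + β t) := by linarith [h t, hlb t]
      refine h2.trans (mul_le_mul ih ?_ (by linarith [hβ t]) (by have := ha 0; positivity))
      linarith [Real.add_one_le_exp (β t)]
  set K := (1 + a 0) * Real.exp (∑' s, β s) with hK
  have hKb : ∀ t, 1 + a t ≤ K := fun t => (h1 t).trans
    (mul_le_mul_of_nonneg_left (Real.exp_le_exp.2 (hs.sum_le_tsum _ fun s _ => hβ s))
      (by linarith [ha 0]))
  refine ⟨⟨K, hKb⟩, summable_of_sum_range_le (c := a 0 + K * ∑' s, β s) hlb fun N => ?_⟩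
  have h3 : a N + ∑ t ∈ Finset.range N, lam t * b t
      ≤ a 0 + K * ∑ t ∈ Finset.range N, β t := by
    induction N with
    | zero => simp
    | succ N ih =>
      rw [Finset.sum_range_succ, Finset.sum_range_succ, mul_add]
      have h4 : β N * (1 + a N) ≤ K * β N := by
        rw [mul_comm]; exact mul_le_mul_of_nonneg_right (hKb N) (hβ N)
      linarith [h N]
  have h5 : K * ∑ t ∈ Finset.range N, β t ≤ K * ∑' s, β s :=
    mul_le_mul_of_nonneg_left (hs.sum_le_tsum _ fun s _ => hβ s) (by linarith [hKb 0, ha 0])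
  linarith [ha N]

theorem exists_tail_lt {β : ℕ → ℝ} {ε : ℝ} (hε : 0 < ε) : ∃ T, ∀ t ≥ T, ∑' s, β (s + t) < ε :=
  eventually_atTop.1 ((tendsto_sum_nat_add β).eventually_lt_const hε)

/-- Since lam is not summable while lam * b is, b is small at arbitrarily late times; from then on
it can only rise by a tail of β. -/
theorem tendsto_zero_of_quasi_decreasing {b lam β : ℕ → ℝ} (hb : ∀ t, 0 ≤ b t)
    (hl : ∀ t, 0 ≤ lam t) (hβ : ∀ t, 0 ≤ β t) (hs : Summable β)
    (h : ∀ t, b (t + 1) ≤ b t + β t) (hlb : Summable fun t => lam t * b t)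
    (hlam : ¬ Summable lam) : Tendsto b atTop (𝓝 0) := by
  refine Metric.tendsto_atTop.2 fun ε hε => ?_
  obtain ⟨T, hT⟩ := exists_tail_lt (β := β) (half_pos hε)
  have h1 : ∃ t ≥ T, b t < ε / 2 := by
    by_contra! hcon
    refine hlam ((summable_nat_add_iff T).1 (Summable.of_nonneg_of_le (fun t => hl _)
      (fun t => ?_) (((summable_nat_add_iff T).2 hlb).mul_left (2 / ε))))
    have h2 := hcon (t + T) (by omega)
    have h3 : lam (t + T) * (ε / 2) ≤ lam (t + T) * b (t + T) :=
      mul_le_mul_of_nonneg_left h2 (hl _)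
    calc lam (t + T) = 2 / ε * (lam (t + T) * (ε / 2)) := by field_simp
      _ ≤ _ := mul_le_mul_of_nonneg_left h3 (by positivity)
  obtain ⟨t₀, ht₀, hbt⟩ := h1
  refine ⟨t₀, fun t ht => ?_⟩
  have h4 := le_add_tsum_tail hβ hs h t₀ (t - t₀)
  rw [Nat.sub_add_cancel ht] at h4
  rw [Real.dist_eq, sub_zero, abs_of_nonneg (hb t)]
  linarith [hT t₀ ht₀]

end Sequences

/-! ### Test functions along a perturbed gradient step. -/

section Mean

variable {n : ℕ} {Ω : Type*} [MeasurableSpace Ω] {P : Measure Ω}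

/-- The process `x` decreases in mean along every smooth function `ψ` up to summable errors that
depend on `ψ` only through the constant `M` bounding its growth. -/
def MeanDescent (P : Measure Ω) (x : ℕ → Ω → Vec n) (gF : Vec n → Vec n) (xs : Vec n)
    (lam : ℕ → ℝ) : Prop :=
  ∀ M : ℝ, 0 ≤ M → ∃ β : ℕ → ℝ, (∀ t, 0 ≤ β t) ∧ Summable β ∧
    ∀ (ψ : Vec n → ℝ) (G : Vec n → Vec n), Continuous ψ → Continuous G →
      (∀ y h, ψ (y + h) ≤ ψ y + inner ℝ (G y) h + M * ‖h‖ ^ 2) →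
      (∀ y, ‖G y‖ ≤ M * (1 + ‖y - xs‖)) → (∀ y, |ψ y| ≤ M * (1 + ‖y - xs‖) ^ 2) →
      ∀ t, ∫ ω, ψ (x (t + 1) ω) ∂P ≤ ∫ ω, ψ (x t ω) ∂P
        - lam t * ∫ ω, inner ℝ (G (x t ω)) (gF (x t ω)) ∂P
        + β t * (1 + ∫ ω, ‖x t ω - xs‖ ^ 2 ∂P)

variable [IsProbabilityMeasure P] {x : ℕ → Ω → Vec n} {xs : Vec n}

theorem integrable_of_quadratic {y : Ω → Vec n} (hy : Measurable y)
    (hy2 : MemLp (fun ω => ‖y ω - xs‖) 2 P) {ψ : Vec n → ℝ} (hψ : Continuous ψ) {M : ℝ}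
    (h : ∀ y, |ψ y| ≤ M * (1 + ‖y - xs‖) ^ 2) : Integrable (fun ω => ψ (y ω)) P := by
  have h1 : MemLp (fun ω => 1 + ‖y ω - xs‖) 2 P := (memLp_const (1 : ℝ)).add hy2
  exact (h1.integrable_sq.const_mul M).mono' (hψ.measurable.comp hy).aestronglyMeasurable
    (ae_of_all _ fun ω => h (y ω))

theorem memLp_of_linear {y : Ω → Vec n} (hy : Measurable y)
    (hy2 : MemLp (fun ω => ‖y ω - xs‖) 2 P) {G : Vec n → Vec n} (hG : Continuous G) {M : ℝ}
    (h : ∀ y, ‖G y‖ ≤ M * (1 + ‖y - xs‖)) : MemLp (fun ω => ‖G (y ω)‖) 2 P := by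
  have h1 : MemLp (fun ω => M * (1 + ‖y ω - xs‖)) 2 P :=
    ((memLp_const (1 : ℝ)).add hy2).const_mul M
  refine h1.mono (hG.measurable.comp hy).norm.aestronglyMeasurable (ae_of_all _ fun ω => ?_)
  rw [norm_norm]
  exact (h (y ω)).trans (le_abs_self _)

/-- Expand ψ at the current point. The noise has mean zero against G, and Young's inequality
separates each error from ‖G‖ ^ 2, which is at most 2 * M ^ 2 * (1 + ‖x t - xs‖ ^ 2). The
coefficients lam ^ 2, lam * η and γ ^ t and the moments of the errors are all summable. -/
theorem meanDescent_of_step {w g r : ℕ → Ω → Vec n} {X dev Y : ℕ → Ω → ℝ} {lam η : ℕ → ℝ}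
    {gF : Vec n → Vec n} {c γ C D : ℝ} (hxm : ∀ t, Measurable (x t))
    (hx2 : ∀ t, MemLp (fun ω => ‖x t ω - xs‖) 2 P)
    (hstep : ∀ t ω, x (t + 1) ω = x t ω + (w t ω - lam t • g t ω - r t ω))
    (hH : SqSummable P fun t ω => ‖x (t + 1) ω - x t ω‖)
    (horth : ∀ (t : ℕ) (G : Vec n → Vec n), Continuous G → MemLp (fun ω => ‖G (x t ω)‖) 2 P →
      Integrable (fun ω => inner ℝ (G (x t ω)) (w t ω)) P ∧
        ∫ ω, inner ℝ (G (x t ω)) (w t ω) ∂P = 0)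
    (hgF : Continuous gF) (hgFb : ∀ y, ‖gF y‖ ≤ D)
    (herr : ∀ t ω, ‖g t ω - gF (x t ω)‖ ≤ X t ω + dev t ω) (hX : SqSummable P X)
    (hdev : ∀ t, MemLp (dev t) 2 P) (hC : 0 ≤ C) (hdevb : ∀ t, ∫ ω, dev t ω ^ 2 ∂P ≤ C * η t ^ 2)
    (hη : ∀ t, 0 < η t) (hr : ∀ t ω, ‖r t ω‖ ≤ c * γ ^ t * Y t ω) (hY : SqSummable P Y)
    (hγ : 0 < γ) (hγ1 : γ < 1) (hlam : ∀ t, 0 ≤ lam t) (hlam2 : Summable fun t => lam t ^ 2)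
    (hlamη : Summable fun t => lam t * η t) : MeanDescent P x gF xs lam := by
  intro M hM
  set β : ℕ → ℝ := fun t => M ^ 2 * (lam t ^ 2 + lam t * η t + γ ^ t)
    + (1 / 2 * (∫ ω, X t ω ^ 2 ∂P) + 1 / 2 * (C * (lam t * η t))
      + 1 / 2 * c ^ 2 * (∫ ω, Y t ω ^ 2 ∂P) + M * ∫ ω, ‖x (t + 1) ω - x t ω‖ ^ 2 ∂P) with hβ
  have hX0 : ∀ t, 0 ≤ ∫ ω, X t ω ^ 2 ∂P := fun t => integral_nonneg fun ω => sq_nonneg _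
  have hY0 : ∀ t, 0 ≤ ∫ ω, Y t ω ^ 2 ∂P := fun t => integral_nonneg fun ω => sq_nonneg _
  have hH0 : ∀ t, 0 ≤ ∫ ω, ‖x (t + 1) ω - x t ω‖ ^ 2 ∂P :=
    fun t => integral_nonneg fun ω => sq_nonneg _
  have hlη : ∀ t, 0 ≤ lam t * η t := fun t => mul_nonneg (hlam t) (hη t).le
  refine ⟨β, fun t => ?_, ?_, ?_⟩
  · have := hX0 t; have := hY0 t; have := hH0 t; have := hlη t
    positivity
  · exact (((hlam2.add hlamη).add (summable_geometric_of_lt_one hγ.le hγ1)).mul_left _).add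
      ((((hX.summable.mul_left _).add ((hlamη.mul_left C).mul_left _)).add
        (hY.summable.mul_left _)).add (hH.summable.mul_left M))
  · intro ψ G hψ hG hdesc hGb hψb t
    have hG2 := memLp_of_linear (hxm t) (hx2 t) hG hGb
    obtain ⟨hwI, hw0⟩ := horth t G hG hG2
    set a : Ω → ℝ := fun ω => ‖x t ω - xs‖ ^ 2
    have iψ := integrable_of_quadratic (hxm t) (hx2 t) hψ hψb
    have iψ' := integrable_of_quadratic (hxm (t + 1)) (hx2 (t + 1)) hψ hψb
    have iG : Integrable (fun ω => inner ℝ (G (x t ω)) (gF (x t ω))) P := by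
      refine ((hG2.integrable one_le_two).mul_const D).mono'
        ((hG.inner hgF).measurable.comp (hxm t)).aestronglyMeasurable (ae_of_all _ fun ω => ?_)
      exact (abs_real_inner_le_norm _ _).trans
        (mul_le_mul_of_nonneg_left (hgFb _) (norm_nonneg _))
    have ia : Integrable a P := (hx2 t).integrable_sq
    have iX := (hX.memLp t).integrable_sq
    have iY := (hY.memLp t).integrable_sq
    have idev := (hdev t).integrable_sq
    have iH := (hH.memLp t).integrable_sq
    set q : ℝ := lam t ^ 2 + lam t * η t + γ ^ t with hq
    have hpt : ∀ ω, ψ (x (t + 1) ω) ≤ ψ (x t ω) + inner ℝ (G (x t ω)) (w t ω)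
        - lam t * inner ℝ (G (x t ω)) (gF (x t ω)) + M ^ 2 * q * (1 + a ω)
        + 1 / 2 * X t ω ^ 2 + 1 / 2 * (lam t / η t) * dev t ω ^ 2 + 1 / 2 * c ^ 2 * Y t ω ^ 2
        + M * ‖x (t + 1) ω - x t ω‖ ^ 2 := by
      intro ω
      set y := x t ω with hy
      set d := w t ω - lam t • g t ω - r t ω with hd
      have e1 : x (t + 1) ω = y + d := hstep t ω
      have e2 : x (t + 1) ω - y = d := by rw [e1]; abel
      rw [e2, e1]
      have h1 := hdesc y d
      have h2 : inner ℝ (G y) d = inner ℝ (G y) (w t ω) - lam t * inner ℝ (G y) (gF y)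
          - lam t * inner ℝ (G y) (g t ω - gF y) - inner ℝ (G y) (r t ω) := by
        rw [hd, inner_sub_right, inner_sub_right, inner_smul_right, inner_sub_right (G y) (g t ω)]
        ring
      set N := ‖G y‖ with hN
      have hN0 : 0 ≤ N := norm_nonneg _
      have h3 : -inner ℝ (G y) (g t ω - gF y) ≤ N * (X t ω + dev t ω) :=
        ((neg_le_abs _).trans (abs_real_inner_le_norm _ _)).trans
          (mul_le_mul_of_nonneg_left (herr t ω) hN0)
      have h4 : -inner ℝ (G y) (r t ω) ≤ N * (c * γ ^ t * Y t ω) :=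
        ((neg_le_abs _).trans (abs_real_inner_le_norm _ _)).trans
          (mul_le_mul_of_nonneg_left (hr t ω) hN0)
      have h5 : lam t * (N * X t ω) ≤ 1 / 2 * (lam t ^ 2 * N ^ 2) + 1 / 2 * X t ω ^ 2 := by
        nlinarith [sq_nonneg (lam t * N - X t ω)]
      -- The weight η t balances the two halves: dev has mean square O(η t ^ 2), so both become
      -- O(lam t * η t), whereas its second moments alone need not be summable.
      have h6 : lam t * (N * dev t ω) ≤ 1 / 2 * (lam t * η t * N ^ 2)
          + 1 / 2 * (lam t / η t) * dev t ω ^ 2 := by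
        have h := mul_nonneg (div_nonneg (hlam t) (hη t).le) (sq_nonneg (η t * N - dev t ω))
        have e : lam t / η t * (η t * N - dev t ω) ^ 2
            = lam t * η t * N ^ 2 - 2 * (lam t * (N * dev t ω))
              + lam t / η t * dev t ω ^ 2 := by
          have := (hη t).ne'
          field_simp
          ring
        rw [e] at h
        linarith
      have h7 : N * (c * γ ^ t * Y t ω) ≤ 1 / 2 * (γ ^ t * N ^ 2) + 1 / 2 * c ^ 2 * Y t ω ^ 2 := by
        have hg1 : γ ^ t ≤ 1 := pow_le_one₀ hγ.le hγ1.le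
        have hg0 : 0 ≤ γ ^ t := by positivity
        nlinarith [mul_nonneg hg0 (sq_nonneg (N - c * Y t ω)),
          mul_nonneg (sub_nonneg.2 hg1) (sq_nonneg (c * Y t ω))]
      have h8 : N ^ 2 ≤ 2 * M ^ 2 * (1 + a ω) := by
        have h9 : N ^ 2 ≤ (M * (1 + ‖y - xs‖)) ^ 2 := pow_le_pow_left₀ hN0 (hGb y) 2
        refine h9.trans ?_
        have : (1 + ‖y - xs‖) ^ 2 ≤ 2 * (1 + ‖y - xs‖ ^ 2) := by
          nlinarith [sq_nonneg (1 - ‖y - xs‖)]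
        rw [mul_pow]
        calc M ^ 2 * (1 + ‖y - xs‖) ^ 2 ≤ M ^ 2 * (2 * (1 + ‖y - xs‖ ^ 2)) :=
              mul_le_mul_of_nonneg_left this (sq_nonneg M)
          _ = _ := by ring
      have hq0 : 0 ≤ q := by have := hlη t; positivity
      have h10 : 1 / 2 * (q * N ^ 2) ≤ M ^ 2 * q * (1 + a ω) := by
        have := mul_le_mul_of_nonneg_left h8 hq0
        linarith
      have h11 := mul_le_mul_of_nonneg_left h3 (hlam t)
      rw [hq] at h10
      rw [hq]
      linarith
    have i1 := iψ.add hwI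
    have i2 := i1.sub (iG.const_mul (lam t))
    have i3 := i2.add (((integrable_const (1 : ℝ)).add ia).const_mul (M ^ 2 * q))
    have i4 := i3.add (iX.const_mul (1 / 2))
    have i5 := i4.add (idev.const_mul (1 / 2 * (lam t / η t)))
    have i6 := i5.add (iY.const_mul (1 / 2 * c ^ 2))
    have i7 := i6.add (iH.const_mul M)
    have hmono := integral_mono iψ' i7 hpt
    rw [integral_add' i6 (iH.const_mul M), integral_add' i5 (iY.const_mul _),
      integral_add' i4 (idev.const_mul _), integral_add' i3 (iX.const_mul _),
      integral_add' i2 (((integrable_const (1 : ℝ)).add ia).const_mul (M ^ 2 * q)),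
      integral_sub' i1 (iG.const_mul _), integral_add' iψ hwI, hw0] at hmono
    simp only [integral_const_mul] at hmono
    have e1 : ∫ ω, ((fun _ : Ω => (1 : ℝ)) + a) ω ∂P = 1 + ∫ ω, a ω ∂P := by
      rw [integral_add' (integrable_const _) ia]; simp
    rw [e1] at hmono
    have h12 : 1 / 2 * (lam t / η t) * ∫ ω, dev t ω ^ 2 ∂P ≤ 1 / 2 * (C * (lam t * η t)) := by
      have h := mul_le_mul_of_nonneg_left (hdevb t)
        (by have := hlam t; have := hη t; positivity : 0 ≤ 1 / 2 * (lam t / η t))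
      have e : 1 / 2 * (lam t / η t) * (C * η t ^ 2) = 1 / 2 * (C * (lam t * η t)) := by
        have := (hη t).ne'
        field_simp
      linarith
    have ha0 : 0 ≤ ∫ ω, a ω ∂P := integral_nonneg fun ω => sq_nonneg _
    have h13 : 1 / 2 * (∫ ω, X t ω ^ 2 ∂P) + 1 / 2 * (C * (lam t * η t))
        + 1 / 2 * c ^ 2 * (∫ ω, Y t ω ^ 2 ∂P) + M * ∫ ω, ‖x (t + 1) ω - x t ω‖ ^ 2 ∂P
        ≤ (1 / 2 * (∫ ω, X t ω ^ 2 ∂P) + 1 / 2 * (C * (lam t * η t))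
        + 1 / 2 * c ^ 2 * (∫ ω, Y t ω ^ 2 ∂P) + M * ∫ ω, ‖x (t + 1) ω - x t ω‖ ^ 2 ∂P)
          * (1 + ∫ ω, a ω ∂P) := by
      refine le_mul_of_one_le_right ?_ (by linarith)
      have := hX0 t; have := hY0 t; have := hH0 t; have := hlη t
      positivity
    simp only [hβ]
    rw [add_mul]
    linarith

end Mean

end OnlineLDP

/-! ### Convergence from descent in mean -/

namespace OnlineLDP

/-! ### A truncated squared distance with descent constant independent of the truncation. -/

section Truncation

variable {n : ℕ}

/-- A smooth truncation of the squared distance to `xs`, vanishing as `K → ∞`. -/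
noncomputable def truncSq (xs : Vec n) (K : ℝ) (y : Vec n) : ℝ :=
  (√(K ^ 2 + ‖y - xs‖ ^ 2) - K) ^ 2

/-- The gradient of `truncSq`. -/
noncomputable def truncSqGrad (xs : Vec n) (K : ℝ) (y : Vec n) : Vec n :=
  (2 * (1 - K / √(K ^ 2 + ‖y - xs‖ ^ 2))) • (y - xs)

variable {xs : Vec n} {K : ℝ}

theorem le_truncRoot (K : ℝ) (y : Vec n) : K ≤ √(K ^ 2 + ‖y - xs‖ ^ 2) :=
  Real.le_sqrt_of_sq_le (by nlinarith [sq_nonneg ‖y - xs‖])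

theorem truncRoot_le (hK : 0 < K) (y : Vec n) : √(K ^ 2 + ‖y - xs‖ ^ 2) ≤ K + ‖y - xs‖ :=
  Real.sqrt_le_iff.2 ⟨by positivity, by nlinarith [mul_nonneg hK.le (norm_nonneg (y - xs))]⟩

theorem truncRoot_sq (y : Vec n) : √(K ^ 2 + ‖y - xs‖ ^ 2) ^ 2 = K ^ 2 + ‖y - xs‖ ^ 2 :=
  Real.sq_sqrt (by positivity)

theorem truncSq_le (hK : 0 < K) (y : Vec n) : truncSq xs K y ≤ ‖y - xs‖ ^ 2 := by
  have h1 := le_truncRoot (xs := xs) K y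
  have h2 := truncRoot_le (xs := xs) hK y
  exact pow_le_pow_left₀ (by linarith) (by linarith) 2

/-- With root q one has ‖y - xs‖ ^ 2 = `truncSq` + 2 * K * (q - K), and q - K ≤ ‖y - xs‖. The excess
is linear, hence controlled by L¹ convergence. -/
theorem sq_le_truncSq (hK : 0 < K) (y : Vec n) :
    ‖y - xs‖ ^ 2 ≤ truncSq xs K y + 2 * K * ‖y - xs‖ := by
  have h1 := truncRoot_sq (xs := xs) (K := K) y
  have h2 := truncRoot_le (xs := xs) hK y
  unfold truncSq
  nlinarith

theorem continuous_truncSq : Continuous (truncSq xs K) := by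
  unfold truncSq; fun_prop

theorem truncCoeff_mem (hK : 0 < K) (y : Vec n) :
    0 ≤ 1 - K / √(K ^ 2 + ‖y - xs‖ ^ 2) ∧ 1 - K / √(K ^ 2 + ‖y - xs‖ ^ 2) ≤ 1 := by
  have h1 := le_truncRoot (xs := xs) K y
  have h2 : 0 < √(K ^ 2 + ‖y - xs‖ ^ 2) := hK.trans_le h1
  constructor
  · rw [sub_nonneg, div_le_one h2]; exact h1
  · have : 0 ≤ K / √(K ^ 2 + ‖y - xs‖ ^ 2) := by positivity
    linarith

theorem continuous_truncSqGrad (hK : 0 < K) : Continuous (truncSqGrad xs K) := by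
  unfold truncSqGrad
  have h : ∀ y : Vec n, √(K ^ 2 + ‖y - xs‖ ^ 2) ≠ 0 := fun y =>
    (hK.trans_le (le_truncRoot K y)).ne'
  fun_prop (disch := exact h _)

theorem norm_truncSqGrad_le (hK : 0 < K) (y : Vec n) : ‖truncSqGrad xs K y‖ ≤ 2 * ‖y - xs‖ := by
  obtain ⟨h0, h1⟩ := truncCoeff_mem (xs := xs) hK y
  rw [truncSqGrad, norm_smul, Real.norm_of_nonneg (by linarith)]
  exact mul_le_mul_of_nonneg_right (by linarith) (norm_nonneg _)

/-- The constant 1 in front of ‖h‖ ^ 2 does not involve K, so `MeanDescent` applies with the same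
error sequence for all truncation levels. -/
theorem truncSq_descent (hK : 0 < K) (y h : Vec n) :
    truncSq xs K (y + h) ≤ truncSq xs K y + inner ℝ (truncSqGrad xs K y) h + ‖h‖ ^ 2 := by
  set q := √(K ^ 2 + ‖y - xs‖ ^ 2) with hq
  set q' := √(K ^ 2 + ‖y + h - xs‖ ^ 2) with hq'
  have hq0 : 0 < q := hK.trans_le (le_truncRoot K y)
  have hq2 : q ^ 2 = K ^ 2 + ‖y - xs‖ ^ 2 := truncRoot_sq y
  have hq2' : q' ^ 2 = K ^ 2 + ‖y + h - xs‖ ^ 2 := truncRoot_sq (y + h)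
  have e : y + h - xs = (y - xs) + h := by abel
  have hexp : ‖y + h - xs‖ ^ 2 = ‖y - xs‖ ^ 2 + 2 * inner ℝ (y - xs) h + ‖h‖ ^ 2 := by
    rw [e, norm_add_sq_real]
  -- Cauchy–Schwarz for the vectors (K, y - xs) and (K, y + h - xs) in one dimension more.
  have hcs : q ^ 2 + inner ℝ (y - xs) h ≤ q * q' := by
    have h1 : inner ℝ (y - xs) (y + h - xs) ≤ ‖y - xs‖ * ‖y + h - xs‖ := real_inner_le_norm _ _
    rw [e, inner_add_right, real_inner_self_eq_norm_sq, ← e] at h1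
    rw [hq, hq', ← Real.sqrt_mul (by positivity)]
    have h2 : K ^ 2 + ‖y - xs‖ * ‖y + h - xs‖
        ≤ √((K ^ 2 + ‖y - xs‖ ^ 2) * (K ^ 2 + ‖y + h - xs‖ ^ 2)) := by
      refine Real.le_sqrt_of_sq_le ?_
      nlinarith [mul_nonneg (sq_nonneg K) (sq_nonneg (‖y - xs‖ - ‖y + h - xs‖))]
    rw [← hq, hq2]
    linarith
  have hin : inner ℝ (truncSqGrad xs K y) h = 2 * (1 - K / q) * inner ℝ (y - xs) h := by
    rw [truncSqGrad, real_inner_smul_left]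
  have h3 : K / q * (q ^ 2 + inner ℝ (y - xs) h) ≤ K / q * (q * q') :=
    mul_le_mul_of_nonneg_left hcs (by positivity)
  have h4 : K / q * (q * q') = K * q' := by field_simp
  have h5 : K / q * q ^ 2 = K * q := by field_simp
  have e1 : truncSq xs K (y + h) = q' ^ 2 - 2 * (K * q') + K ^ 2 := by
    rw [truncSq, ← hq']; ring
  have e2 : truncSq xs K y = q ^ 2 - 2 * (K * q) + K ^ 2 := by
    rw [truncSq, ← hq]; ring
  rw [e1, e2, hin, hq2', hexp, hq2]
  rw [mul_add, h4, h5] at h3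
  nlinarith

theorem tendsto_truncSq (xs y : Vec n) :
    Tendsto (fun j : ℕ => truncSq xs ((j : ℝ) + 1) y) atTop (𝓝 0) := by
  have hb : Tendsto (fun j : ℕ => (‖y - xs‖ ^ 2 / ((j : ℝ) + 1)) ^ 2) atTop (𝓝 0) := by
    have htop : Tendsto (fun j : ℕ => (j : ℝ) + 1) atTop atTop :=
      tendsto_atTop_add_const_right _ _ tendsto_natCast_atTop_atTop
    simpa using (htop.const_div_atTop (‖y - xs‖ ^ 2)).pow 2
  refine squeeze_zero (fun j => sq_nonneg _) (fun j => ?_) hb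
  have hj : (0 : ℝ) < (j : ℝ) + 1 := by positivity
  have h1 := le_truncRoot (xs := xs) ((j : ℝ) + 1) y
  have h2 := truncRoot_sq (xs := xs) (K := (j : ℝ) + 1) y
  refine pow_le_pow_left₀ (by linarith) ?_ 2
  rw [le_div_iff₀ hj]
  nlinarith

end Truncation

/-! ### Convergence of a process with descent in mean. -/

section Convergence

variable {n : ℕ} {Ω : Type*} [MeasurableSpace Ω] {P : Measure Ω} [IsProbabilityMeasure P]
  {x : ℕ → Ω → Vec n} {xs : Vec n} {F : Vec n → ℝ} {lam : ℕ → ℝ} {D L : ℝ}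

theorem FirstOrderConvex.inner_ge (hF : FirstOrderConvex F) (y : Vec n) :
    F y - F xs ≤ inner ℝ (y - xs) (gradient F y) := by
  have h := hF y xs
  rw [show xs - y = -(y - xs) by abel, inner_neg_right, real_inner_comm] at h
  linarith

theorem abs_obj_sub_le (hF : FirstOrderConvex F) (hD : ∀ y, ‖gradient F y‖ ≤ D) (hD0 : 0 ≤ D)
    (y : Vec n) : |F y - F xs| ≤ D * (1 + ‖y - xs‖) ^ 2 :=
  (hF.abs_sub_le hD y xs).trans (mul_le_mul_of_nonneg_left
    (by nlinarith [norm_nonneg (y - xs)]) hD0)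

/-- Boundedness in mean square and summability of the weighted objective gaps. -/
theorem MeanDescent.bounded_and_summable (h : MeanDescent P x (gradient F) xs lam)
    (hxm : ∀ t, Measurable (x t)) (hx2 : ∀ t, MemLp (fun ω => ‖x t ω - xs‖) 2 P)
    (hF : FirstOrderConvex F) (hD : ∀ y, ‖gradient F y‖ ≤ D) (hD0 : 0 ≤ D)
    (hFc : Continuous (gradient F)) (hmin : ∀ y, F xs ≤ F y) (hl : ∀ t, 0 ≤ lam t) :
    (∃ K : ℝ, ∀ t, 1 + ∫ ω, ‖x t ω - xs‖ ^ 2 ∂P ≤ K) ∧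
      Summable fun t => lam t * ∫ ω, (F (x t ω) - F xs) ∂P := by
  obtain ⟨β, hβ0, hβs, hβ⟩ := h 2 zero_le_two
  -- Test with the squared distance: its drift dominates the objective gap by convexity.
  have hd := hβ (fun y => ‖y - xs‖ ^ 2) (fun y => (2 : ℝ) • (y - xs)) (by fun_prop) (by fun_prop)
    (fun y h => by
      rw [show y + h - xs = (y - xs) + h by abel, norm_add_sq_real, real_inner_smul_left]
      nlinarith [sq_nonneg ‖h‖])
    (fun y => by rw [norm_smul, Real.norm_ofNat]; linarith)
    (fun y => by
      rw [abs_of_nonneg (sq_nonneg _)]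
      nlinarith [norm_nonneg (y - xs)])
  have iF : ∀ t, Integrable (fun ω => F (x t ω) - F xs) P := fun t =>
    integrable_of_quadratic (ψ := fun y => F y - F xs) (hxm t) (hx2 t)
      ((hF.continuous hD).sub continuous_const) (abs_obj_sub_le hF hD hD0)
  refine robbins_siegmund (fun t => integral_nonneg fun ω => sq_nonneg _)
    (fun t => integral_nonneg fun ω => sub_nonneg.2 (hmin _)) hl hβ0 hβs fun t => ?_
  refine (hd t).trans ?_
  have h1 : ∫ ω, (F (x t ω) - F xs) ∂P
      ≤ ∫ ω, inner ℝ ((2 : ℝ) • (x t ω - xs)) (gradient F (x t ω)) ∂P := by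
    refine integral_mono (iF t) ?_ fun ω => ?_
    · refine (((hx2 t).integrable one_le_two).const_mul (2 * D)).mono'
        (((by fun_prop : Continuous fun y : Vec n => (2 : ℝ) • (y - xs)).inner
          hFc).measurable.comp (hxm t)).aestronglyMeasurable (ae_of_all _ fun ω => ?_)
      refine (abs_real_inner_le_norm _ _).trans ?_
      rw [norm_smul, Real.norm_ofNat]
      nlinarith [mul_le_mul_of_nonneg_left (hD (x t ω)) (norm_nonneg (x t ω - xs))]
    · simp only []
      rw [real_inner_smul_left]
      linarith [hF.inner_ge (xs := xs) (x t ω), hmin (x t ω)]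
  have h2 := mul_le_mul_of_nonneg_left h1 (hl t)
  linarith

/-- Convergence in mean of the objective values. -/
theorem MeanDescent.tendsto_obj (h : MeanDescent P x (gradient F) xs lam)
    (hxm : ∀ t, Measurable (x t)) (hx2 : ∀ t, MemLp (fun ω => ‖x t ω - xs‖) 2 P)
    (hF : FirstOrderConvex F) (hD : ∀ y, ‖gradient F y‖ ≤ D) (hD0 : 0 ≤ D) (hL0 : 0 ≤ L)
    (hL : ∀ y z, ‖gradient F y - gradient F z‖ ≤ L * ‖y - z‖)
    (hFc : Continuous (gradient F)) (hmin : ∀ y, F xs ≤ F y) (hl : ∀ t, 0 ≤ lam t)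
    (hlam : ¬ Summable lam) : Tendsto (fun t => ∫ ω, (F (x t ω) - F xs) ∂P) atTop (𝓝 0) := by
  obtain ⟨⟨K, hK⟩, hsum⟩ := h.bounded_and_summable hxm hx2 hF hD hD0 hFc hmin hl
  obtain ⟨β, hβ0, hβs, hβ⟩ := h (D + L) (by positivity)
  -- Test with the objective gap: the drift is -lam t times the mean of ‖∇F‖ ^ 2 and can be dropped,
  -- leaving an almost decreasing sequence.
  have hd := hβ (fun y => F y - F xs) (gradient F) ((hF.continuous hD).sub continuous_const) hFc
    (fun y h => by
      have := hF.descent hL y h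
      nlinarith [mul_nonneg hD0 (sq_nonneg ‖h‖)])
    (fun y => by
      have := mul_nonneg hD0 (norm_nonneg (y - xs))
      have := mul_nonneg hL0 (norm_nonneg (y - xs))
      linarith [hD y])
    (fun y => (abs_obj_sub_le hF hD hD0 y).trans
      (mul_le_mul_of_nonneg_right (by linarith) (sq_nonneg _)))
  refine tendsto_zero_of_quasi_decreasing (β := fun t => K * β t)
    (fun t => integral_nonneg fun ω => sub_nonneg.2 (hmin _)) hl
    (fun t => mul_nonneg ?_ (hβ0 t)) (hβs.mul_left K) (fun t => ?_) hsum hlam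
  · have : 0 ≤ ∫ ω, ‖x t ω - xs‖ ^ 2 ∂P := integral_nonneg fun ω => sq_nonneg _
    linarith [hK t]
  · have h1 : 0 ≤ lam t * ∫ ω, inner ℝ (gradient F (x t ω)) (gradient F (x t ω)) ∂P :=
      mul_nonneg (hl t) (integral_nonneg fun ω => real_inner_self_nonneg)
    have h2 := mul_le_mul_of_nonneg_left (hK t) (hβ0 t)
    have := hd t
    linarith

/-- Mean-square convergence, by uniform integrability, for an objective with linear growth at every
scale. -/
theorem MeanDescent.tendsto_sq (h : MeanDescent P x (gradient F) xs lam)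
    (hxm : ∀ t, Measurable (x t)) (hx2 : ∀ t, MemLp (fun ω => ‖x t ω - xs‖) 2 P)
    (hF : FirstOrderConvex F) (hD : ∀ y, ‖gradient F y‖ ≤ D) (hD0 : 0 ≤ D)
    (hFc : Continuous (gradient F)) (hmin : ∀ y, F xs ≤ F y) (hl : ∀ t, 0 ≤ lam t)
    (hobj : Tendsto (fun t => ∫ ω, (F (x t ω) - F xs) ∂P) atTop (𝓝 0))
    (hgrow : ∀ δ : ℝ, 0 < δ → ∃ c : ℝ, 0 ≤ c ∧ ∀ y, ‖y - xs‖ ≤ δ + c * (F y - F xs)) :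
    Tendsto (fun t => ∫ ω, ‖x t ω - xs‖ ^ 2 ∂P) atTop (𝓝 0) := by
  have i1 : ∀ t, Integrable (fun ω => ‖x t ω - xs‖) P := fun t => (hx2 t).integrable one_le_two
  have i2 : ∀ t, Integrable (fun ω => ‖x t ω - xs‖ ^ 2) P := fun t => (hx2 t).integrable_sq
  have iF : ∀ t, Integrable (fun ω => F (x t ω) - F xs) P := fun t =>
    integrable_of_quadratic (ψ := fun y => F y - F xs) (hxm t) (hx2 t)
      ((hF.continuous hD).sub continuous_const) (abs_obj_sub_le hF hD hD0)
  have hL1 : ∀ ε : ℝ, 0 < ε → ∀ᶠ t in atTop, ∫ ω, ‖x t ω - xs‖ ∂P < ε := by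
    intro ε hε
    obtain ⟨c, hc, hcb⟩ := hgrow (ε / 2) (half_pos hε)
    have h1 : Tendsto (fun t => ε / 2 + c * ∫ ω, (F (x t ω) - F xs) ∂P) atTop
        (𝓝 (ε / 2 + c * 0)) := (hobj.const_mul c).const_add _
    filter_upwards [h1.eventually_lt_const (by linarith : ε / 2 + c * 0 < ε)] with t ht
    refine lt_of_le_of_lt ?_ ht
    have h2 : ∫ ω, ‖x t ω - xs‖ ∂P ≤ ∫ ω, (ε / 2 + c * (F (x t ω) - F xs)) ∂P :=
      integral_mono (i1 t) ((integrable_const _).add ((iF t).const_mul c)) fun ω => hcb _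
    rw [integral_add (integrable_const _) ((iF t).const_mul c), integral_const_mul] at h2
    simpa using h2
  obtain ⟨⟨B, hB⟩, -⟩ := h.bounded_and_summable hxm hx2 hF hD hD0 hFc hmin hl
  obtain ⟨β, hβ0, hβs, hβ⟩ := h 2 zero_le_two
  have hB0 : 0 ≤ B := by
    have : 0 ≤ ∫ ω, ‖x 0 ω - xs‖ ^ 2 ∂P := integral_nonneg fun ω => sq_nonneg _
    linarith [hB 0]
  have htr0 : ∀ K y, 0 ≤ truncSq xs K y := fun K y => sq_nonneg _
  have itr : ∀ K, 0 < K → ∀ t, Integrable (fun ω => truncSq xs K (x t ω)) P := fun K hK t =>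
    (i2 t).mono' (continuous_truncSq.measurable.comp (hxm t)).aestronglyMeasurable
      (ae_of_all _ fun ω => by
        rw [Real.norm_of_nonneg (htr0 _ _)]; exact truncSq_le hK _)
  -- The error B * β t does not depend on K; T can therefore be fixed before K is chosen.
  have hstep : ∀ K, 0 < K → ∀ t, ∫ ω, truncSq xs K (x (t + 1) ω) ∂P
      ≤ ∫ ω, truncSq xs K (x t ω) ∂P + B * β t := by
    intro K hK t
    have hd := hβ (truncSq xs K) (truncSqGrad xs K) continuous_truncSq (continuous_truncSqGrad hK)
      (fun y h => (truncSq_descent hK y h).trans (by nlinarith [sq_nonneg ‖h‖]))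
      (fun y => (norm_truncSqGrad_le hK y).trans (by linarith))
      (fun y => by
        rw [abs_of_nonneg (htr0 _ _)]
        exact (truncSq_le hK y).trans (by nlinarith [norm_nonneg (y - xs)])) t
    have h1 : 0 ≤ lam t * ∫ ω, inner ℝ (truncSqGrad xs K (x t ω)) (gradient F (x t ω)) ∂P := by
      refine mul_nonneg (hl t) (integral_nonneg fun ω => ?_)
      simp only [truncSqGrad, real_inner_smul_left, Pi.zero_apply]
      have h2 := hF.inner_ge (xs := xs) (x t ω)
      exact mul_nonneg (mul_nonneg zero_le_two (truncCoeff_mem hK _).1)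
        ((sub_nonneg.2 (hmin _)).trans h2)
    have h2 := mul_le_mul_of_nonneg_left (hB t) (hβ0 t)
    linarith
  refine Metric.tendsto_atTop.2 fun ε hε => ?_
  obtain ⟨T, hT⟩ := exists_tail_lt (β := fun t => B * β t) (by positivity : 0 < ε / 3)
  -- At the single time T dominated convergence makes the truncated moment small for large K, and it
  -- stays small afterwards. This is the uniform integrability.
  have hlim : Tendsto (fun j : ℕ => ∫ ω, truncSq xs ((j : ℝ) + 1) (x T ω) ∂P) atTop (𝓝 0) := by
    have := tendsto_integral_of_dominated_convergence (μ := P)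
      (F := fun (j : ℕ) ω => truncSq xs ((j : ℝ) + 1) (x T ω)) (f := fun _ => (0 : ℝ))
      (fun ω => ‖x T ω - xs‖ ^ 2)
      (fun j => (itr _ (by positivity) T).aestronglyMeasurable) (i2 T)
      (fun j => ae_of_all _ fun ω => by
        rw [Real.norm_of_nonneg (htr0 _ _)]; exact truncSq_le (by positivity) _)
      (ae_of_all _ fun ω => tendsto_truncSq xs _)
    simpa using this
  obtain ⟨j, hj⟩ := (hlim.eventually_lt_const (by positivity : 0 < ε / 3)).exists
  set K : ℝ := (j : ℝ) + 1 with hK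
  have hK0 : 0 < K := by positivity
  obtain ⟨T', hT'⟩ := eventually_atTop.1 (hL1 (ε / 3 / (2 * K)) (by positivity))
  refine ⟨max T T', fun t ht => ?_⟩
  have h1 := le_add_tsum_tail (b := fun t => ∫ ω, truncSq xs K (x t ω) ∂P)
    (fun t => mul_nonneg hB0 (hβ0 t)) (hβs.mul_left B) (hstep K hK0) T (t - T)
  rw [Nat.sub_add_cancel ((le_max_left _ _).trans ht)] at h1
  have h2 := hT' t ((le_max_right _ _).trans ht)
  rw [lt_div_iff₀ (by positivity)] at h2
  have h3 : ∫ ω, ‖x t ω - xs‖ ^ 2 ∂P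
      ≤ ∫ ω, (truncSq xs K (x t ω) + 2 * K * ‖x t ω - xs‖) ∂P :=
    integral_mono (i2 t) ((itr K hK0 t).add ((i1 t).const_mul (2 * K))) fun ω =>
      sq_le_truncSq hK0 _
  rw [integral_add (itr K hK0 t) ((i1 t).const_mul (2 * K)), integral_const_mul] at h3
  rw [Real.dist_eq, sub_zero, abs_of_nonneg (integral_nonneg fun ω => sq_nonneg _)]
  have h4 := hT T le_rfl
  linarith

end Convergence

end OnlineLDP

/-! ### The average of the model parameters -/

namespace OnlineLDP

section Growth

variable {n : ℕ} {Ω : Type*} [MeasurableSpace Ω] {P : Measure Ω} [IsProbabilityMeasure P]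
  {x : ℕ → Ω → Vec n}

theorem norm_le_sum_increments (x : ℕ → Vec n) (t : ℕ) :
    ‖x t‖ ≤ ‖x 0‖ + ∑ k ∈ Finset.range t, ‖x (k + 1) - x k‖ := by
  induction t with
  | zero => simp
  | succ t ih =>
    rw [Finset.sum_range_succ]
    have h := norm_add_le (x t) (x (t + 1) - x t)
    rw [add_sub_cancel] at h
    linarith

theorem memLp_of_increments (hxm : ∀ t, Measurable (x t)) {a : ℝ} (h0 : ∀ ω, ‖x 0 ω‖ ≤ a)
    (hH : SqSummable P fun t ω => ‖x (t + 1) ω - x t ω‖) (t : ℕ) :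
    MemLp (fun ω => ‖x t ω‖) 2 P := by
  have h1 : MemLp (fun ω => a + ∑ k ∈ Finset.range t, ‖x (k + 1) ω - x k ω‖) 2 P :=
    (memLp_const a).add (memLp_finsetSum _ fun k _ => hH.memLp k)
  refine h1.mono (hxm t).norm.aestronglyMeasurable (ae_of_all _ fun ω => ?_)
  rw [norm_norm]
  refine le_trans ?_ (le_abs_self _)
  have := norm_le_sum_increments (fun t => x t ω) t
  linarith [h0 ω]

/-- Diffusive growth in probability of a process with square-summable increments. -/
theorem exists_tail_bound (hxm : ∀ t, Measurable (x t)) {a : ℝ} (h0 : ∀ ω, ‖x 0 ω‖ ≤ a)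
    (hH : SqSummable P fun t ω => ‖x (t + 1) ω - x t ω‖) :
    ∃ B : ℝ, 0 ≤ B ∧ ∀ t : ℕ, P.real {ω | (t : ℝ) + 1 < ‖x t ω‖} ≤ B / ((t : ℝ) + 1) := by
  have hi0 : ∀ k, 0 ≤ ∫ ω, ‖x (k + 1) ω - x k ω‖ ^ 2 ∂P :=
    fun k => integral_nonneg fun ω => sq_nonneg _
  set S : ℝ := ∑' k, ∫ ω, ‖x (k + 1) ω - x k ω‖ ^ 2 ∂P with hS
  have hS0 : 0 ≤ S := tsum_nonneg hi0
  refine ⟨2 * a ^ 2 + 2 * S, by positivity, fun t => ?_⟩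
  have ht : (0 : ℝ) < (t : ℝ) + 1 := by positivity
  have hi : ∀ k, Integrable (fun ω => ‖x (k + 1) ω - x k ω‖ ^ 2) P :=
    fun k => (hH.memLp k).integrable_sq
  have hsq := (memLp_of_increments hxm h0 hH t).integrable_sq
  have hsum : Integrable (fun ω => ∑ k ∈ Finset.range t, ‖x (k + 1) ω - x k ω‖ ^ 2) P :=
    integrable_finsetSum _ fun k _ => hi k
  -- Cauchy–Schwarz over the t increments gives a second moment O(t + 1); Chebyshev at level t + 1
  -- then yields O(1 / (t + 1)).
  have h1 : ∫ ω, ‖x t ω‖ ^ 2 ∂P ≤ ∫ ω, (2 * a ^ 2 + 2 * (t : ℝ)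
      * ∑ k ∈ Finset.range t, ‖x (k + 1) ω - x k ω‖ ^ 2) ∂P := by
    refine integral_mono hsq ((integrable_const _).add (hsum.const_mul _)) fun ω => ?_
    have h2 := norm_le_sum_increments (fun t => x t ω) t
    have h3 := sq_sum_le_card_mul_sum_sq (s := Finset.range t)
      (f := fun k => ‖x (k + 1) ω - x k ω‖)
    rw [Finset.card_range] at h3
    set s := ∑ k ∈ Finset.range t, ‖x (k + 1) ω - x k ω‖
    have h4 : ‖x t ω‖ ^ 2 ≤ (a + s) ^ 2 :=
      pow_le_pow_left₀ (norm_nonneg _) (by linarith [h0 ω]) 2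
    change ‖x t ω‖ ^ 2 ≤ _
    nlinarith [sq_nonneg (a - s)]
  rw [integral_add (integrable_const _) (hsum.const_mul _), integral_const_mul (2 * (t : ℝ)),
    integral_finsetSum _ fun k _ => hi k] at h1
  have h5 : ∑ k ∈ Finset.range t, ∫ ω, ‖x (k + 1) ω - x k ω‖ ^ 2 ∂P ≤ S :=
    hH.summable.sum_le_tsum _ fun k _ => hi0 k
  have h6 : ∫ ω, ‖x t ω‖ ^ 2 ∂P ≤ (2 * a ^ 2 + 2 * S) * ((t : ℝ) + 1) := by
    simp only [integral_const, probReal_univ, one_smul] at h1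
    have : 2 * (t : ℝ) * ∑ k ∈ Finset.range t, ∫ ω, ‖x (k + 1) ω - x k ω‖ ^ 2 ∂P
        ≤ 2 * (t : ℝ) * S := mul_le_mul_of_nonneg_left h5 (by positivity)
    nlinarith [sq_nonneg a, mul_nonneg (sq_nonneg a) (Nat.cast_nonneg (α := ℝ) t)]
  have h7 := mul_meas_ge_le_integral_of_nonneg (μ := P)
    (ae_of_all _ fun ω => sq_nonneg ‖x t ω‖) hsq (((t : ℝ) + 1) ^ 2)
  have h8 : P.real {ω | (t : ℝ) + 1 < ‖x t ω‖} ≤ P.real {ω | ((t : ℝ) + 1) ^ 2 ≤ ‖x t ω‖ ^ 2} :=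
    measureReal_mono fun ω hω => pow_le_pow_left₀ ht.le (le_of_lt hω) 2
  rw [le_div_iff₀ ht]
  have h9 : P.real {ω | ((t : ℝ) + 1) ^ 2 ≤ ‖x t ω‖ ^ 2} * ((t : ℝ) + 1)
      ≤ 2 * a ^ 2 + 2 * S := by
    refine le_of_mul_le_mul_right ?_ ht
    calc _ = ((t : ℝ) + 1) ^ 2 * P.real {ω | ((t : ℝ) + 1) ^ 2 ≤ ‖x t ω‖ ^ 2} := by ring
      _ ≤ _ := h7.trans h6
  exact (mul_le_mul_of_nonneg_right h8 ht.le).trans h9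

end Growth

section Average

variable {m n : ℕ} {Ω Ξ : Type*} [MeasurableSpace Ω] [MeasurableSpace Ξ] {P : Measure Ω}
  [IsProbabilityMeasure P] {A : Algo m n Ξ} {N : NoiseParams m} {Q : Fin m → Measure Ξ}
  {ξ : Fin m → ℕ → Ω → Ξ} {ζ ϑ : Fin m → ℕ → Ω → Vec n} {κ L cl D : ℝ}

omit [IsProbabilityMeasure P] in
theorem sqSummable_avgNoise (hrate : RateAssumption A.lam0 A.v N)
    (hnoise : NoiseAssumption P N ξ ζ ϑ) (p : Fin m → ℝ) :
    SqSummable P fun t ω => ‖A.avgNoise p (fun j => ζ j t ω) (fun j => ϑ j t ω)‖ := by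
  have h := (SqSummable.sum Finset.univ fun i _ => SqSummable.sum (inNbrs A.R i) fun j _ =>
    (sqSummable_ϑ hrate hnoise j).const_mul |p i * A.R i j|).add
    (SqSummable.sum Finset.univ fun i _ => SqSummable.sum (inNbrs A.C i) fun j _ =>
      (sqSummable_ζ hrate hnoise j).const_mul |-(1 / (m : ℝ)) * A.C i j|)
  refine h.mono (fun t => ?_) fun t ω => ?_
  · have h1 : Measurable fun ω => ∑ i, ∑ j ∈ inNbrs A.R i, (p i * A.R i j) • ϑ j t ω :=
      Finset.measurable_fun_sum _ fun i _ => Finset.measurable_fun_sum _ fun j _ =>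
        (hnoise.measϑ j t).const_smul (p i * A.R i j)
    have h2 : Measurable fun ω => ∑ i, ∑ j ∈ inNbrs A.C i, (-(1 / (m : ℝ)) * A.C i j) • ζ j t ω :=
      Finset.measurable_fun_sum _ fun i _ => Finset.measurable_fun_sum _ fun j _ =>
        (hnoise.measζ j t).const_smul (-(1 / (m : ℝ)) * A.C i j)
    exact (h1.add h2).norm.aestronglyMeasurable
  · rw [abs_norm, Algo.avgNoise]
    refine (norm_add_le _ _).trans (add_le_add ?_ ?_)
    all_goals
      refine (norm_sum_le _ _).trans (Finset.sum_le_sum fun i _ =>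
        (norm_sum_le _ _).trans (Finset.sum_le_sum fun j _ => ?_))
      rw [norm_smul, Real.norm_eq_abs]

omit [MeasurableSpace Ξ] in
theorem not_summable_lam (hrate : RateAssumption A.lam0 A.v N) : ¬ Summable A.lam := by
  intro h
  have h1 : Summable fun t : ℕ => (((t : ℝ) + 1) ^ A.v)⁻¹ := by
    refine (h.mul_left A.lam0⁻¹).congr fun t => ?_
    have := hrate.lam0_pos.ne'
    rw [Algo.lam]
    field_simp
  have h2 : Summable fun t : ℕ => ((t : ℝ) ^ A.v)⁻¹ := by
    rw [← summable_nat_add_iff 1]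
    simpa using h1
  exact absurd (Real.summable_nat_rpow_inv.1 h2) (by linarith [hrate.v_lt])

/-- The weighted average of the model parameters satisfies the descent inequalities in mean, and the
model parameters approach it in mean square. -/
theorem exists_meanDescent (hc : CouplingAssumption A.R A.C)
    (hrate : RateAssumption A.lam0 A.v N) (hcl : 0 < cl) (hL : 0 ≤ L)
    (hbdd : ∀ i θ, ‖gradient (A.localObj Q i) θ‖ ≤ D) (hgrad : GradientAssumption A Q κ L)
    (hloss : ∀ θ x, l1norm (A.gradLoss θ x) ≤ cl)
    (hdata : DataAssumption P Q ξ) (hnoise : NoiseAssumption P N ξ ζ ϑ) (xs : Vec n) :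
    ∃ x : ℕ → Ω → Vec n, (∀ t, Measurable (x t)) ∧ (∀ t, MemLp (fun ω => ‖x t ω - xs‖) 2 P) ∧
      SqSummable P (fun t ω => ∑ i,
        ‖(A.network (sample ξ ω) (sample ζ ω) (sample ϑ ω) t i).2 - x t ω‖) ∧
      MeanDescent P x (gradient (A.obj Q)) xs A.lam := by
  have hprob := hdata.isProbabilityMeasure
  have hm := hc.m_pos
  have hm0 : (0 : ℝ) < m := by exact_mod_cast hm
  have hg := Algo.measurable_uncurry_gradLoss hgrad.meas hgrad.diff hgrad.lipschitz
  obtain ⟨p, hp0, hp1, hp, c, γ, hc0, hγ, hγ1, hP⟩ := hc.exists_limit_R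
  have hu : IsLeftPerron A.R fun i => m * p i := by
    refine ⟨fun j => mul_pos hm0 (hp0 j), ?_, by rw [← Finset.mul_sum, hp1, mul_one]⟩
    have : (fun j => (m : ℝ) * p j) = (m : ℝ) • p := rfl
    rw [this, Matrix.smul_vecMul, hp]
  obtain ⟨cz, γz, hr⟩ := hc.exists_isEigenRate hu
  obtain ⟨hcz, hγz, hγz1, -⟩ := id hr
  have hM : ∀ t i, |1 / ((m : ℝ) * zEst A.R t i i)| ≤ cz + ∑ j, 1 / |m * p j| := by
    intro t i
    refine (Algo.abs_inv_le_of_isEigenRate hr i t).trans (add_le_add ?_ ?_)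
    · exact mul_le_of_le_one_right hcz.le (pow_le_one₀ hγz.le hγz1.le)
    · exact Finset.single_le_sum (f := fun j => 1 / |m * p j|) (fun j _ => by positivity)
        (Finset.mem_univ i)
  set x : ℕ → Ω → Vec n := fun t ω => A.avgθ p (sample ξ ω) (sample ζ ω) (sample ϑ ω) t with hx
  have hxm : ∀ t, Measurable (x t) := measurable_avgθ hg hdata hnoise p
  have hincr := sqSummable_incr hc hrate hcl.le hloss hg hdata hnoise
  have hcons := sqSummable_consensus hc hrate hg hdata hnoise hincr hp hc0.le hγ hγ1 hP hM
  have hlam0 : ∀ t, 0 ≤ A.lam t := fun t => (Algo.lam_pos hrate.lam0_pos t).le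
  have hlam2 : Summable fun t => A.lam t ^ 2 := summable_div_rpow_sq hrate.v_gt
  choose r hstep hrb using fun t ω =>
    Algo.avgθ_succ hc hp0 hp1 hp hr (sample ξ ω) (sample ζ ω) (sample ϑ ω) t
  have hgb : ∀ t ω, ‖A.avgGrad (sample ξ ω) (sample ζ ω) (sample ϑ ω) t‖ ≤ cl := fun t ω =>
    Algo.norm_average_le hm fun i => Algo.norm_empGrad_le hloss _ _ _
  have hincr0 : ∀ t ω, 0 ≤ A.incr (sample ξ ω) (sample ζ ω) (sample ϑ ω) t := fun t ω =>
    Finset.sum_nonneg fun _ _ => norm_nonneg _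
  have hH : SqSummable P fun t ω => ‖x (t + 1) ω - x t ω‖ := by
    refine (((sqSummable_avgNoise hrate hnoise p).add
      ((SqSummable.const hlam2).const_mul cl)).add (hincr.const_mul cz)).mono
      (fun t => ((hxm (t + 1)).sub (hxm t)).norm.aestronglyMeasurable) fun t ω => ?_
    rw [abs_norm, hx]
    simp only []
    rw [hstep t ω, add_sub_cancel_left]
    refine (norm_sub_le _ _).trans (add_le_add ((norm_sub_le _ _).trans (add_le_add_right ?_ _)) ?_)
    · rw [norm_smul, Real.norm_of_nonneg (hlam0 t), mul_comm]
      exact mul_le_mul_of_nonneg_right (hgb t ω) (hlam0 t)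
    · refine (hrb t ω).trans (mul_le_mul_of_nonneg_right ?_ (hincr0 t ω))
      exact mul_le_of_le_one_right hcz.le (pow_le_one₀ hγz.le hγz1.le)
  have hx0 : ∀ ω, ‖x 0 ω‖ ≤ ‖∑ i, p i • A.θ0 i‖ := fun ω => le_rfl
  have hxL := memLp_of_increments hxm hx0 hH
  have hx2 : ∀ t, MemLp (fun ω => ‖x t ω - xs‖) 2 P := fun t => by
    have h1 : MemLp (fun ω => ‖x t ω‖ + ‖xs‖) 2 P := (hxL t).add (memLp_const _)
    exact h1.mono ((hxm t).sub_const xs).norm.aestronglyMeasurable (ae_of_all _ fun ω => by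
      rw [norm_norm]; exact (norm_sub_le _ _).trans (le_abs_self _))
  obtain ⟨B, hB0, hB⟩ := exists_tail_bound hxm hx0 hH
  have hv := hrate.v_gt
  obtain ⟨C, hC0, hC⟩ := exists_gradDev_bound hcl hL hgrad hloss hdata hB0
    (δ := A.v - 1 / 2) (by linarith)
  -- η ^ 2 is the deviation bound for δ = v - 1 / 2, and lam * η then decays with exponent v / 2 + 3
  -- / 4, which exceeds 1 because v > 1 / 2.
  set η : ℕ → ℝ := fun t => ((t : ℝ) + 1) ^ ((A.v - 1 / 2 - 1) / 2) with hη
  have hη0 : ∀ t, 0 < η t := fun t => by positivity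
  have hη2 : ∀ t, η t ^ 2 = ((t : ℝ) + 1) ^ (A.v - 1 / 2 - 1) := fun t => by
    rw [hη, ← Real.rpow_mul_natCast (by positivity)]
    norm_num
  have hlamη : Summable fun t => A.lam t * η t := by
    refine ((summable_inv_rpow (a := A.v / 2 + 3 / 4) (by linarith)).mul_left A.lam0).congr
      fun t => ?_
    have ht : (0 : ℝ) < (t : ℝ) + 1 := by positivity
    change _ = A.lam t * ((t : ℝ) + 1) ^ ((A.v - 1 / 2 - 1) / 2)
    rw [Algo.lam, div_eq_mul_inv A.lam0, mul_assoc, ← Real.rpow_neg ht.le, ← Real.rpow_neg ht.le,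
      ← Real.rpow_add ht]
    congr 2
    ring
  set dev : ℕ → Ω → ℝ := fun t ω => ∑ i, ‖gradDev A Q i (fun k => ξ i k ω) t (x t ω)‖ with hdev
  have hdevm : ∀ t i, MemLp (fun ω => ‖gradDev A Q i (fun k => ξ i k ω) t (x t ω)‖) 2 P :=
    fun t i => MemLp.of_bound (measurable_gradDev hgrad hdata i t (hxm t)).norm.aestronglyMeasurable
      (2 * cl) (ae_of_all _ fun ω => by
        rw [norm_norm]; exact norm_gradDev_le hgrad hdata hloss i _ t _)
  have hdevb : ∀ t, ∫ ω, dev t ω ^ 2 ∂P ≤ (m * (m * C)) * η t ^ 2 := by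
    intro t
    have hI : Integrable (fun ω => ∑ i, ‖gradDev A Q i (fun k => ξ i k ω) t (x t ω)‖ ^ 2) P :=
      integrable_finsetSum _ fun i _ => (hdevm t i).integrable_sq
    have h1 : ∫ ω, dev t ω ^ 2 ∂P
        ≤ ∫ ω, m * ∑ i, ‖gradDev A Q i (fun k => ξ i k ω) t (x t ω)‖ ^ 2 ∂P := by
      refine integral_mono (memLp_finsetSum _ fun i _ => hdevm t i).integrable_sq
        (hI.const_mul _) fun ω => ?_
      simpa using sq_sum_le_card_mul_sum_sq (s := Finset.univ)
        (f := fun i => ‖gradDev A Q i (fun k => ξ i k ω) t (x t ω)‖)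
    refine h1.trans ?_
    rw [integral_const_mul, integral_finsetSum _ fun i _ => (hdevm t i).integrable_sq, mul_assoc]
    refine mul_le_mul_of_nonneg_left ?_ hm0.le
    refine (Finset.sum_le_sum fun i _ => hC i t (x t) (hxm t) (hB t)).trans ?_
    simp [hη2, mul_assoc]
  have hLip := Algo.norm_gradient_obj_sub_le hm hgrad hloss
  have hgFc : Continuous (gradient (A.obj Q)) :=
    (LipschitzWith.of_dist_le_mul (K := ⟨L, hL⟩) fun y z => by
      rw [dist_eq_norm, dist_eq_norm]; exact hLip y z).continuous
  refine ⟨x, hxm, hx2, hcons, meanDescent_of_step hxm hx2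
    (w := fun t ω => A.avgNoise p (fun j => ζ j t ω) (fun j => ϑ j t ω))
    (g := fun t ω => A.avgGrad (sample ξ ω) (sample ζ ω) (sample ϑ ω) t) (r := r) (dev := dev)
    hstep hH (fun t G hG hG2 => integral_inner_avgNoise hrate hg hdata hnoise p t hG.measurable hG2)
    hgFc (Algo.norm_gradient_obj_le hm hgrad hloss hbdd) ?_ (hcons.const_mul L)
    (fun t => memLp_finsetSum _ fun i _ => hdevm t i) (by positivity) hdevb hη0 hrb hincr hγz hγz1
    hlam0 hlam2 hlamη⟩
  intro t ω
  rw [Algo.gradient_obj hgrad hloss, Algo.avgGrad, ← smul_sub, ← Finset.sum_sub_distrib]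
  refine Algo.norm_average_le hm fun i => ?_
  -- The gradients are moved from the individual parameters to the average, at the cost of L times
  -- the disagreement; the rest is the deviation at the average.
  have e : A.empGrad (sample ξ ω i) t (A.network (sample ξ ω) (sample ζ ω) (sample ϑ ω) t i).2
      - gradient (A.localObj Q i) (x t ω)
      = (A.empGrad (sample ξ ω i) t (A.network (sample ξ ω) (sample ζ ω) (sample ϑ ω) t i).2
        - A.empGrad (sample ξ ω i) t (x t ω))
        + gradDev A Q i (sample ξ ω i) t (x t ω) := by
    rw [gradDev]; abel
  rw [e]
  refine (norm_add_le _ _).trans (add_le_add ?_ ?_)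
  · refine (norm_empGrad_sub_le hgrad _ t _ _).trans (mul_le_mul_of_nonneg_left ?_ hL)
    exact Finset.single_le_sum (f := fun i =>
      ‖(A.network (sample ξ ω) (sample ζ ω) (sample ϑ ω) t i).2 - x t ω‖)
      (fun _ _ => norm_nonneg _) (Finset.mem_univ i)
  · exact Finset.single_le_sum (f := fun i =>
      ‖gradDev A Q i (fun k => ξ i k ω) t (x t ω)‖) (fun _ _ => norm_nonneg _) (Finset.mem_univ i)

end Average

end OnlineLDP

/-! ### From the average to the individual learners, and the main theorem. -/

namespace OnlineLDP

section Main

variable {m n : ℕ} {Ω Ξ : Type*} [MeasurableSpace Ω] [MeasurableSpace Ξ] {P : Measure Ω}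
  [IsProbabilityMeasure P] {A : Algo m n Ξ} {N : NoiseParams m} {Q : Fin m → Measure Ξ}
  {ξ : Fin m → ℕ → Ω → Ξ} {ζ ϑ : Fin m → ℕ → Ω → Vec n} {κ L cl D : ℝ} {θstar : Vec n}

omit [IsProbabilityMeasure P] in
theorem GradientAssumption.mono {L' : ℝ} (h : GradientAssumption A Q κ L) (hL : L ≤ L') :
    GradientAssumption A Q κ L' :=
  { h with
    lipschitz := fun ξ x y =>
      (h.lipschitz ξ x y).trans (mul_le_mul_of_nonneg_right hL (norm_nonneg _)) }

/-- Convergence of the model parameters in mean square and of the objective values in mean. -/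
theorem tendsto_modelParameters (hcoupling : CouplingAssumption A.R A.C)
    (hrate : RateAssumption A.lam0 A.v N) (hopt : ∀ θ, A.obj Q θstar ≤ A.obj Q θ)
    (hD : 0 ≤ D) (hbdd : ∀ i θ, ‖gradient (A.localObj Q i) θ‖ ≤ D)
    (hconv : ∀ θ₁ θ₂, ∃ μ : ℝ, 0 ≤ μ ∧ ConvexityBound (A.obj Q) μ θ₁ θ₂)
    (hgrad : GradientAssumption A Q κ L) (hdata : DataAssumption P Q ξ)
    (hnoise : NoiseAssumption P N ξ ζ ϑ) (hcl : 0 < cl)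
    (hloss : ∀ θ x, l1norm (A.gradLoss θ x) ≤ cl) (i : Fin m) :
    ((∀ θ₁ θ₂, ∃ μ : ℝ, 0 < μ ∧ ConvexityBound (A.obj Q) μ θ₁ θ₂) →
      (∀ t, Integrable (fun ω =>
        ‖(A.network (sample ξ ω) (sample ζ ω) (sample ϑ ω) t i).2 - θstar‖ ^ 2) P) ∧
      Tendsto (fun t => ∫ ω,
        ‖(A.network (sample ξ ω) (sample ζ ω) (sample ϑ ω) t i).2 - θstar‖ ^ 2 ∂P) atTop (𝓝 0)) ∧
    (∀ t, Integrable (fun ω =>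
      A.obj Q (A.network (sample ξ ω) (sample ζ ω) (sample ϑ ω) t i).2 - A.obj Q θstar) P) ∧
    Tendsto (fun t => ∫ ω,
      (A.obj Q (A.network (sample ξ ω) (sample ζ ω) (sample ϑ ω) t i).2 - A.obj Q θstar) ∂P)
      atTop (𝓝 0) := by
  -- A negative L may be replaced by 0.
  wlog hL : 0 ≤ L generalizing L
  · exact this (hgrad.mono (le_max_left L 0)) (le_max_right L 0)
  have hprob := hdata.isProbabilityMeasure
  have hm := hcoupling.m_pos
  have hg := Algo.measurable_uncurry_gradLoss hgrad.meas hgrad.diff hgrad.lipschitz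
  obtain ⟨x, hxm, hx2, hcons, hdesc⟩ :=
    exists_meanDescent hcoupling hrate hcl hL hbdd hgrad hloss hdata hnoise θstar
  set y : ℕ → Ω → Vec n := fun t ω =>
    (A.network (sample ξ ω) (sample ζ ω) (sample ϑ ω) t i).2 with hy
  have hym : ∀ t, Measurable (y t) := fun t =>
    (measurable_network_sample hg hdata hnoise t i).snd
  have hdiff : SqSummable P fun t ω => ‖y t ω - x t ω‖ := by
    refine hcons.mono (fun t => ((hym t).sub (hxm t)).norm.aestronglyMeasurable) fun t ω => ?_
    rw [abs_norm]
    exact Finset.single_le_sum (f := fun i =>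
      ‖(A.network (sample ξ ω) (sample ζ ω) (sample ϑ ω) t i).2 - x t ω‖)
      (fun _ _ => norm_nonneg _) (Finset.mem_univ i)
  have hF := firstOrderConvex_of_bound hconv
  have hFD := Algo.norm_gradient_obj_le hm hgrad hloss hbdd
  have hFL := Algo.norm_gradient_obj_sub_le hm hgrad hloss
  have hFc : Continuous (gradient (A.obj Q)) :=
    (LipschitzWith.of_dist_le_mul (K := ⟨L, hL⟩) fun y z => by
      rw [dist_eq_norm, dist_eq_norm]; exact hFL y z).continuous
  have hlam : ∀ t, 0 ≤ A.lam t := fun t => (Algo.lam_pos hrate.lam0_pos t).le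
  have hobj := hdesc.tendsto_obj hxm hx2 hF hFD hD hL hFL hFc hopt hlam (not_summable_lam hrate)
  have hy2 : ∀ t, MemLp (fun ω => ‖y t ω - θstar‖) 2 P := fun t => by
    have h1 : MemLp (fun ω => ‖y t ω - x t ω‖ + ‖x t ω - θstar‖) 2 P :=
      (hdiff.memLp t).add (hx2 t)
    exact h1.mono ((hym t).sub_const θstar).norm.aestronglyMeasurable (ae_of_all _ fun ω => by
      rw [norm_norm]
      exact (norm_sub_le_norm_sub_add_norm_sub _ (x t ω) _).trans (le_abs_self _))
  have iF : ∀ z : ℕ → Ω → Vec n, (∀ t, Measurable (z t)) →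
      (∀ t, MemLp (fun ω => ‖z t ω - θstar‖) 2 P) → ∀ t,
      Integrable (fun ω => A.obj Q (z t ω) - A.obj Q θstar) P := fun z hzm hz t =>
    integrable_of_quadratic (ψ := fun y => A.obj Q y - A.obj Q θstar) (hzm t) (hz t)
      ((hF.continuous hFD).sub continuous_const) (abs_obj_sub_le hF hFD hD)
  refine ⟨fun hstrict => ⟨fun t => (hy2 t).integrable_sq, ?_⟩, iF y hym hy2, ?_⟩
  · have hsq := hdesc.tendsto_sq hxm hx2 hF hFD hD hFc hopt hlam hobj fun δ hδ =>
      exists_linear_growth hF hstrict (hF.continuous hFD) hopt hδ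
    refine squeeze_zero (fun t => integral_nonneg fun ω => sq_nonneg _) (fun t => ?_)
      (by simpa using (hdiff.tendsto.const_mul 2).add (hsq.const_mul 2))
    have h1 := (hdiff.memLp t).integrable_sq
    have h2 := (hx2 t).integrable_sq
    rw [← integral_const_mul, ← integral_const_mul,
      ← integral_add (h1.const_mul 2) (h2.const_mul 2)]
    refine integral_mono (hy2 t).integrable_sq ((h1.const_mul 2).add (h2.const_mul 2)) fun ω => ?_
    have h3 := norm_sub_le_norm_sub_add_norm_sub (y t ω) (x t ω) θstar
    have h4 := pow_le_pow_left₀ (norm_nonneg _) h3 2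
    change ‖y t ω - θstar‖ ^ 2 ≤ 2 * ‖y t ω - x t ω‖ ^ 2 + 2 * ‖x t ω - θstar‖ ^ 2
    nlinarith [sq_nonneg (‖y t ω - x t ω‖ - ‖x t ω - θstar‖)]
  · refine squeeze_zero (fun t => integral_nonneg fun ω => sub_nonneg.2 (hopt _)) (fun t => ?_)
      (by simpa using ((hdiff.tendsto_integral fun t ω => norm_nonneg _).const_mul D).add hobj)
    have h1 : Integrable (fun ω => ‖y t ω - x t ω‖) P := (hdiff.memLp t).integrable one_le_two
    rw [← integral_const_mul, ← integral_add (h1.const_mul D) (iF x hxm hx2 t)]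
    refine integral_mono (iF y hym hy2 t) ((h1.const_mul D).add (iF x hxm hx2 t)) fun ω => ?_
    have h2 := hF.sub_le hFD (y t ω) (x t ω)
    change A.obj Q (y t ω) - _ ≤ D * ‖y t ω - x t ω‖ + (A.obj Q (x t ω) - _)
    linarith

end Main

end OnlineLDP

theorem theorem4 {m n : ℕ} {Ω Ξ : Type*} [MeasurableSpace Ω] [MeasurableSpace Ξ]
    (P : Measure Ω) [IsProbabilityMeasure P]
    (A : OnlineLDP.Algo m n Ξ) (N : OnlineLDP.NoiseParams m)
    (Q : Fin m → Measure Ξ)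
    (ξ : Fin m → ℕ → Ω → Ξ) (ζ ϑ : Fin m → ℕ → Ω → OnlineLDP.Vec n)
    (D κ L cl : ℝ) (θstar : OnlineLDP.Vec n)
    (hcoupling : OnlineLDP.CouplingAssumption A.R A.C)
    (hrate : OnlineLDP.RateAssumption A.lam0 A.v N)
    -- `θstar` is an optimal solution
    (hopt : ∀ θ, A.obj Q θstar ≤ A.obj Q θ)
    -- bounded gradients of the local objectives
    (hD : 0 < D) (hbdd : ∀ i θ, ‖gradient (A.localObj Q i) θ‖ ≤ D)
    -- convexity of the global objective
    (hconv : ∀ θ₁ θ₂, ∃ μ : ℝ, 0 ≤ μ ∧ OnlineLDP.ConvexityBound (A.obj Q) μ θ₁ θ₂)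
    (hgrad : OnlineLDP.GradientAssumption A Q κ L)
    (hdata : OnlineLDP.DataAssumption P Q ξ)
    (hnoise : OnlineLDP.NoiseAssumption P N ξ ζ ϑ)
    -- bounded gradients of the loss
    (hcl : 0 < cl) (hloss : ∀ θ x, OnlineLDP.l1norm (A.gradLoss θ x) ≤ cl) :
    -- the model parameters `θ_{i,t}` of the algorithm
    let θ : Fin m → ℕ → Ω → OnlineLDP.Vec n := fun i t ω =>
      (A.network (fun j k => ξ j k ω) (fun j k => ζ j k ω) (fun j k => ϑ j k ω) t i).2
    -- Laplace parameters and cumulative privacy budgets of learner `i`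
    let νζ : Fin m → ℕ → ℝ := fun i => OnlineLDP.noiseScale (N.σζ i) (N.ςζ i)
    let νϑ : Fin m → ℕ → ℝ := fun i => OnlineLDP.noiseScale (N.σϑ i) (N.ςϑ i)
    let εs : Fin m → ℕ → ℝ≥0∞ := fun i => OnlineLDP.budget (A.sensS i) (νζ i)
    let εθ : Fin m → ℕ → ℝ≥0∞ := fun i => OnlineLDP.budget (A.sensθ i) (νϑ i)
    let εtot : Fin m → ℝ≥0∞ := fun i => ⨆ T, (εs i T + εθ i T)
    -- convergence in mean square, in the case `μ > 0`
    ((∀ θ₁ θ₂, ∃ μ : ℝ, 0 < μ ∧ OnlineLDP.ConvexityBound (A.obj Q) μ θ₁ θ₂) →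
      ∀ i, (∀ t, Integrable (fun ω => ‖θ i t ω - θstar‖ ^ 2) P) ∧
        Tendsto (fun t => ∫ ω, ‖θ i t ω - θstar‖ ^ 2 ∂P) atTop (𝓝 0)) ∧
    -- convergence in mean of the objective values, in the general convex case
    (∀ i, (∀ t, Integrable (fun ω => A.obj Q (θ i t ω) - A.obj Q θstar) P) ∧
      Tendsto (fun t => ∫ ω, (A.obj Q (θ i t ω) - A.obj Q θstar) ∂P) atTop (𝓝 0)) ∧
    -- the vector `u` and the constants `cz`, `γz` of the explicit bound exist
    (∃! u, OnlineLDP.IsLeftPerron A.R u) ∧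
    (∀ u, OnlineLDP.IsLeftPerron A.R u → ∃ cz γz, OnlineLDP.IsEigenRate A.R u cz γz) ∧
    -- 1) local differential privacy over any finite horizon, with an explicit budget bound
    (∀ i T,
      OnlineLDP.IsLDP P (A.implementation i (ζ i) (ϑ i) T) (εs i T + εθ i T).toReal ∧
      εs i T ≤ ENNReal.ofReal (∑ t ∈ Finset.Icc 1 T,
        √2 * A.rhoS cl t * ((t : ℝ) + 1) ^ (N.ςζ i) / N.σζ i) ∧
      ∀ u cz γz, OnlineLDP.IsLeftPerron A.R u → OnlineLDP.IsEigenRate A.R u cz γz →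
        εθ i T ≤ ENNReal.ofReal (∑ t ∈ Finset.Icc 1 T,
          √2 * A.rhoθ cl cz γz (u i) t * ((t : ℝ) + 1) ^ (N.ςϑ i) / N.σϑ i)) ∧
    -- 2) the cumulative budget stays finite as the horizon tends to infinity
    (∀ i, εtot i < ∞ ∧
      ∀ T, OnlineLDP.IsLDP P (A.implementation i (ζ i) (ϑ i) T) (εtot i).toReal) := by
  intro θ νζ νϑ εs εθ εtot
  -- A data stream is needed below: nonnegativity of ϱ is read off from its bounding a norm, for a
  -- stream compared with itself.
  have hΞ : Nonempty (ℕ → Ξ) := by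
    obtain ⟨ω⟩ := nonempty_of_isProbabilityMeasure P
    exact ⟨fun k => ξ ⟨0, hcoupling.m_pos⟩ k ω⟩
  obtain ⟨D₀⟩ := hΞ
  have hl := hrate.lam0_pos
  have hconvg := OnlineLDP.tendsto_modelParameters hcoupling hrate hopt hD.le hbdd hconv hgrad hdata hnoise
    hcl hloss
  have hfin : ∀ i, ∃ B : ℝ, ∀ T, εs i T + εθ i T ≤ ENNReal.ofReal B :=
    OnlineLDP.Algo.exists_budgets_le hcoupling hrate hcl.le hloss (le_max_right L 0)
      (hgrad.mono (le_max_left L 0)).lipschitz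
  have htot : ∀ i, εtot i < ∞ := fun i => by
    obtain ⟨B, hB⟩ := hfin i
    exact (iSup_le hB).trans_lt ENNReal.ofReal_lt_top
  refine ⟨fun hstrict i => (hconvg i).1 hstrict, fun i => (hconvg i).2,
    hcoupling.existsUnique_isLeftPerron, fun u hu => hcoupling.exists_isEigenRate hu,
    fun i T => ⟨?_, ?_, fun u cz γz _ hr => ?_⟩, fun i => ⟨htot i, fun T => ?_⟩⟩
  · have h : εs i T + εθ i T ≤ εtot i := le_iSup (fun T => εs i T + εθ i T) T
    exact OnlineLDP.isLDP_implementation hrate hnoise i T (h.trans_lt (htot i)).ne le_rfl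
  · refine OnlineLDP.budget_le (hrate.σζ_pos i) (fun t => ?_)
      (OnlineLDP.Algo.sensS_le hcoupling hl hloss i) T
    exact (OnlineLDP.l1norm_nonneg _).trans
      (OnlineLDP.Algo.l1norm_learner_fst_le hcoupling hl hloss i D₀ D₀ 0 t)
  · refine OnlineLDP.budget_le (hrate.σϑ_pos i) (fun t => ?_)
      (OnlineLDP.Algo.sensθ_le hcoupling hl hloss hr i) T
    exact (OnlineLDP.l1norm_nonneg _).trans
      (OnlineLDP.Algo.l1norm_learner_snd_le hcoupling hl hloss hr i D₀ D₀ 0 t)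
  · exact OnlineLDP.isLDP_implementation hrate hnoise i T (htot i).ne
      (le_iSup (fun T => εs i T + εθ i T) T)
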